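/- **Setting.** Let $T\ge 2$ and $p\ge1$. A multistage stochastic linear program has feasible regions $\mathcal X_t(x_{t-1},\xi_t)=\{x_t\in\mathbb R^{d_t}_+ : A_tx_t+B_tx_{t-1}=b_t\}$, where $c_t,b_t,A_t,B_t$ are continuous functions of $\xi_t\in\mathbb R^p$ (for instance coordinates and constants), and $x_0$, $\xi_1$ are given. Write $$Q_t(x_{t-1},\xi_t)=\min_{x_t\in\mathcal X_t(x_{t-1},\xi_t)}\Big\{c_t^\top x_t+\mathbb E[Q_{t+1}(x_t,\tilde\xi_{t+1})\mid\xi_t]\Big\},\qquad Q_{T+1}\equiv0,$$ and $v=Q_1(x_0,\xi_1)$. Given $N$ independent trajectories $(\xi^i_1,\dots,\xi^i_T)$, $i\le N$, of the data process, let $\hat Q_t$ and $\hat v_N=\hat Q_1(x_0,\xi_1)$ be defined by the same recursion with $\mathbb E[\,\cdot\mid\xi_t]$ replaced by the Nadaraya–Watson estimate $$\hat{\mathbb E}[\varphi(\tilde\xi_{t+1})\mid\xi_t]=\sum_{i}\frac{\mathcal K((\xi_t-\xi_t^i)/h_N)}{\sum_j\mathcal K((\xi_t-\xi_t^j)/h_N)}\,\varphi(\xi^i_{t+1}),\qquad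 \mathcal K(\rho)=e^{-\|\rho\|_2}.$$ **Assumptions.** The process is Markov, $\xi_1$ is deterministic, $\xi_t$ takes values in a compact set $\Xi_t$ (with $\Xi_1=\{\xi_1\}$). For every $t\le T$, the region $\mathcal X_t(x_{t-1},\xi_t)$ is nonempty and compact for all $\xi_t\in\Xi_t$ and all feasible $x_{t-1}$ (those reachable from $x_0$ by decisions $x_s\in\mathcal X_s(x_{s-1},\xi_s)$, $\xi_s\in\Xi_s$). For $2\le t<T$ the pair $(\xi_t,\xi_{t+1})$ has a joint density $f_t\ge 0$ on $\mathbb R^p\times\mathbb R^p$ that is $C^2$ with bounded first and second derivatives; $f_t(\xi)$ also denotes the marginal density $\int f_t(\xi,\xi')\,d\xi'$ of $\xi_t$. The bandwidth is of the order $N^{-1/(p+4)}$: $h_N=O(N^{-1/(p+4)})$ and, for some $c>0$, $h_N\ge c\,N^{-1/(p+4)}$ for all large $N$. **Constants.** Let $\sigma_t,L_t>0$ $(2\le t\le T)$ and $D_t>0$ $(1\le t\le T)$ be such that: the conditional variance of $Q_t(x_{t-1},\tilde\xi_t)$ given $\xi_{t-1}$ is at most $\sigma_t^2$ for almost every $\xi_{t-1}$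 and all feasible $x_{t-1}\in\mathcal X_{t-1}(x_{t-2},\xi_{t-1})$; $Q_t(\cdot,\xi_t)$ is $L_t$-Lipschitz on the feasible decisions $x_{t-1}$, for almost every $\xi_t$; every $\mathcal X_t(x_{t-1},\xi_t)$ with $\xi_t\in\Xi_t$ and $x_{t-1}$ feasible has diameter at most $D_t$. For $2\le t\le T-1$ put $g_t=\min_{i\le N}f_t(\xi_t^i)\big/\big(2\int_{\mathbb R^p}\mathcal K^2\big)$, and let $g_1>0$ be any constant. Put $L_{\max}=\max_{2\le t\le T}L_t$, $\sigma^2_{\max}=\max_{2\le t\le T}\sigma_t^2$, $g_{\min}=\min_{1\le t\le T-1}g_t$, $D_{\max}=\max_{1\le t\le T}(D_t/\eta)^{d_t}$, $\delta_{\min}=\min_{2\le t\le T}\delta_t$. The square root of a negative number is read as $0$. **Claim.** There is a constant $C\ge1$ (the $O(1)$) such that for all $\delta_2,\dots,\delta_T\in(0,1)$ the following hold. (a) There is a deterministic sequence $\varepsilon_N\to0$ (the $o(1)$) such that for all sufficiently large $N$ and every $\eta>0$, with probability at least $1-\sum_{t=2}^T\delta_t$, $$|v-\hat v_N|\ \le\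 \varphi:=\sum_{t=2}^T\left(\sqrt{\sigma_t^2\,\frac{\log\big(C N^{t-2}\prod_{s=1}^{t-1}(D_s/\eta)^{d_s}/\delta_t\big)}{N h_N^p\,g_{t-1}(1+\varepsilon_N)}}+2L_t\eta\right)$$ $$\le\ \frac{T}{N^{2/(p+4)}}\sqrt{\frac{\sigma_{\max}^2}{c^p g_{\min}(1+\varepsilon_N)}\log\Big(\frac{C N^{T-2}D_{\max}^{T-1}}{\delta_{\min}}\Big)}+2L_{\max}T\eta$$ $$\le\ \frac{T^{3/2}}{N^{2/(p+4)}}\sqrt{\frac{\sigma_{\max}^2}{c^p g_{\min}(1+\varepsilon_N)}\log\Big(\frac{C N\max\{1,D_{\max}\}}{\delta_{\min}}\Big)}+2L_{\max}T\eta .$$ (b) There is a constant $K>0$, depending on the problem and on the $\delta_t$ but not on $N$, such that for all sufficiently large $N$, with probability at least $1-\sum_{t=2}^T\delta_t$, $$|v-\hat v_N|\le K\,\frac{T^{3/2}}{N^{2/(p+4)}}\sqrt{\log N}.$$ -/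

import Mathlib

open MeasureTheory ProbabilityTheory Filter Topology

noncomputable section

namespace DDMSLP

/-- The space `ℝ^p` of stage parameter vectors, with the Euclidean norm and Lebesgue measure. -/
abbrev E (p : ℕ) : Type := EuclideanSpace ℝ (Fin p)

/-- A multistage stochastic linear program.  Stage `t` has a decision in `ℝ^(d t)` and `m t`
equality constraints.  The entries of the cost vector, right-hand side, technology matrix and
recourse matrix of a stage are continuous functions of the parameter vector `ξ ∈ ℝ^p` of that stage
(coordinate functions for random entries, constants for deterministic entries).
`B t` is the matrix of stage `t + 1`; it acts on the decision of stage `t`. -/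
structure Program (p : ℕ) where
  d : ℕ → ℕ
  m : ℕ → ℕ
  c : (t : ℕ) → E p → Fin (d t) → ℝ
  b : (t : ℕ) → E p → Fin (m t) → ℝ
  A : (t : ℕ) → E p → Matrix (Fin (m t)) (Fin (d t)) ℝ
  B : (t : ℕ) → E p → Matrix (Fin (m (t + 1))) (Fin (d t)) ℝ
  continuous_c : ∀ t, Continuous (c t)
  continuous_b : ∀ t, Continuous (b t)
  continuous_A : ∀ t, Continuous (A t)
  continuous_B : ∀ t, Continuous (B t)
  /-- the given initial state -/
  x₀ : EuclideanSpace ℝ (Fin (d 0))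
  /-- the deterministic first-stage parameter vector -/
  ξ₁ : E p

variable {p : ℕ}

/-- Decisions of stage `t`. -/
abbrev Program.Dec (prog : Program p) (t : ℕ) : Type := EuclideanSpace ℝ (Fin (prog.d t))

/-- The feasible region of stage `t + 1`:
`{y ≥ 0 : A_{t+1} y + B_{t+1} x = b_{t+1}}`, where `x` is the decision of stage `t` and `ξ` the
parameter vector of stage `t + 1`. -/
def Program.feasible (prog : Program p) (t : ℕ) (x : prog.Dec t) (ξ : E p) : Set (prog.Dec (t + 1)) :=
  {y | (∀ j, 0 ≤ y j) ∧
    (prog.A (t + 1) ξ).mulVec y.ofLp + (prog.B t ξ).mulVec x.ofLp = prog.b (t + 1) ξ}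

/-- The feasible decisions of stage `t`: those that can be reached from `x₀` by decisions that are
feasible for some parameter vectors in the uncertainty sets `Ξ 1, …, Ξ t`. -/
def Program.reach (prog : Program p) (Ξ : ℕ → Set (E p)) : (t : ℕ) → Set (prog.Dec t)
  | 0 => {prog.x₀}
  | t + 1 => {y | ∃ x ∈ prog.reach Ξ t, ∃ ξ ∈ Ξ (t + 1), y ∈ prog.feasible t x ξ}

/-- Bellman recursion for a given family `Ex` of conditional expectations, where
`Ex t ξ φ` stands for the expectation of `φ(ξ_{t+1})` given `ξ_t = ξ`.
With `k` stages to go, `costToGo Ex k t x ξ` is the cost-to-go of stages `t + 1, …, t + k`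
when the decision of stage `t` is `x` and the parameter vector of stage `t + 1` is `ξ`. -/
def Program.costToGo (prog : Program p) (Ex : ℕ → E p → (E p → ℝ) → ℝ) :
    (k t : ℕ) → prog.Dec t → E p → ℝ
  | 0, _, _, _ => 0
  | k + 1, t, x, ξ =>
      sInf ((fun y : prog.Dec (t + 1) =>
        prog.c (t + 1) ξ ⬝ᵥ y.ofLp
          + Ex (t + 1) ξ (fun ξ' => prog.costToGo Ex k (t + 1) y ξ')) '' prog.feasible t x ξ)

/-- Optimal value of the `T`-stage problem:
`min {c₁ᵀ x₁ + Ex[Q₂(x₁, ξ₂) | ξ₁] : x₁ ∈ X₁(x₀, ξ₁)}`. -/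
def Program.optVal (prog : Program p) (T : ℕ) (Ex : ℕ → E p → (E p → ℝ) → ℝ) : ℝ :=
  prog.costToGo Ex T 0 prog.x₀ prog.ξ₁

/-! ### The true conditional distributions -/

/-- The marginal density of `ξ_t`, if `f t` is the joint density of `(ξ_t, ξ_{t+1})`. -/
def marginal (f : ℕ → E p × E p → ℝ) (t : ℕ) (ξ : E p) : ℝ := ∫ ξ', f t (ξ, ξ')

/-- The conditional distribution of `ξ_{t+1}` given `ξ_t = ξ`.  The first stage is deterministic,
so that for `t = 1` this is the distribution of `ξ₂`; for `t ≥ 2` it has the density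
`f t (ξ, ·) / marginal f t ξ`. -/
def condLaw (μ : Measure (ℕ → E p)) (f : ℕ → E p × E p → ℝ) (t : ℕ) (ξ : E p) : Measure (E p) :=
  if t ≤ 1 then μ.map (fun y => y 2)
  else volume.withDensity (fun ξ' => ENNReal.ofReal (f t (ξ, ξ') / marginal f t ξ))

/-- The true conditional expectation of `φ(ξ_{t+1})` given `ξ_t = ξ`. -/
def trueEx (μ : Measure (ℕ → E p)) (f : ℕ → E p × E p → ℝ) (t : ℕ) (ξ : E p) (φ : E p → ℝ) : ℝ :=
  ∫ ξ', φ ξ' ∂(condLaw μ f t ξ)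

/-- The Markov property at stages `1, …, T`: the conditional distribution of `ξ_{t+1}` given
`ξ_1, …, ξ_t` is the one given `ξ_t`. -/
def IsMarkov (μ : Measure (ℕ → E p)) (T : ℕ) : Prop :=
  ∀ t, 1 ≤ t → t < T → ∀ S : Set (E p), MeasurableSet S →
    μ[((fun y : ℕ → E p => y (t + 1)) ⁻¹' S).indicator (fun _ => (1 : ℝ)) |
        ⨆ s ∈ Set.Icc 1 t, MeasurableSpace.comap (fun y : ℕ → E p => y s) inferInstance]
      =ᵐ[μ]
    μ[((fun y : ℕ → E p => y (t + 1)) ⁻¹' S).indicator (fun _ => (1 : ℝ)) |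
        MeasurableSpace.comap (fun y : ℕ → E p => y t) inferInstance]

/-- Assumptions on the true problem.  `μ` is the distribution of the data process
`(ξ_1, ξ_2, …)`, of which only the stages `1, …, T` matter; `Ξ t` is the uncertainty set of stage
`t`; `f t` is the joint density of `(ξ_t, ξ_{t+1})` for `2 ≤ t < T`. -/
structure Assumptions (prog : Program p) (T : ℕ) (Ξ : ℕ → Set (E p)) (μ : Measure (ℕ → E p))
    (f : ℕ → E p × E p → ℝ) : Prop where
  /-- the first stage is deterministic -/
  first : Ξ 1 = {prog.ξ₁}
  supported : ∀ t ∈ Set.Icc 1 T, ∀ᵐ y ∂μ, y t ∈ Ξ t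
  markov : IsMarkov μ T
  /-- relatively complete recourse, with compact feasible regions -/
  recourse : ∀ t < T, ∀ x ∈ prog.reach Ξ t, ∀ ξ ∈ Ξ (t + 1),
    (prog.feasible t x ξ).Nonempty ∧ IsCompact (prog.feasible t x ξ)
  compact : ∀ t ∈ Set.Icc 1 T, IsCompact (Ξ t)
  density_nonneg : ∀ t, 2 ≤ t → t < T → ∀ z, 0 ≤ f t z
  density : ∀ t, 2 ≤ t → t < T →
    μ.map (fun y => (y t, y (t + 1))) = volume.withDensity (fun z => ENNReal.ofReal (f t z))
  density_smooth : ∀ t, 2 ≤ t → t < T → ContDiff ℝ 2 (f t)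
  density_bounded : ∀ t, 2 ≤ t → t < T → ∃ M : ℝ, ∀ z,
    ‖iteratedFDeriv ℝ 1 (f t) z‖ ≤ M ∧ ‖iteratedFDeriv ℝ 2 (f t) z‖ ≤ M

/-- `σ t ^ 2` (`2 ≤ t ≤ T`) bounds the conditional variance of the true cost-to-go of stage `t`
given the parameters of stage `t - 1`. -/
def IsVarianceBound (prog : Program p) (T : ℕ) (Ξ : ℕ → Set (E p)) (μ : Measure (ℕ → E p))
    (f : ℕ → E p × E p → ℝ) (σ : ℕ → ℝ) : Prop :=
  ∀ t < T - 1, ∀ᵐ y ∂μ, ∀ x ∈ prog.reach Ξ t, ∀ x' ∈ prog.feasible t x (y (t + 1)),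
    variance (fun ξ' => prog.costToGo (trueEx μ f) (T - (t + 1)) (t + 1) x' ξ')
      (condLaw μ f (t + 1) (y (t + 1))) ≤ σ (t + 2) ^ 2

/-- `L t` (`2 ≤ t ≤ T`) is a Lipschitz constant of the true cost-to-go of stage `t` as a function of
the feasible decision of stage `t - 1`, for almost every parameter vector of stage `t`. -/
def IsLipschitzBound (prog : Program p) (T : ℕ) (Ξ : ℕ → Set (E p)) (μ : Measure (ℕ → E p))
    (f : ℕ → E p × E p → ℝ) (L : ℕ → ℝ) : Prop :=
  ∀ t, 1 ≤ t → t < T → ∀ᵐ y ∂μ, ∀ x ∈ prog.reach Ξ t, ∀ x' ∈ prog.reach Ξ t,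
    |prog.costToGo (trueEx μ f) (T - t) t x (y (t + 1))
      - prog.costToGo (trueEx μ f) (T - t) t x' (y (t + 1))| ≤ L (t + 1) * ‖x - x'‖

/-- `D t` (`1 ≤ t ≤ T`) bounds the diameter of every feasible region of stage `t`. -/
def IsDiameterBound (prog : Program p) (T : ℕ) (Ξ : ℕ → Set (E p)) (D : ℕ → ℝ) : Prop :=
  ∀ t < T, ∀ x ∈ prog.reach Ξ t, ∀ ξ ∈ Ξ (t + 1),
    ∀ y ∈ prog.feasible t x ξ, ∀ y' ∈ prog.feasible t x ξ, ‖y - y'‖ ≤ D (t + 1)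

/-! ### The Nadaraya-Watson estimator -/

/-- The exponential kernel. -/
def kern (ρ : E p) : ℝ := Real.exp (-‖ρ‖)

/-- The Nadaraya-Watson weight of trajectory `i` at stage `t`; `data i t` is the parameter vector of
stage `t` in trajectory `i`, and the trajectories `0, …, N - 1` are used with bandwidth `h`. -/
def nwWeight (data : ℕ → ℕ → E p) (N : ℕ) (h : ℝ) (t : ℕ) (ξ : E p) (i : ℕ) : ℝ :=
  kern (h⁻¹ • (ξ - data i t)) / ∑ j ∈ Finset.range N, kern (h⁻¹ • (ξ - data j t))

/-- The estimated conditional expectation of `φ(ξ_{t+1})` given `ξ_t = ξ`. -/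
def nwEx (data : ℕ → ℕ → E p) (N : ℕ) (h : ℝ) (t : ℕ) (ξ : E p) (φ : E p → ℝ) : ℝ :=
  ∑ i ∈ Finset.range N, nwWeight data N h t ξ i * φ (data i (t + 1))

/-- The out-of-sample error: the distance between the optimal values of the true problem and of the
discretized problem. -/
def outOfSampleError (prog : Program p) (T : ℕ) (μ : Measure (ℕ → E p)) (f : ℕ → E p × E p → ℝ)
    (data : ℕ → ℕ → E p) (N : ℕ) (h : ℝ) : ℝ :=
  |prog.optVal T (trueEx μ f) - prog.optVal T (nwEx data N h)|

/-- The scaled marginal density of `ξ_t`. -/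
def scaledDensity (f : ℕ → E p × E p → ℝ) (t : ℕ) (ξ : E p) : ℝ :=
  marginal f t ξ / (2 * ∫ ρ : E p, kern ρ ^ 2)

/-- The least scaled marginal density of stage `t` over the `N` data points.  The deterministic
first stage has no density, and a constant `g₁` takes its place. -/
def minDensity (f : ℕ → E p × E p → ℝ) (g₁ : ℝ) (data : ℕ → ℕ → E p) (N t : ℕ) : ℝ :=
  if t ≤ 1 then g₁ else ⨅ i : Fin N, scaledDensity f t (data i t)

/-! ### The bounds -/

/-- The largest value of `u` on a finite set of stages. -/
def maxOver (s : Finset ℕ) (u : ℕ → ℝ) : ℝ := ⨆ t : s, u t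

/-- The least value of `u` on a finite set of stages. -/
def minOver (s : Finset ℕ) (u : ℕ → ℝ) : ℝ := ⨅ t : s, u t

/-- The error term `φ` of the out-of-sample guarantee.  `C` is the `O(1)` and `ε` the `o(1)`. -/
def errorTerm (p T : ℕ) (d : ℕ → ℕ) (σ L D δ g : ℕ → ℝ) (η C ε : ℝ) (N : ℕ) (h : ℝ) : ℝ :=
  ∑ t ∈ Finset.Icc 2 T,
    (Real.sqrt (σ t ^ 2 *
        (Real.log (C * (N : ℝ) ^ (t - 2) * (∏ s ∈ Finset.Icc 1 (t - 1), (D s / η) ^ d s) / δ t)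
          / (N * h ^ p * (g (t - 1) * (1 + ε)))))
      + 2 * L t * η)

/-- `D_max = max_t (D_t / η) ^ d_t`. -/
def dMax (T : ℕ) (d : ℕ → ℕ) (D : ℕ → ℝ) (η : ℝ) : ℝ :=
  maxOver (Finset.Icc 1 T) (fun t => (D t / η) ^ d t)

/-- The asymptotic upper bound on the error term, for bandwidths of at least
`c * N ^ (-1 / (p + 4))`. -/
def asymptoticBound (p T : ℕ) (d : ℕ → ℕ) (σ L D δ g : ℕ → ℝ) (c η C ε : ℝ) (N : ℕ) : ℝ :=
  T / (N : ℝ) ^ ((2 : ℝ) / (p + 4)) *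
      Real.sqrt (maxOver (Finset.Icc 2 T) (fun t => σ t ^ 2)
          / (c ^ p * minOver (Finset.Icc 1 (T - 1)) g * (1 + ε)) *
        Real.log (C * (N : ℝ) ^ (T - 2) * dMax T d D η ^ (T - 1) / minOver (Finset.Icc 2 T) δ))
    + 2 * maxOver (Finset.Icc 2 T) L * T * η

/-- The form of the bound that shows the dependence `T ^ (3 / 2) / N ^ (2 / (p + 4))`
up to a logarithmic factor in which `T` is not an exponent. -/
def rateBound (p T : ℕ) (d : ℕ → ℕ) (σ L D δ g : ℕ → ℝ) (c η C ε : ℝ) (N : ℕ) : ℝ :=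
  (T : ℝ) ^ ((3 : ℝ) / 2) / (N : ℝ) ^ ((2 : ℝ) / (p + 4)) *
      Real.sqrt (maxOver (Finset.Icc 2 T) (fun t => σ t ^ 2)
          / (c ^ p * minOver (Finset.Icc 1 (T - 1)) g * (1 + ε)) *
        Real.log (C * N * max 1 (dMax T d D η) / minOver (Finset.Icc 2 T) δ))
    + 2 * maxOver (Finset.Icc 2 T) L * T * η

end DDMSLP

end

/-! The argument has two independent halves: a rate for the out-of-sample error, and a lower bound
for the error term `φ` that exceeds this rate. Write `r = N ^ (-1 / (p + 4))` for the order of the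
bandwidth.

Rate. With probability tending to one, `|v - v̂_N| ≤ a √(log N / N) + A r² √(log N)`, with `A = 0`
when `T = 2` (`exists_whp_outOfSampleError_le`). At a stage `2 ≤ t < T`, the numerator and the
denominator of the Nadaraya-Watson estimate of the true cost-to-go are sums of `N` independent
bounded terms with second moment of order `h ^ p`. A Chernoff bound, a union bound over a net of
polynomial size and a Lipschitz estimate give a deviation of order `√(N h ^ p log N)`, uniformly in
the feasible decision and in `ξ` (`tendsto_measure_uniform_deviation`). The kernel is even and the
joint density has bounded second differences, so the bias is of order `N h ^ (p + 2)`
(`abs_integral_kern_mul_sub_le`). The bandwidth balances the two up to `√(log N)`.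

The density may come arbitrarily close to zero, so the kernel sum `F(ξ)` in the denominator has no
useful uniform lower bound. The estimation error is therefore kept in the form `constant / F(ξ)`
(`whp_trueEx_sub_nwEx`) and is propagated through the Bellman recursion as a sum over the data
points, not as a supremum. Two deterministic inequalities, valid for data in arbitrary position,
make this work: `∑ i, 1 / F(x i)` is at most of order `h ^ (-p)` for points in a bounded set
(`sum_inv_kernelSum_le`), and the column sums of the weight matrix are bounded (`sum_weight_le`).
All first-stage weights equal `1 / N`, so exactly the mean of the errors of the next stage enters
the final error (`exists_outOfSampleError_le`). The first-stage expectation itself is estimated by a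
plain average, with error of order `√(log N / N)`.

Lower bound for `φ`, with `ε = 0` (`eventually_le_errorTerm`). If `η > 1`, the summand `2 L₂ η`
already exceeds a quantity that tends to zero. Let `η ≤ 1`. If `T ≥ 3`, the continuous, compactly
supported density of `ξ₂` takes arbitrarily small positive values on open sets, so the minimum `g₂`
over the sample tends to zero in probability (`whp_minDensity_le`). The summand `t = 3`, which
contains `1 / √g₂`, then exceeds any prescribed multiple of `r² √(log N)`. If `T = 2`, the summand
`t = 2` is at least of order `r²`, and `√(log N / N) = r² √(log N · r ^ p)` is of smaller order
because `p ≥ 1`.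

Each of these events has a complement whose probability tends to zero, hence is eventually below the
positive number `∑ δ t`. The two remaining inequalities of (a) are elementary comparisons of
logarithms, and (b) is the rate itself, since `T ^ (3 / 2) ≥ 1`. -/

namespace DDMSLP

/-! ### Polynomial covering numbers -/

/-- The covering numbers of `S` at scale `1 / M` grow at most polynomially in `M`. -/
def HasPolyCover {α : Type*} [PseudoMetricSpace α] (S : Set α) : Prop :=
  ∃ C D : ℕ, ∀ M : ℕ, 1 ≤ M → ∃ F : Finset α, (F : Set α) ⊆ S ∧ F.card ≤ C * M ^ D ∧
    ∀ x ∈ S, ∃ y ∈ F, dist x y ≤ 1 / M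

theorem HasPolyCover.prod {α β : Type*} [PseudoMetricSpace α] [PseudoMetricSpace β]
    {S : Set α} {S' : Set β} (h : HasPolyCover S) (h' : HasPolyCover S') :
    HasPolyCover (S ×ˢ S') := by
  obtain ⟨C, D, h⟩ := h
  obtain ⟨C', D', h'⟩ := h'
  refine ⟨C * C', D + D', fun M hM => ?_⟩
  obtain ⟨F, hF, hc, hd⟩ := h M hM
  obtain ⟨F', hF', hc', hd'⟩ := h' M hM
  refine ⟨F ×ˢ F', ?_, ?_, ?_⟩
  · rw [Finset.coe_product]
    exact Set.prod_mono hF hF'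
  · rw [Finset.card_product]
    calc F.card * F'.card ≤ (C * M ^ D) * (C' * M ^ D') := Nat.mul_le_mul hc hc'
      _ = C * C' * M ^ (D + D') := by ring
  · rintro ⟨x, x'⟩ ⟨hx, hx'⟩
    obtain ⟨y, hy, hxy⟩ := hd x hx
    obtain ⟨y', hy', hxy'⟩ := hd' x' hx'
    exact ⟨(y, y'), Finset.mem_product.2 ⟨hy, hy'⟩, max_le hxy hxy'⟩

/-- Points of one grid cell of side `r` are compared. The factor `n + 1` is a crude replacement for
`√n`. -/
theorem dist_le_of_floor_eq {n : ℕ} {r : ℝ} (hr : 0 < r) {x y : EuclideanSpace ℝ (Fin n)}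
    (h : ∀ i, ⌊x i / r⌋ = ⌊y i / r⌋) : dist x y ≤ (n + 1) * r := by
  have hi : ∀ i, dist (x i) (y i) ^ 2 ≤ r ^ 2 := fun i => by
    have h1 := Int.abs_sub_lt_one_of_floor_eq_floor (h i)
    rw [← sub_div, abs_div, abs_of_pos hr, div_lt_one hr] at h1
    rw [Real.dist_eq]
    gcongr
  rw [EuclideanSpace.dist_eq]
  refine Real.sqrt_le_iff.2 ⟨by positivity, ?_⟩
  calc ∑ i, dist (x i) (y i) ^ 2 ≤ ∑ _i : Fin n, r ^ 2 := Finset.sum_le_sum fun i _ => hi i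
    _ = n * r ^ 2 := by simp
    _ ≤ ((n + 1) * r) ^ 2 := by nlinarith [sq_nonneg r, (Nat.cast_nonneg n : (0 : ℝ) ≤ n)]

/-- Cut the space into cubes and pick one point of `S` in every cube that meets `S`. The net lies
inside `S`, as it must: the random functions to be controlled have bounds and measurability only for
indices in `S`. -/
theorem hasPolyCover_of_isBounded {n : ℕ} {S : Set (EuclideanSpace ℝ (Fin n))}
    (hS : Bornology.IsBounded S) : HasPolyCover S := by
  classical
  obtain ⟨R, hR⟩ := hS.exists_norm_le
  obtain ⟨R', hR'⟩ := exists_nat_ge R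
  -- Each coordinate of a cell index lies in `[-b, b]` with `b = (n + 1) R' M + 1`, which leaves `2
  -- (n + 1) R' M + 3 ≤ (2 (n + 1) R' + 3) M` values.
  refine ⟨(2 * ((n + 1) * R') + 3) ^ n, n, fun M hM => ?_⟩
  have hM' : (1 : ℝ) ≤ M := by exact_mod_cast hM
  set r : ℝ := 1 / ((n + 1) * M) with hr_def
  have hr : 0 < r := by positivity
  set φ : EuclideanSpace ℝ (Fin n) → Fin n → ℤ := fun x i => ⌊x i / r⌋ with hφ
  set b : ℤ := (((n + 1) * R' * M + 1 : ℕ) : ℤ) with hb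
  set G : Finset (Fin n → ℤ) := Fintype.piFinset fun _ => Finset.Icc (-b) b with hG
  have hmem : ∀ x ∈ S, φ x ∈ G := fun x hx => by
    refine Fintype.mem_piFinset.2 fun i => Finset.mem_Icc.2 ?_
    have h1 : |x i| ≤ R' := (PiLp.norm_apply_le x i).trans ((hR x hx).trans hR')
    have h2 : |x i / r| ≤ (n + 1) * R' * M := by
      rw [abs_div, abs_of_pos hr, hr_def, div_div_eq_mul_div, div_one]
      calc |x i| * ((n + 1) * M) ≤ R' * ((n + 1) * M) := by gcongr
        _ = _ := by ring
    obtain ⟨h3, h4⟩ := abs_le.1 h2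
    refine ⟨Int.le_floor.2 ?_, ?_⟩
    · rw [hb]; push_cast; linarith
    · have : (⌊x i / r⌋ : ℝ) ≤ (b : ℝ) := by
        refine (Int.floor_le _).trans ?_
        rw [hb]; push_cast; linarith
      exact_mod_cast this
  -- A tautology in the shape from which `choose!` extracts a representative of every nonempty cell.
  have hex : ∀ z : Fin n → ℤ, (∃ x ∈ S, φ x = z) →
      ∃ x ∈ S, φ x = z := fun z h => h
  choose! g hgS hg using hex
  refine ⟨(G.filter fun z => ∃ x ∈ S, φ x = z).image g, ?_, ?_, ?_⟩
  · intro y hy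
    obtain ⟨z, hz, rfl⟩ := Finset.mem_image.1 (Finset.mem_coe.1 hy)
    exact hgS z (Finset.mem_filter.1 hz).2
  · refine Finset.card_image_le.trans ((Finset.card_filter_le _ _).trans ?_)
    rw [hG, Fintype.card_piFinset]
    simp only [Int.card_Icc, Finset.prod_const, Finset.card_univ, Fintype.card_fin]
    rw [← mul_pow]
    refine Nat.pow_le_pow_left ?_ n
    have : (b + 1 - -b).toNat = 2 * ((n + 1) * R' * M + 1) + 1 := by rw [hb]; omega
    rw [this]
    nlinarith
  · intro x hx
    refine ⟨g (φ x), Finset.mem_image.2 ⟨φ x, Finset.mem_filter.2 ⟨hmem x hx, x, hx, rfl⟩, rfl⟩, ?_⟩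
    have h1 : φ (g (φ x)) = φ x := hg (φ x) ⟨x, hx, rfl⟩
    refine (dist_le_of_floor_eq hr fun i => (congrFun h1 i).symm).trans (le_of_eq ?_)
    rw [hr_def]; field_simp

/-! ### Uniform deviations of sums of independent random variables -/

section Deviation

variable {𝒴 Ω : Type*} [MeasurableSpace 𝒴] [MeasurableSpace Ω] {μ : Measure 𝒴}
  [IsProbabilityMeasure μ] {P : Measure Ω} [IsProbabilityMeasure P] {X : ℕ → Ω → 𝒴}

theorem integrable_of_abs_le {Z : 𝒴 → ℝ} (hZ : Measurable Z) {B : ℝ} (hB : ∀ y, |Z y| ≤ B)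
    {ν : Measure 𝒴} [IsFiniteMeasure ν] : Integrable Z ν :=
  Integrable.of_bound hZ.aestronglyMeasurable B (Eventually.of_forall hB)

/-- From `exp x ≤ 1 + x + x ^ 2` for `|x| ≤ 1`, followed by `1 + y ≤ exp y`. The exponent contains
the second moment and not the supremum. This gain is essential for kernel terms, which are bounded
by a constant but have second moment of order `h ^ p`. -/
theorem integral_exp_mul_le {Z : 𝒴 → ℝ} (hZ : Measurable Z) {B w s : ℝ}
    (hB : ∀ y, |Z y| ≤ B) (hw : ∫ y, Z y ^ 2 ∂μ ≤ w) (hs : 0 ≤ s) (hsB : s * B ≤ 1) :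
    ∫ y, Real.exp (s * Z y) ∂μ ≤ Real.exp (s * ∫ y, Z y ∂μ + s ^ 2 * w) := by
  have hsZ : ∀ y, |s * Z y| ≤ 1 := fun y => by
    rw [abs_mul, abs_of_nonneg hs]
    exact (mul_le_mul_of_nonneg_left (hB y) hs).trans hsB
  have hi1 : Integrable Z μ := integrable_of_abs_le hZ hB
  have hi2 : Integrable (fun y => Z y ^ 2) μ := by
    refine integrable_of_abs_le (hZ.pow_const 2) (B := B ^ 2) fun y => ?_
    rw [abs_pow]
    exact pow_le_pow_left₀ (abs_nonneg _) (hB y) 2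
  calc ∫ y, Real.exp (s * Z y) ∂μ ≤ ∫ y, (1 + s * Z y + s ^ 2 * Z y ^ 2) ∂μ := by
        refine integral_mono ?_ (((integrable_const 1).add (hi1.const_mul s)).add
          (hi2.const_mul _)) fun y => ?_
        · refine integrable_of_abs_le (hZ.const_mul s).exp (B := Real.exp 1) fun y => ?_
          rw [Real.abs_exp]
          exact Real.exp_le_exp.2 ((le_abs_self _).trans (hsZ y))
        · have := (abs_le.1 (Real.abs_exp_sub_one_sub_id_le (hsZ y))).2
          dsimp only
          nlinarith
    _ = 1 + (s * ∫ y, Z y ∂μ + s ^ 2 * ∫ y, Z y ^ 2 ∂μ) := by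
        have hi3 : Integrable (fun y => 1 + s * Z y) μ := (integrable_const 1).add (hi1.const_mul s)
        rw [integral_add hi3 (hi2.const_mul _),
          integral_add (integrable_const 1) (hi1.const_mul s), integral_const_mul,
          integral_const_mul]
        simp [add_assoc]
    _ ≤ 1 + (s * ∫ y, Z y ∂μ + s ^ 2 * w) := by gcongr
    _ ≤ _ := by linarith [Real.add_one_le_exp (s * ∫ y, Z y ∂μ + s ^ 2 * w)]

/-- Chernoff's inequality: by independence the moment generating function of the sum is an `N`-th
power. The parameter `s` stays free and is chosen only once the net is fixed. -/
theorem measure_sum_sub_ge_le (hX_meas : ∀ i, Measurable (X i)) (hX_law : ∀ i, P.map (X i) = μ)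
    (hX_indep : iIndepFun X P) {Z : 𝒴 → ℝ} (hZ : Measurable Z) {B w s : ℝ}
    (hB : ∀ y, |Z y| ≤ B) (hw : ∫ y, Z y ^ 2 ∂μ ≤ w) (hs : 0 ≤ s) (hsB : s * B ≤ 1) (a : ℝ)
    (N : ℕ) :
    P.real {ω | a ≤ ∑ j ∈ Finset.range N, Z (X j ω) - N * ∫ y, Z y ∂μ}
      ≤ Real.exp (-(s * a) + N * (s ^ 2 * w)) := by
  have hind : iIndepFun (fun i => Z ∘ X i) P := hX_indep.comp (fun _ => Z) fun _ => hZ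
  have hm : ∀ i, Measurable (Z ∘ X i) := fun i => hZ.comp (hX_meas i)
  have hmgf : mgf (∑ j ∈ Finset.range N, Z ∘ X j) P s
      = (∫ y, Real.exp (s * Z y) ∂μ) ^ N := by
    rw [hind.mgf_sum hm]
    rw [Finset.prod_congr rfl (g := fun _ => ∫ y, Real.exp (s * Z y) ∂μ), Finset.prod_const,
      Finset.card_range]
    intro i _
    rw [mgf, ← hX_law i, integral_map (hX_meas i).aemeasurable
      (hZ.const_mul s).exp.aestronglyMeasurable]
    rfl
  have hint : Integrable (fun ω => Real.exp (s * (∑ j ∈ Finset.range N, Z ∘ X j) ω)) P := by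
    have hms : Measurable (∑ j ∈ Finset.range N, Z ∘ X j) := by
      simp only [Finset.sum_fn]
      exact Finset.measurable_sum _ fun i _ => hm i
    refine integrable_of_abs_le (hms.const_mul s).exp (B := Real.exp N) fun ω => ?_
    rw [Real.abs_exp]
    refine Real.exp_le_exp.2 ?_
    rw [Finset.sum_apply, Finset.mul_sum]
    calc ∑ i ∈ Finset.range N, s * (Z ∘ X i) ω ≤ ∑ _i ∈ Finset.range N, (1 : ℝ) :=
          Finset.sum_le_sum fun i _ => (mul_le_mul_of_nonneg_left
            ((le_abs_self _).trans (hB _)) hs).trans hsB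
      _ = N := by simp
  have hset : {ω | a ≤ ∑ j ∈ Finset.range N, Z (X j ω) - N * ∫ y, Z y ∂μ}
      = {ω | a + N * ∫ y, Z y ∂μ ≤ (∑ j ∈ Finset.range N, Z ∘ X j) ω} := by
    ext ω
    simp only [Set.mem_ofPred_eq, Finset.sum_apply, Function.comp_apply]
    exact le_sub_iff_add_le
  rw [hset]
  refine (measure_ge_le_exp_mul_mgf _ hs hint).trans ?_
  rw [hmgf]
  calc Real.exp (-s * (a + N * ∫ y, Z y ∂μ)) * (∫ y, Real.exp (s * Z y) ∂μ) ^ N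
      ≤ Real.exp (-s * (a + N * ∫ y, Z y ∂μ)) * (Real.exp (s * ∫ y, Z y ∂μ + s ^ 2 * w)) ^ N := by
        refine mul_le_mul_of_nonneg_left (pow_le_pow_left₀
          (integral_nonneg fun y => (Real.exp_pos (s * Z y)).le) ?_ N) (Real.exp_pos _).le
        exact integral_exp_mul_le hZ hB hw hs hsB
    _ = _ := by
        rw [← Real.exp_nat_mul, ← Real.exp_add]
        congr 1
        ring

theorem measure_abs_sum_sub_ge_le (hX_meas : ∀ i, Measurable (X i))
    (hX_law : ∀ i, P.map (X i) = μ) (hX_indep : iIndepFun X P) {Z : 𝒴 → ℝ} (hZ : Measurable Z)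
    {B w s : ℝ} (hB : ∀ y, |Z y| ≤ B) (hw : ∫ y, Z y ^ 2 ∂μ ≤ w) (hs : 0 ≤ s) (hsB : s * B ≤ 1)
    (a : ℝ) (N : ℕ) :
    P.real {ω | a ≤ |∑ j ∈ Finset.range N, Z (X j ω) - N * ∫ y, Z y ∂μ|}
      ≤ 2 * Real.exp (-(s * a) + N * (s ^ 2 * w)) := by
  have h1 := measure_sum_sub_ge_le hX_meas hX_law hX_indep hZ hB hw hs hsB a N
  have h2 := measure_sum_sub_ge_le hX_meas hX_law hX_indep hZ.neg (B := B) (w := w) (s := s)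
    (fun y => by simpa using hB y) (by simpa using hw) hs hsB a N
  have hset : {ω | a ≤ |∑ j ∈ Finset.range N, Z (X j ω) - N * ∫ y, Z y ∂μ|}
      ⊆ {ω | a ≤ ∑ j ∈ Finset.range N, Z (X j ω) - N * ∫ y, Z y ∂μ}
        ∪ {ω | a ≤ ∑ j ∈ Finset.range N, (-Z) (X j ω) - N * ∫ y, (-Z) y ∂μ} := by
    intro ω hω
    rcases le_abs.1 (Set.mem_ofPred_eq ▸ hω) with h | h
    · exact Or.inl h
    · refine Or.inr ?_
      simp only [Set.mem_ofPred_eq, Pi.neg_apply, Finset.sum_neg_distrib, integral_neg]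
      linarith
  linarith [measureReal_mono (μ := P) hset, measureReal_union_le (μ := P)
    {ω | a ≤ ∑ j ∈ Finset.range N, Z (X j ω) - N * ∫ y, Z y ∂μ}
    {ω | a ≤ ∑ j ∈ Finset.range N, (-Z) (X j ω) - N * ∫ y, (-Z) y ∂μ}]

/-- Union bound over the net, then passage from a net point to an arbitrary index. The passage costs
`N Λ r` twice, once for the sum and once for its mean. The Lipschitz bound is needed only almost
surely, provided the null set does not depend on the pair of indices. -/
theorem measure_uniform_deviation_le (hX_meas : ∀ i, Measurable (X i))
    (hX_law : ∀ i, P.map (X i) = μ) (hX_indep : iIndepFun X P) {Θ : Type*} [PseudoMetricSpace Θ]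
    {S : Set Θ} (F : Finset Θ) (hFS : (F : Set Θ) ⊆ S) {r : ℝ}
    (hF : ∀ x ∈ S, ∃ y ∈ F, dist x y ≤ r) {Z : Θ → 𝒴 → ℝ} (hZ : ∀ θ ∈ S, Measurable (Z θ))
    {B w s Λ : ℝ} (hΛ : 0 ≤ Λ) (hB : ∀ θ ∈ S, ∀ y, |Z θ y| ≤ B)
    (hw : ∀ θ ∈ S, ∫ y, Z θ y ^ 2 ∂μ ≤ w)
    (hlip : ∀ᵐ y ∂μ, ∀ θ ∈ S, ∀ θ' ∈ S, |Z θ y - Z θ' y| ≤ Λ * dist θ θ')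
    (hs : 0 ≤ s) (hsB : s * B ≤ 1) (a : ℝ) (N : ℕ) :
    P.real {ω | ¬ ∀ θ ∈ S, |∑ j ∈ Finset.range N, Z θ (X j ω) - N * ∫ y, Z θ y ∂μ|
        ≤ a + 2 * (N * (Λ * r))}
      ≤ F.card * (2 * Real.exp (-(s * a) + N * (s ^ 2 * w))) := by
  have hX_lip : ∀ᵐ ω ∂P, ∀ j, ∀ θ ∈ S, ∀ θ' ∈ S,
      |Z θ (X j ω) - Z θ' (X j ω)| ≤ Λ * dist θ θ' := by
    refine ae_all_iff.2 fun j => ae_of_ae_map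
      (p := fun y => ∀ θ ∈ S, ∀ θ' ∈ S, |Z θ y - Z θ' y| ≤ Λ * dist θ θ')
      (hX_meas j).aemeasurable ?_
    rw [hX_law j]
    exact hlip
  have hint : ∀ θ ∈ S, Integrable (Z θ) μ := fun θ hθ => integrable_of_abs_le (hZ θ hθ) (hB θ hθ)
  have hmean : ∀ θ ∈ S, ∀ θ' ∈ S, |∫ y, Z θ y ∂μ - ∫ y, Z θ' y ∂μ| ≤ Λ * dist θ θ' := by
    intro θ hθ θ' hθ'
    rw [← integral_sub (hint θ hθ) (hint θ' hθ')]
    have := norm_integral_le_of_norm_le_const (μ := μ) (f := fun y => Z θ y - Z θ' y)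
      (C := Λ * dist θ θ') (hlip.mono fun y hy => hy θ hθ θ' hθ')
    simpa using this
  have hsub : {ω | ¬ ∀ θ ∈ S, |∑ j ∈ Finset.range N, Z θ (X j ω) - N * ∫ y, Z θ y ∂μ|
        ≤ a + 2 * (N * (Λ * r))}
      ≤ᵐ[P] ⋃ θ ∈ F, {ω | a ≤ |∑ j ∈ Finset.range N, Z θ (X j ω) - N * ∫ y, Z θ y ∂μ|} := by
    filter_upwards [hX_lip] with ω hω
    intro hbad
    by_contra hgood
    refine hbad fun θ hθ => ?_
    obtain ⟨θ', hθ', hd⟩ := hF θ hθ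
    have hθ'S : θ' ∈ S := hFS hθ'
    have h1 : |∑ j ∈ Finset.range N, Z θ' (X j ω) - N * ∫ y, Z θ' y ∂μ| ≤ a := by
      by_contra hc
      exact hgood (Set.mem_biUnion hθ' (not_le.1 hc).le)
    have h2 : |∑ j ∈ Finset.range N, Z θ (X j ω) - ∑ j ∈ Finset.range N, Z θ' (X j ω)|
        ≤ N * (Λ * r) := by
      rw [← Finset.sum_sub_distrib]
      calc |∑ j ∈ Finset.range N, (Z θ (X j ω) - Z θ' (X j ω))|
          ≤ ∑ j ∈ Finset.range N, |Z θ (X j ω) - Z θ' (X j ω)| := Finset.abs_sum_le_sum_abs _ _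
        _ ≤ ∑ _j ∈ Finset.range N, Λ * r := Finset.sum_le_sum fun j _ =>
            (hω j θ hθ θ' hθ'S).trans (mul_le_mul_of_nonneg_left hd hΛ)
        _ = N * (Λ * r) := by simp
    have h3 : |N * ∫ y, Z θ y ∂μ - N * ∫ y, Z θ' y ∂μ| ≤ N * (Λ * r) := by
      rw [← mul_sub, abs_mul, Nat.abs_cast]
      gcongr
      exact (hmean θ hθ θ' hθ'S).trans (mul_le_mul_of_nonneg_left hd hΛ)
    rw [abs_le] at h1 h2 h3 ⊢
    constructor <;> linarith
  calc P.real _ ≤ P.real (⋃ θ ∈ F,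
        {ω | a ≤ |∑ j ∈ Finset.range N, Z θ (X j ω) - N * ∫ y, Z θ y ∂μ|}) := by
        exact ENNReal.toReal_mono (measure_ne_top _ _) (measure_mono_ae hsub)
    _ ≤ ∑ θ ∈ F, P.real {ω | a ≤ |∑ j ∈ Finset.range N, Z θ (X j ω) - N * ∫ y, Z θ y ∂μ|} :=
        measureReal_biUnion_finset_le _ _
    _ ≤ ∑ _θ ∈ F, 2 * Real.exp (-(s * a) + N * (s ^ 2 * w)) :=
        Finset.sum_le_sum fun θ hθ => measure_abs_sum_sub_ge_le hX_meas hX_law hX_indep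
          (hZ θ (hFS hθ)) (hB θ (hFS hθ)) (hw θ (hFS hθ)) hs hsB a N
    _ = _ := by simp

/-- Take `s = √(log N / (N v))` in the Chernoff bound and a net of scale `N ^ (-2)`. The Lipschitz
constant may grow like `N`, since at this scale it contributes only the constant `2 Λ`. The growth
condition makes `s B ≤ 1` for large `N`. -/
theorem tendsto_measure_uniform_deviation (hX_meas : ∀ i, Measurable (X i))
    (hX_law : ∀ i, P.map (X i) = μ) (hX_indep : iIndepFun X P) {Θ : Type*} [PseudoMetricSpace Θ]
    {S : Set Θ} (hS : HasPolyCover S) {Z : ℕ → Θ → 𝒴 → ℝ}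
    (hZ : ∀ N, ∀ θ ∈ S, Measurable (Z N θ))
    {B W Λ : ℝ} (hΛ : 0 ≤ Λ) (hB : ∀ N, ∀ θ ∈ S, ∀ y, |Z N θ y| ≤ B) {v : ℕ → ℝ}
    (hv : ∀ᶠ N in atTop, 0 < v N)
    (hW : ∀ᶠ N in atTop, ∀ θ ∈ S, ∫ y, Z N θ y ^ 2 ∂μ ≤ W * v N)
    (hlip : ∀ᶠ N : ℕ in atTop, ∀ᵐ y ∂μ, ∀ θ ∈ S, ∀ θ' ∈ S,
      |Z N θ y - Z N θ' y| ≤ (Λ * N) * dist θ θ')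
    (hgrowth : Tendsto (fun N : ℕ => Real.log N / (N * v N)) atTop (𝓝 0)) :
    ∃ κ : ℝ, 0 ≤ κ ∧ Tendsto (fun N : ℕ => P {ω | ¬ ∀ θ ∈ S,
        |∑ j ∈ Finset.range N, Z N θ (X j ω) - N * ∫ y, Z N θ y ∂μ|
          ≤ κ * √(N * v N * Real.log N) + 2 * Λ}) atTop (𝓝 0) := by
  obtain ⟨C, D, hS⟩ := hS
  -- `2 * D` pays for the `C N ^ (2 D)` points of the net, `|W|` for the second-moment term of the
  -- exponent, and the extra `1` leaves a failure probability of order `1 / N`.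
  set κ : ℝ := 2 * D + 1 + |W| with hκ
  refine ⟨κ, by positivity, ?_⟩
  have hs0 : Tendsto (fun N : ℕ => √(Real.log N / (N * v N)) * B) atTop (𝓝 0) := by
    have := (Real.continuous_sqrt.tendsto 0).comp hgrowth
    simpa using (this.mul_const B)
  have hbound : ∀ᶠ N : ℕ in atTop, P.real {ω | ¬ ∀ θ ∈ S,
        |∑ j ∈ Finset.range N, Z N θ (X j ω) - N * ∫ y, Z N θ y ∂μ|
          ≤ κ * √(N * v N * Real.log N) + 2 * Λ} ≤ 2 * C * (N : ℝ)⁻¹ := by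
    filter_upwards [hv, hW, hlip, hs0.eventually (ge_mem_nhds one_pos), eventually_ge_atTop 1]
      with N hv hW hlip hsB hN
    have hN' : (1 : ℝ) ≤ N := by exact_mod_cast hN
    have hlog : 0 ≤ Real.log N := Real.log_nonneg hN'
    obtain ⟨F, hFS, hcard, hF⟩ := hS (N ^ 2) (Nat.one_le_pow _ _ hN)
    have key := measure_uniform_deviation_le hX_meas hX_law hX_indep F hFS hF (hZ N)
      (by positivity) (hB N) hW hlip (Real.sqrt_nonneg _) hsB (κ * √(N * v N * Real.log N)) N
    have h1 : 2 * (N * (Λ * N * (1 / ((N ^ 2 : ℕ) : ℝ)))) = 2 * Λ := by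
      push_cast
      field_simp
    rw [h1] at key
    refine key.trans ?_
    have hNv : 0 < N * v N := by positivity
    have h2 : √(Real.log N / (N * v N)) * (κ * √(N * v N * Real.log N)) = κ * Real.log N := by
      rw [mul_left_comm, ← Real.sqrt_mul (by positivity)]
      congr 1
      rw [show Real.log N / (N * v N) * (N * v N * Real.log N) = Real.log N ^ 2 by
        field_simp]
      exact Real.sqrt_sq hlog
    have h3 : N * (√(Real.log N / (N * v N)) ^ 2 * (W * v N)) = W * Real.log N := by
      rw [Real.sq_sqrt (by positivity)]
      field_simp
    rw [h2, h3]
    have h4 : -(κ * Real.log N) + W * Real.log N ≤ -((2 * D + 1 : ℕ) * Real.log N) := by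
      rw [hκ]
      push_cast
      nlinarith [le_abs_self W]
    have h5 : Real.exp (-((2 * D + 1 : ℕ) * Real.log N)) = ((N : ℝ) ^ (2 * D + 1))⁻¹ := by
      rw [Real.exp_neg, Real.exp_nat_mul, Real.exp_log (by positivity)]
    calc (F.card : ℝ) * (2 * Real.exp (-(κ * Real.log N) + W * Real.log N))
        ≤ (C * (N ^ 2) ^ D) * (2 * ((N : ℝ) ^ (2 * D + 1))⁻¹) := by
          gcongr
          · exact_mod_cast hcard
          · exact (Real.exp_le_exp.2 h4).trans h5.le
      _ = 2 * C * (N : ℝ)⁻¹ := by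
          rw [← pow_mul, pow_succ]
          field_simp
  have hlim : Tendsto (fun N : ℕ => ENNReal.ofReal (2 * C * (N : ℝ)⁻¹)) atTop (𝓝 0) := by
    have := (tendsto_inv_atTop_nhds_zero_nat (𝕜 := ℝ)).const_mul (2 * C : ℝ)
    rw [mul_zero] at this
    simpa using ENNReal.tendsto_ofReal this
  refine tendsto_of_tendsto_of_tendsto_of_le_of_le' tendsto_const_nhds hlim
    (Eventually.of_forall fun _ => zero_le) ?_
  filter_upwards [hbound] with N hN
  rw [← ENNReal.ofReal_toReal (measure_ne_top P _)]
  exact ENNReal.ofReal_le_ofReal hN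

end Deviation

end DDMSLP

namespace DDMSLP

/-! ### The exponential kernel -/

section Kernel

variable {p : ℕ}

theorem kern_pos (ρ : E p) : 0 < kern ρ := Real.exp_pos _

theorem kern_le_one (ρ : E p) : kern ρ ≤ 1 := Real.exp_le_one_iff.2 (neg_nonpos.2 (norm_nonneg _))

theorem abs_kern_le_one (ρ : E p) : |kern ρ| ≤ 1 := by
  rw [abs_of_pos (kern_pos ρ)]
  exact kern_le_one ρ

theorem kern_neg (ρ : E p) : kern (-ρ) = kern ρ := by simp [kern]

theorem continuous_kern : Continuous (kern : E p → ℝ) := by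
  unfold kern
  fun_prop

theorem abs_kern_sub_le (ρ ρ' : E p) : |kern ρ - kern ρ'| ≤ ‖ρ - ρ'‖ := by
  have key : ∀ a b : E p, kern a - kern b ≤ ‖a - b‖ := fun a b => by
    have h1 : kern b ≥ kern a * Real.exp (-‖a - b‖) := by
      rw [kern, kern, ← Real.exp_add]
      refine Real.exp_le_exp.2 ?_
      have := norm_sub_norm_le b a
      rw [norm_sub_rev] at this
      linarith
    have h2 := Real.add_one_le_exp (-‖a - b‖)
    nlinarith [kern_pos a, kern_le_one a, norm_nonneg (a - b)]
  refine abs_le.2 ⟨?_, key ρ ρ'⟩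
  have := key ρ' ρ
  rw [norm_sub_rev] at this
  linarith

/-- A Harnack-type property of the exponential kernel: kernel sums at two points at distance at most
`h` are comparable, wherever the data lie. -/
theorem kern_le_exp_mul_kern {a b : E p} (h : ‖a - b‖ ≤ 1) : kern a ≤ Real.exp 1 * kern b := by
  rw [kern, kern, ← Real.exp_add]
  refine Real.exp_le_exp.2 ?_
  have := norm_sub_norm_le b a
  rw [norm_sub_rev] at this
  linarith

/-- The term of degree `p + 3` of the exponential series of `1 + ‖v‖` absorbs the quadratic factor
and leaves the power `p + 1`, which exceeds the dimension, so the right-hand side is integrable. -/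
theorem norm_sq_mul_kern_le (v : E p) :
    (1 + ‖v‖ ^ 2) * kern v
      ≤ (2 * Real.exp 1 * (p + 3).factorial) * (1 + ‖v‖) ^ (-((p + 1 : ℕ) : ℝ)) := by
  have hv := norm_nonneg v
  have h1 := Real.pow_div_factorial_le_exp (1 + ‖v‖) (by positivity) (p + 3)
  rw [div_le_iff₀ (by positivity), Real.exp_add] at h1
  rw [Real.rpow_neg (by positivity), Real.rpow_natCast, ← div_eq_mul_inv,
    le_div_iff₀ (by positivity), kern, Real.exp_neg, mul_right_comm, ← div_eq_mul_inv,
    div_le_iff₀ (Real.exp_pos _)]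
  calc (1 + ‖v‖ ^ 2) * (1 + ‖v‖) ^ (p + 1) ≤ (2 * (1 + ‖v‖) ^ 2) * (1 + ‖v‖) ^ (p + 1) := by
        gcongr
        nlinarith
    _ = 2 * (1 + ‖v‖) ^ (p + 3) := by ring
    _ ≤ 2 * (Real.exp 1 * Real.exp ‖v‖ * (p + 3).factorial) := by gcongr
    _ = _ := by ring

theorem integrable_one_add_norm_sq_mul_kern :
    Integrable (fun v : E p => (1 + ‖v‖ ^ 2) * kern v) := by
  have h0 : Integrable (fun v : E p => (2 * Real.exp 1 * (p + 3).factorial) *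
      (1 + ‖v‖) ^ (-((p + 1 : ℕ) : ℝ))) := by
    refine (integrable_one_add_norm ?_).const_mul _
    simp
  refine h0.mono' ?_ (Eventually.of_forall fun v => ?_)
  · have := continuous_kern (p := p)
    exact Continuous.aestronglyMeasurable (by fun_prop)
  · rw [Real.norm_of_nonneg (mul_nonneg (by positivity) (kern_pos v).le)]
    exact norm_sq_mul_kern_le v

theorem integrable_kern : Integrable (kern : E p → ℝ) := by
  refine integrable_one_add_norm_sq_mul_kern.mono' continuous_kern.aestronglyMeasurable
    (Eventually.of_forall fun v => ?_)
  rw [Real.norm_of_nonneg (kern_pos v).le]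
  nlinarith [kern_pos v, sq_nonneg ‖v‖]

theorem integrable_norm_sq_mul_kern : Integrable (fun v : E p => ‖v‖ ^ 2 * kern v) := by
  refine (integrable_one_add_norm_sq_mul_kern.sub integrable_kern).congr
    (Eventually.of_forall fun v => ?_)
  simp only [Pi.sub_apply]
  ring

theorem integral_kern_pos : 0 < ∫ v : E p, kern v := by
  refine (integral_pos_iff_support_of_nonneg (fun v => (kern_pos v).le) integrable_kern).2 ?_
  have : Function.support (kern : E p → ℝ) = Set.univ :=
    Set.eq_univ_of_forall fun v => (kern_pos v).ne'
  rw [this]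
  exact Measure.measure_univ_pos.2 (NeZero.ne _)

theorem integrable_kern_sq : Integrable (fun v : E p => kern v ^ 2) := by
  refine integrable_kern.mono' (continuous_kern.pow 2).aestronglyMeasurable
    (Eventually.of_forall fun v => ?_)
  rw [Real.norm_of_nonneg (by positivity)]
  nlinarith [kern_pos v, kern_le_one v]

theorem integral_kern_sq_pos : 0 < ∫ v : E p, kern v ^ 2 := by
  refine (integral_pos_iff_support_of_nonneg (fun v => sq_nonneg (kern v)) integrable_kern_sq).2 ?_
  have : Function.support (fun v : E p => kern v ^ 2) = Set.univ :=
    Set.eq_univ_of_forall fun v => (pow_pos (kern_pos v) 2).ne'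
  rw [this]
  exact Measure.measure_univ_pos.2 (NeZero.ne _)

/-! ### Rescaled kernels, smoothing bias and sums over data points. -/

theorem integral_comp_scaled_sub {h : ℝ} (hh : 0 < h) (ξ : E p) (G : E p → ℝ) :
    ∫ u, G (h⁻¹ • (ξ - u)) = h ^ p * ∫ v, G v := by
  rw [integral_sub_left_eq_self (fun u => G (h⁻¹ • u)) volume ξ,
    Measure.integral_comp_inv_smul_of_nonneg _ _ hh.le]
  simp

theorem integrable_comp_scaled_sub {h : ℝ} (hh : 0 < h) (ξ : E p) {G : E p → ℝ}
    (hG : Integrable G) : Integrable fun u => G (h⁻¹ • (ξ - u)) :=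
  (hG.comp_smul (inv_ne_zero hh.ne')).comp_sub_left ξ

theorem scaled_scaled_sub {h : ℝ} (hh : 0 < h) (ξ u : E p) : ξ - h • (h⁻¹ • (ξ - u)) = u := by
  rw [smul_inv_smul₀ hh.ne', sub_sub_cancel]

theorem integral_kern_mul {h : ℝ} (hh : 0 < h) (ξ : E p) (r : E p → ℝ) :
    ∫ u, kern (h⁻¹ • (ξ - u)) * r u = h ^ p * ∫ v, kern v * r (ξ - h • v) := by
  rw [← integral_comp_scaled_sub hh ξ]
  simp only [scaled_scaled_sub hh]

/-- Smoothing by the kernel has a bias of the second order. -/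
theorem abs_integral_kern_mul_sub_le {h : ℝ} (hh : 0 < h) {r : E p → ℝ} (hr : Measurable r)
    {R M : ℝ} (hR : ∀ ξ, |r ξ| ≤ R)
    (hM : ∀ ξ w, |r (ξ + w) + r (ξ - w) - 2 * r ξ| ≤ M * ‖w‖ ^ 2) (ξ : E p) :
    |(∫ u, kern (h⁻¹ • (ξ - u)) * r u) - h ^ p * ((∫ v : E p, kern v) * r ξ)|
      ≤ h ^ p * (h ^ 2 * (M * ∫ v : E p, ‖v‖ ^ 2 * kern v)) := by
  have hint : ∀ w : E p → E p, Measurable w → Integrable fun v => kern v * r (w v) := fun w hw => by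
    refine (integrable_kern.mul_const R).mono'
      (continuous_kern.measurable.mul (hr.comp hw)).aestronglyMeasurable
      (Eventually.of_forall fun v => ?_)
    rw [norm_mul, Real.norm_of_nonneg (kern_pos v).le, Real.norm_eq_abs]
    exact mul_le_mul_of_nonneg_left (hR _) (kern_pos v).le
  have i1 := hint (fun v => ξ - h • v) (by fun_prop)
  have i2 := hint (fun v => ξ + h • v) (by fun_prop)
  -- Since the kernel is even, smoothing may be averaged over `v` and `-v`. The error becomes half
  -- the smoothed second difference of `r`, and the first-order term disappears.
  have hsymm : ∫ v, kern v * r (ξ + h • v) = ∫ v, kern v * r (ξ - h • v) := by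
    rw [← integral_neg_eq_self (fun v => kern v * r (ξ + h • v))]
    simp [kern_neg, sub_eq_add_neg]
  have i3 : Integrable fun v => kern v * r (ξ + h • v) + kern v * r (ξ - h • v) := i2.add i1
  have i4 : Integrable fun v : E p => kern v * (2 * r ξ) := integrable_kern.mul_const _
  have hsum : ∫ v, kern v * (r (ξ + h • v) + r (ξ - h • v) - 2 * r ξ)
      = 2 * ((∫ v, kern v * r (ξ - h • v)) - (∫ v : E p, kern v) * r ξ) := by
    have : (fun v => kern v * (r (ξ + h • v) + r (ξ - h • v) - 2 * r ξ))
        = fun v => (kern v * r (ξ + h • v) + kern v * r (ξ - h • v)) - kern v * (2 * r ξ) := by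
      funext v; ring
    rw [this, integral_sub i3 i4, integral_add i2 i1, hsymm, integral_mul_const]
    ring
  have hbd : |∫ v, kern v * (r (ξ + h • v) + r (ξ - h • v) - 2 * r ξ)|
      ≤ h ^ 2 * (M * ∫ v : E p, ‖v‖ ^ 2 * kern v) := by
    rw [← integral_const_mul, ← integral_const_mul, ← Real.norm_eq_abs]
    refine norm_integral_le_of_norm_le ((integrable_norm_sq_mul_kern.const_mul M).const_mul _)
      (Eventually.of_forall fun v => ?_)
    rw [norm_mul, Real.norm_of_nonneg (kern_pos v).le, Real.norm_eq_abs]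
    refine (mul_le_mul_of_nonneg_left (hM ξ (h • v)) (kern_pos v).le).trans (le_of_eq ?_)
    rw [norm_smul, Real.norm_of_nonneg hh.le]
    ring
  rw [integral_kern_mul hh, ← mul_sub, abs_mul, abs_of_pos (pow_pos hh p)]
  refine mul_le_mul_of_nonneg_left ?_ (pow_pos hh p).le
  rw [hsum, abs_mul, abs_two] at hbd
  linarith [abs_nonneg ((∫ v, kern v * r (ξ - h • v)) - (∫ v : E p, kern v) * r ξ)]

/-- The volume of the unit ball. -/
noncomputable def unitVol (p : ℕ) : ℝ := volume.real (Metric.ball (0 : E p) 1)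

theorem unitVol_pos (p : ℕ) : 0 < unitVol p :=
  ENNReal.toReal_pos (Metric.measure_ball_pos _ _ one_pos).ne' measure_ball_lt_top.ne

theorem volume_real_closedBall (x : E p) {h : ℝ} (hh : 0 ≤ h) :
    volume.real (Metric.closedBall x h) = h ^ p * unitVol p := by
  rw [Measure.real, Measure.addHaar_closedBall _ _ hh, ENNReal.toReal_mul,
    ENNReal.toReal_ofReal (by positivity)]
  simp [unitVol, Measure.real]

/-- A sum over the data points, weighted by the inverse of the kernel density estimate, is bounded
by an integral. -/
theorem sum_div_kernelSum_le {h : ℝ} (hh : 0 < h) (x : ℕ → E p) (N : ℕ) {G : E p → ℝ}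
    (hG0 : ∀ u, 0 ≤ G u) (hG : Integrable G) {c : ℝ} (hc : 0 ≤ c)
    (hGc : ∀ i < N, ∀ u, ‖u - x i‖ ≤ h → G (x i) ≤ c * G u) :
    ∑ i ∈ Finset.range N, G (x i) / ∑ k ∈ Finset.range N, kern (h⁻¹ • (x i - x k))
      ≤ c * Real.exp 1 ^ 2 / (unitVol p * h ^ p) * ∫ u, G u := by
  set F : E p → ℝ := fun u => ∑ k ∈ Finset.range N, kern (h⁻¹ • (u - x k)) with hF
  have hFcont : Continuous F := by
    have := continuous_kern (p := p)
    fun_prop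
  have hscale : ∀ {u v w : E p}, ‖u - v‖ ≤ h → ‖h⁻¹ • (u - w) - h⁻¹ • (v - w)‖ ≤ 1 := by
    intro u v w huv
    rw [← smul_sub, sub_sub_sub_cancel_right, norm_smul, Real.norm_of_nonneg (inv_pos.2 hh).le,
      inv_mul_le_one₀ hh]
    exact huv
  have hFpos : ∀ i < N, ∀ u, 0 < F u := fun i hi u =>
    Finset.sum_pos (fun k _ => kern_pos _) ⟨i, Finset.mem_range.2 hi⟩
  have hFle : ∀ i < N, ∀ u, ‖u - x i‖ ≤ h → F u ≤ Real.exp 1 * F (x i) := by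
    intro i _ u hu
    rw [hF, Finset.mul_sum]
    exact Finset.sum_le_sum fun k _ => kern_le_exp_mul_kern (hscale hu)
  have hratio : ∀ i < N, ∀ u, kern (h⁻¹ • (u - x i)) / F u ≤ 1 := fun i hi u => by
    rw [div_le_one (hFpos i hi u)]
    exact Finset.single_le_sum (f := fun k => kern (h⁻¹ • (u - x k))) (fun k _ => (kern_pos _).le)
      (Finset.mem_range.2 hi)
  have hterm : ∀ i < N, Integrable fun u => G u * (kern (h⁻¹ • (u - x i)) / F u) := by
    intro i hi
    refine hG.mono' (hG.aestronglyMeasurable.mul ?_) (Eventually.of_forall fun u => ?_)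
    · refine Continuous.aestronglyMeasurable ?_
      have := continuous_kern (p := p)
      exact Continuous.div (by fun_prop) hFcont fun u => (hFpos i hi u).ne'
    · rw [Real.norm_of_nonneg (mul_nonneg (hG0 u) (div_nonneg (kern_pos _).le (hFpos i hi u).le))]
      exact mul_le_of_le_one_right (hG0 u) (hratio i hi u)
  -- On the ball of radius `h` around `x i`, `F` is at most `exp 1` times its value at the centre,
  -- and the kernel centred at `x i` is at least `exp (-1)`. The value at the data point is thus
  -- bounded by an integral over the ball, and the factor `kern / F` can be inserted under that
  -- integral.
  have hpt : ∀ i < N, unitVol p * h ^ p * (G (x i) / F (x i))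
      ≤ c * Real.exp 1 ^ 2 * ∫ u, G u * (kern (h⁻¹ • (u - x i)) / F u) := by
    intro i hi
    have hlow : ∀ u ∈ Metric.closedBall (x i) h, G (x i) / F (x i)
        ≤ c * Real.exp 1 ^ 2 * (G u * (kern (h⁻¹ • (u - x i)) / F u)) := by
      intro u hu
      rw [mem_closedBall_iff_norm] at hu
      have h1 : 1 ≤ Real.exp 1 * kern (h⁻¹ • (u - x i)) := by
        have h2 : kern (h⁻¹ • (x i - x i) : E p) = 1 := by simp [kern]
        refine h2.ge.trans (kern_le_exp_mul_kern (hscale ?_))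
        rwa [norm_sub_rev]
      have h2 := hFle i hi u hu
      have h3 := hGc i hi u hu
      have hFi := hFpos i hi (x i)
      have hFu := hFpos i hi u
      rw [mul_div_assoc', mul_div_assoc', div_le_div_iff₀ hFi hFu]
      have h4 : 0 ≤ c * G u := mul_nonneg hc (hG0 u)
      calc G (x i) * F u ≤ (c * G u) * (Real.exp 1 * F (x i)) :=
            mul_le_mul h3 h2 hFu.le h4
        _ = (c * G u) * (Real.exp 1 * F (x i)) * 1 := by ring
        _ ≤ (c * G u) * (Real.exp 1 * F (x i)) * (Real.exp 1 * kern (h⁻¹ • (u - x i))) := by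
            gcongr
        _ = _ := by ring
    have h5 : ∫ u in Metric.closedBall (x i) h, G (x i) / F (x i)
        ≤ ∫ u in Metric.closedBall (x i) h,
          c * Real.exp 1 ^ 2 * (G u * (kern (h⁻¹ • (u - x i)) / F u)) := by
      refine setIntegral_mono_on ?_ ((hterm i hi).const_mul _).integrableOn
        Metric.isClosed_closedBall.measurableSet hlow
      exact integrableOn_const measure_closedBall_lt_top.ne
    rw [setIntegral_const, volume_real_closedBall _ hh.le, smul_eq_mul, mul_comm (h ^ p)] at h5
    refine h5.trans ?_
    rw [← integral_const_mul]
    refine setIntegral_le_integral ((hterm i hi).const_mul _) (Eventually.of_forall fun u => ?_)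
    exact mul_nonneg (by positivity) (mul_nonneg (hG0 u) (div_nonneg (kern_pos _).le
      (hFpos i hi u).le))
  have hu := unitVol_pos p
  rw [div_mul_eq_mul_div, le_div_iff₀ (by positivity), mul_comm, Finset.mul_sum]
  -- After summation over `i` the ratios `kern / F` add up to at most one at every `u`, so nothing
  -- depends on the position or the number of the points.
  calc ∑ i ∈ Finset.range N, unitVol p * h ^ p * (G (x i) / F (x i))
      ≤ ∑ i ∈ Finset.range N, c * Real.exp 1 ^ 2 * ∫ u, G u * (kern (h⁻¹ • (u - x i)) / F u) :=
        Finset.sum_le_sum fun i hi => hpt i (Finset.mem_range.1 hi)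
    _ = c * Real.exp 1 ^ 2 * ∫ u, ∑ i ∈ Finset.range N, G u * (kern (h⁻¹ • (u - x i)) / F u) := by
        rw [← Finset.mul_sum, integral_finsetSum]
        exact fun i hi => hterm i (Finset.mem_range.1 hi)
    _ ≤ c * Real.exp 1 ^ 2 * ∫ u, G u := by
        refine mul_le_mul_of_nonneg_left (integral_mono
          (integrable_finsetSum _ fun i hi => hterm i (Finset.mem_range.1 hi)) hG fun u => ?_)
          (by positivity)
        dsimp only
        rw [← Finset.mul_sum, ← Finset.sum_div]
        exact mul_le_of_le_one_right (hG0 u) (div_self_le_one _)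

/-- Apply the preceding bound to the indicator of a ball that contains the `h`-neighbourhoods of all
points. On average over the data this replaces a lower bound on the density: isolated points have a
small kernel sum, but there cannot be many of them in a bounded set. -/
theorem sum_inv_kernelSum_le {R : ℝ} :
    ∃ C : ℝ, 0 ≤ C ∧ ∀ (h : ℝ) (x : ℕ → E p) (N : ℕ), 0 < h → h ≤ 1 → (∀ i < N, ‖x i‖ ≤ R) →
      ∑ i ∈ Finset.range N, (∑ k ∈ Finset.range N, kern (h⁻¹ • (x i - x k)))⁻¹ ≤ C / h ^ p := by
  refine ⟨1 * Real.exp 1 ^ 2 / unitVol p * volume.real (Metric.closedBall (0 : E p) (R + 1)),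
    mul_nonneg (div_nonneg (by positivity) (unitVol_pos p).le) measureReal_nonneg,
    fun h x N hh h1 hx => ?_⟩
  have hms : MeasurableSet (Metric.closedBall (0 : E p) (R + 1)) :=
    Metric.isClosed_closedBall.measurableSet
  have hmem : ∀ i < N, ∀ u, ‖u - x i‖ ≤ h → u ∈ Metric.closedBall (0 : E p) (R + 1) := by
    intro i hi u hu
    rw [mem_closedBall_zero_iff]
    have := norm_add_le (u - x i) (x i)
    rw [sub_add_cancel] at this
    linarith [hx i hi]
  have key := sum_div_kernelSum_le hh x N
    (G := (Metric.closedBall (0 : E p) (R + 1)).indicator fun _ => 1)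
    (fun u => Set.indicator_nonneg (fun _ _ => zero_le_one) u)
    ((integrable_indicator_iff hms).2 (integrableOn_const measure_closedBall_lt_top.ne))
    zero_le_one fun i hi u hu => by
      rw [Set.indicator_of_mem (hmem i hi u hu),
        Set.indicator_of_mem (hmem i hi (x i) (by simpa using hh.le))]
      norm_num
  rw [integral_indicator hms, setIntegral_const, smul_eq_mul, mul_one] at key
  calc _ = ∑ i ∈ Finset.range N, (Metric.closedBall (0 : E p) (R + 1)).indicator (fun _ => (1 : ℝ))
        (x i) / ∑ k ∈ Finset.range N, kern (h⁻¹ • (x i - x k)) :=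
        Finset.sum_congr rfl fun i hi => by
          rw [Set.indicator_of_mem (hmem i (Finset.mem_range.1 hi) (x i) (by simpa using hh.le)),
            one_div]
    _ ≤ _ := key
    _ = _ := by field_simp

/-- The same bound with `G` the kernel centred at `x j`, whose integral `h ^ p ∫ kern` cancels the
volume of the ball. These are column sums of the weight matrix. Its row sums are one, which would
control suprema; bounded column sums make the matrix bounded for sums of errors over the data. -/
theorem sum_weight_le (p : ℕ) :
    ∃ C : ℝ, 0 ≤ C ∧ ∀ (h : ℝ) (x : ℕ → E p) (N j : ℕ), 0 < h →
      ∑ i ∈ Finset.range N, kern (h⁻¹ • (x i - x j))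
        / ∑ k ∈ Finset.range N, kern (h⁻¹ • (x i - x k)) ≤ C := by
  refine ⟨Real.exp 1 * Real.exp 1 ^ 2 / unitVol p * ∫ v : E p, kern v,
    mul_nonneg (div_nonneg (by positivity) (unitVol_pos p).le) integral_kern_pos.le,
    fun h x N j hh => ?_⟩
  have hsymm : (fun u => kern (h⁻¹ • (u - x j))) = fun u => kern (h⁻¹ • (x j - u)) := by
    funext u
    rw [← kern_neg, ← smul_neg, neg_sub]
  have key := sum_div_kernelSum_le hh x N (G := fun u => kern (h⁻¹ • (u - x j)))
    (fun u => (kern_pos _).le) (by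
      rw [hsymm]
      exact integrable_comp_scaled_sub hh _ integrable_kern) (Real.exp_pos 1).le fun i hi u hu => by
      refine kern_le_exp_mul_kern ?_
      rw [← smul_sub, sub_sub_sub_cancel_right, norm_smul, Real.norm_of_nonneg (inv_pos.2 hh).le,
        inv_mul_le_one₀ hh, norm_sub_rev]
      exact hu
  refine key.trans (le_of_eq ?_)
  rw [hsymm, integral_comp_scaled_sub hh]
  have := unitVol_pos p
  field_simp

end Kernel

end DDMSLP

namespace DDMSLP

/-! ### Smooth joint densities with compact support -/

section Density

variable {p : ℕ}

/-- A joint density on `K × K'` with bounded first and second differences in the first argument. -/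
structure RegularDensity (f : E p × E p → ℝ) (K K' : Set (E p)) (M : ℝ) : Prop where
  nonneg : ∀ z, 0 ≤ f z
  cont : Continuous f
  compact : IsCompact K
  compact' : IsCompact K'
  supp : ∀ u u', f (u, u') ≠ 0 → u ∈ K ∧ u' ∈ K'
  lip : ∀ u w u', |f (u + w, u') - f (u, u')| ≤ M * ‖w‖
  diff_two : ∀ u w u', |f (u + w, u') + f (u - w, u') - 2 * f (u, u')| ≤ M * ‖w‖ ^ 2

/-- The integral of `φ` against the density in the second argument. -/
noncomputable def partialInt (f : E p × E p → ℝ) (φ : E p → ℝ) (u : E p) : ℝ :=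
  ∫ u', φ u' * f (u, u')

theorem partialInt_one (f : ℕ → E p × E p → ℝ) (t : ℕ) (u : E p) :
    partialInt (f t) (fun _ => 1) u = marginal f t u := by
  simp [partialInt, marginal]

/-- For the second difference, the mean value inequality is applied to `f` minus its linear part on
the ball of radius `‖w‖`. The linear parts for `w` and `-w` cancel. -/
theorem abs_add_sub_le_of_bounded_deriv {F : Type*} [NormedAddCommGroup F] [NormedSpace ℝ F]
    {f : F → ℝ} (hf : ContDiff ℝ 2 f) {M : ℝ}
    (hM : ∀ z, ‖iteratedFDeriv ℝ 1 f z‖ ≤ M ∧ ‖iteratedFDeriv ℝ 2 f z‖ ≤ M) (z w : F) :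
    |f (z + w) - f z| ≤ M * ‖w‖ ∧ |f (z + w) + f (z - w) - 2 * f z| ≤ 2 * M * ‖w‖ ^ 2 := by
  have hdf : Differentiable ℝ f := hf.differentiable (by norm_num)
  have h1 : ∀ z, ‖fderiv ℝ f z‖ ≤ M := fun z => by
    rw [← norm_iteratedFDeriv_one]
    exact (hM z).1
  have hdd : Differentiable ℝ (fderiv ℝ f) :=
    (hf.fderiv_right (m := 1) (by norm_num)).differentiable (by norm_num)
  have h2 : ∀ z, ‖fderiv ℝ (fderiv ℝ f) z‖ ≤ M := fun z => by
    rw [← norm_iteratedFDeriv_one, norm_iteratedFDeriv_fderiv]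
    exact (hM z).2
  have hM0 : 0 ≤ M := (norm_nonneg _).trans (h1 z)
  have hlip : ∀ a b, ‖fderiv ℝ f a - fderiv ℝ f b‖ ≤ M * ‖a - b‖ := fun a b =>
    convex_univ.norm_image_sub_le_of_norm_fderiv_le (fun x _ => hdd x) (fun x _ => h2 x)
      (Set.mem_univ b) (Set.mem_univ a)
  have htaylor : ∀ v : F, ‖v‖ ≤ ‖w‖ → |f (z + v) - f z - fderiv ℝ f z v| ≤ M * ‖w‖ * ‖w‖ := by
    intro v hv
    have key := (convex_closedBall z ‖w‖).norm_image_sub_le_of_norm_fderiv_le'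
      (φ := fderiv ℝ f z) (C := M * ‖w‖) (x := z) (y := z + v) (fun x _ => hdf x)
      (fun x hx => (hlip x z).trans (by
        rw [mem_closedBall_iff_norm] at hx
        gcongr)) (Metric.mem_closedBall_self (norm_nonneg w)) (by simpa using hv)
    rw [add_sub_cancel_left, Real.norm_eq_abs] at key
    exact key.trans (by gcongr)
  constructor
  · have := convex_univ.norm_image_sub_le_of_norm_fderiv_le (fun x _ => hdf x) (fun x _ => h1 x)
      (Set.mem_univ z) (Set.mem_univ (z + w))
    simpa using this
  · have e1 := htaylor w le_rfl
    have e2 := htaylor (-w) (by simp)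
    rw [map_neg, ← sub_eq_add_neg] at e2
    rw [abs_le] at e1 e2 ⊢
    constructor <;> nlinarith

theorem abs_integral_le_of_support {g : E p → ℝ} {K : Set (E p)} (hK : IsCompact K) {c : ℝ}
    (hg : ∀ u, |g u| ≤ c) (hgK : ∀ u ∉ K, g u = 0) : |∫ u, g u| ≤ c * volume.real K := by
  rw [← setIntegral_eq_integral_of_forall_compl_eq_zero hgK, ← Real.norm_eq_abs]
  exact norm_setIntegral_le_of_norm_le_const hK.measure_lt_top fun u _ => hg u

variable {f : E p × E p → ℝ} {K K' : Set (E p)} {M : ℝ}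

namespace RegularDensity

theorem eq_zero_left (hf : RegularDensity f K K' M) {u : E p} (hu : u ∉ K) (u' : E p) :
    f (u, u') = 0 := by
  by_contra h
  exact hu (hf.supp u u' h).1

theorem eq_zero_right (hf : RegularDensity f K K' M) (u : E p) {u' : E p} (hu' : u' ∉ K') :
    f (u, u') = 0 := by
  by_contra h
  exact hu' (hf.supp u u' h).2

theorem hasCompactSupport (hf : RegularDensity f K K' M) : HasCompactSupport f :=
  HasCompactSupport.intro (hf.compact.prod hf.compact') fun z hz => by
    by_contra h
    exact hz (hf.supp z.1 z.2 h)

theorem integrable_slice (hf : RegularDensity f K K' M) (u : E p) :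
    Integrable fun u' => f (u, u') := by
  refine Continuous.integrable_of_hasCompactSupport (hf.cont.comp (by fun_prop)) ?_
  exact HasCompactSupport.intro hf.compact' fun u' hu' => hf.eq_zero_right u hu'

theorem integrable_mul_slice (hf : RegularDensity f K K' M) {φ : E p → ℝ} (hφ : Measurable φ)
    {B : ℝ} (hB : ∀ u', |φ u'| ≤ B) (u : E p) : Integrable fun u' => φ u' * f (u, u') :=
  (hf.integrable_slice u).bdd_mul hφ.aestronglyMeasurable (Eventually.of_forall hB)

theorem partialInt_congr (hf : RegularDensity f K K' M) {φ φ' : E p → ℝ}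
    (h : ∀ u' ∈ K', φ u' = φ' u') (u : E p) : partialInt f φ u = partialInt f φ' u := by
  refine integral_congr_ae (Eventually.of_forall fun u' => ?_)
  by_cases hu' : u' ∈ K'
  · simp [h u' hu']
  · simp [hf.eq_zero_right u hu']

theorem partialInt_eq_zero (hf : RegularDensity f K K' M) (φ : E p → ℝ) {u : E p} (hu : u ∉ K) :
    partialInt f φ u = 0 := by
  simp [partialInt, hf.eq_zero_left hu]

theorem abs_partialInt_sub_le (hf : RegularDensity f K K' M) {φ : E p → ℝ} (hφ : Measurable φ)
    {B : ℝ} (hB : ∀ u', |φ u'| ≤ B) (u v : E p) :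
    |partialInt f φ u - partialInt f φ v| ≤ B * M * volume.real K' * ‖u - v‖ := by
  rw [partialInt, partialInt, ← integral_sub (hf.integrable_mul_slice hφ hB u)
    (hf.integrable_mul_slice hφ hB v)]
  refine (abs_integral_le_of_support hf.compact' (c := B * (M * ‖u - v‖)) (fun u' => ?_)
    fun u' hu' => ?_).trans (le_of_eq (by ring))
  · rw [← mul_sub, abs_mul]
    have := hf.lip v (u - v) u'
    rw [add_sub_cancel] at this
    exact mul_le_mul (hB u') this (abs_nonneg _) ((abs_nonneg _).trans (hB u'))
  · simp [hf.eq_zero_right _ hu']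

theorem continuous_partialInt (hf : RegularDensity f K K' M) {φ : E p → ℝ} (hφ : Measurable φ)
    {B : ℝ} (hB : ∀ u', |φ u'| ≤ B) : Continuous (partialInt f φ) :=
  (LipschitzWith.of_dist_le' (K := B * M * volume.real K') fun u v => by
    rw [Real.dist_eq, dist_eq_norm]
    exact hf.abs_partialInt_sub_le hφ hB u v).continuous

theorem diff_two_partialInt (hf : RegularDensity f K K' M) {φ : E p → ℝ} (hφ : Measurable φ)
    {B : ℝ} (hB : ∀ u', |φ u'| ≤ B) (u w : E p) :
    |partialInt f φ (u + w) + partialInt f φ (u - w) - 2 * partialInt f φ u|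
      ≤ B * M * volume.real K' * ‖w‖ ^ 2 := by
  have i := hf.integrable_mul_slice hφ hB
  have : partialInt f φ (u + w) + partialInt f φ (u - w) - 2 * partialInt f φ u
      = ∫ u', φ u' * (f (u + w, u') + f (u - w, u') - 2 * f (u, u')) := by
    have i1 : Integrable fun u' => φ u' * f (u + w, u') + φ u' * f (u - w, u') :=
      (i (u + w)).add (i (u - w))
    rw [partialInt, partialInt, partialInt, ← integral_const_mul,
      ← integral_add (i _) (i _), ← integral_sub i1 ((i u).const_mul 2)]
    refine integral_congr_ae (Eventually.of_forall fun u' => ?_)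
    simp only
    ring
  rw [this]
  refine (abs_integral_le_of_support hf.compact' (c := B * (M * ‖w‖ ^ 2)) (fun u' => ?_)
    fun u' hu' => ?_).trans (le_of_eq (by ring))
  · rw [abs_mul]
    exact mul_le_mul (hB u') (hf.diff_two u w u') (abs_nonneg _) ((abs_nonneg _).trans (hB u'))
  · simp [hf.eq_zero_right _ hu']

theorem abs_partialInt_le (hf : RegularDensity f K K' M) {φ : E p → ℝ}
    {B : ℝ} (hB : ∀ u', |φ u'| ≤ B) (u : E p) :
    |partialInt f φ u| ≤ B * partialInt f (fun _ => 1) u := by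
  rw [partialInt, partialInt, ← integral_const_mul, ← Real.norm_eq_abs]
  refine norm_integral_le_of_norm_le ((by simpa using hf.integrable_slice u :
    Integrable fun u' => 1 * f (u, u')).const_mul B) (Eventually.of_forall fun u' => ?_)
  rw [norm_mul, Real.norm_of_nonneg (hf.nonneg _), one_mul]
  exact mul_le_mul_of_nonneg_right (hB u') (hf.nonneg _)

theorem exists_partialInt_one_le (hf : RegularDensity f K K' M) :
    ∃ R : ℝ, 0 ≤ R ∧ ∀ u, partialInt f (fun _ => 1) u ≤ R := by
  obtain ⟨c, hc⟩ := hf.hasCompactSupport.exists_bound_of_continuous hf.cont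
  refine ⟨c * volume.real K', mul_nonneg ((norm_nonneg _).trans (hc 0)) measureReal_nonneg,
    fun u => (le_abs_self _).trans (abs_integral_le_of_support hf.compact' (fun u' => ?_)
      fun u' hu' => ?_)⟩
  · simpa using hc (u, u')
  · simp [hf.eq_zero_right _ hu']

theorem partialInt_nonneg (hf : RegularDensity f K K' M) {φ : E p → ℝ} (hφ : ∀ u', 0 ≤ φ u')
    (u : E p) : 0 ≤ partialInt f φ u :=
  integral_nonneg fun u' => mul_nonneg (hφ u') (hf.nonneg _)

theorem integrable_partialInt (hf : RegularDensity f K K' M) {φ : E p → ℝ} (hφ : Measurable φ)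
    {B : ℝ} (hB : ∀ u', |φ u'| ≤ B) : Integrable (partialInt f φ) :=
  (hf.continuous_partialInt hφ hB).integrable_of_hasCompactSupport
    (HasCompactSupport.intro hf.compact fun _ hu => hf.partialInt_eq_zero φ hu)

/-! ### Expectations of functions of a pair with a regular joint density. -/

section Law

variable {𝒴 : Type*} [MeasurableSpace 𝒴] {μ : Measure 𝒴} {Y Y' : 𝒴 → E p}

theorem integral_mul_comp (hf : RegularDensity f K K' M) (hY : Measurable Y) (hY' : Measurable Y')
    (hμ : μ.map (fun y => (Y y, Y' y)) = volume.withDensity fun z => ENNReal.ofReal (f z))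
    {ψ φ : E p → ℝ} (hψ : Measurable ψ) (hφ : Measurable φ) {A B : ℝ} (hA : ∀ u, |ψ u| ≤ A)
    (hB : ∀ u', |φ u'| ≤ B) :
    ∫ y, ψ (Y y) * φ (Y' y) ∂μ = ∫ u, ψ u * partialInt f φ u := by
  have hA0 : 0 ≤ A := (abs_nonneg _).trans (hA 0)
  have hm : Measurable fun z : E p × E p => ψ z.1 * φ z.2 := by fun_prop
  have h1 : ∫ y, ψ (Y y) * φ (Y' y) ∂μ
      = ∫ z, ψ z.1 * φ z.2 ∂(μ.map fun y => (Y y, Y' y)) :=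
    (integral_map (hY.prodMk hY').aemeasurable hm.aestronglyMeasurable).symm
  rw [h1, hμ, integral_withDensity_eq_integral_toReal_smul
    hf.cont.measurable.ennreal_ofReal (Eventually.of_forall fun _ => ENNReal.ofReal_lt_top)]
  have hint : Integrable (fun z : E p × E p => ψ z.1 * φ z.2 * f z) :=
    (hf.cont.integrable_of_hasCompactSupport hf.hasCompactSupport).bdd_mul (c := A * B)
      hm.aestronglyMeasurable (Eventually.of_forall fun z => by
        rw [Real.norm_eq_abs, abs_mul]
        exact mul_le_mul (hA _) (hB _) (abs_nonneg _) hA0)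
  have h2 : (fun z : E p × E p => (ENNReal.ofReal (f z)).toReal • (ψ z.1 * φ z.2))
      = fun z => ψ z.1 * φ z.2 * f z := by
    funext z
    rw [ENNReal.toReal_ofReal (hf.nonneg z), smul_eq_mul, mul_comm]
  rw [h2, Measure.volume_eq_prod, integral_prod _ (by rwa [← Measure.volume_eq_prod])]
  refine integral_congr_ae (Eventually.of_forall fun u => ?_)
  simp only [partialInt, mul_assoc]
  rw [integral_const_mul]

theorem integral_comp_snd (hf : RegularDensity f K K' M) (hY : Measurable Y)
    (hY' : Measurable Y')
    (hμ : μ.map (fun y => (Y y, Y' y)) = volume.withDensity fun z => ENNReal.ofReal (f z))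
    {φ : E p → ℝ} (hφ : Measurable φ) {B : ℝ} (hB : ∀ u', |φ u'| ≤ B) :
    ∫ y, φ (Y' y) ∂μ = ∫ u, partialInt f φ u := by
  simpa using hf.integral_mul_comp hY hY' hμ (ψ := fun _ => 1) measurable_const hφ (A := 1)
    (by simp) hB

theorem integral_comp_fst (hf : RegularDensity f K K' M) (hY : Measurable Y)
    (hY' : Measurable Y')
    (hμ : μ.map (fun y => (Y y, Y' y)) = volume.withDensity fun z => ENNReal.ofReal (f z))
    {ψ : E p → ℝ} (hψ : Measurable ψ) {A : ℝ} (hA : ∀ u', |ψ u'| ≤ A) :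
    ∫ y, ψ (Y y) ∂μ = ∫ u, ψ u * partialInt f (fun _ => 1) u := by
  simpa using hf.integral_mul_comp hY hY' hμ hψ (φ := fun _ => 1) measurable_const (B := 1)
    hA (by simp)

/-- A bound that holds almost surely for `φ` carries over to all its conditional expectations. -/
theorem abs_partialInt_le_of_ae (hf : RegularDensity f K K' M) (hY : Measurable Y)
    (hY' : Measurable Y')
    (hμ : μ.map (fun y => (Y y, Y' y)) = volume.withDensity fun z => ENNReal.ofReal (f z))
    {φ : E p → ℝ} (hφ : Measurable φ) {B c : ℝ} (hB : ∀ u', |φ u'| ≤ B)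
    (hc0 : 0 ≤ c) (hc : ∀ᵐ y ∂μ, |φ (Y' y)| ≤ c) (u : E p) :
    |partialInt f φ u| ≤ c * partialInt f (fun _ => 1) u := by
  set bad : E p → ℝ := {u' | c < |φ u'|}.indicator fun _ => 1 with hbad
  have hms : MeasurableSet {u' | c < |φ u'|} := measurableSet_lt measurable_const hφ.abs
  have hbm : Measurable bad := measurable_const.indicator hms
  have hb0 : ∀ u', 0 ≤ bad u' := fun u' => Set.indicator_nonneg (fun _ _ => zero_le_one) u'
  have hb1 : ∀ u', |bad u'| ≤ 1 := fun u' => by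
    rw [abs_of_nonneg (hb0 u')]
    exact Set.indicator_le_self' (fun _ _ => zero_le_one) u'
  have hzero : ∫ u, partialInt f bad u = 0 := by
    rw [← hf.integral_comp_snd hY hY' hμ hbm hb1]
    refine integral_eq_zero_of_ae (hc.mono fun y hy => ?_)
    have : Y' y ∉ {u' | c < |φ u'|} := fun h => absurd hy (not_le.2 h)
    exact Set.indicator_of_notMem this _
  have hae := (integral_eq_zero_iff_of_nonneg (fun u => hf.partialInt_nonneg hb0 u)
    (hf.integrable_partialInt hbm hb1)).1 hzero
  -- The partial integral of the exceptional indicator is nonnegative with integral zero, hence zero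
  -- almost everywhere. By continuity it vanishes at every `u`, so the bound holds at every
  -- conditioning value.
  have hall : partialInt f bad = 0 :=
    ((hf.continuous_partialInt hbm hb1).ae_eq_iff_eq volume continuous_const).1 hae
  have i1 : Integrable fun u' => 1 * f (u, u') := by simpa using hf.integrable_slice u
  have i2 := hf.integrable_mul_slice hbm hb1 u
  calc |partialInt f φ u| ≤ ∫ u', (c * (1 * f (u, u')) + B * (bad u' * f (u, u'))) := by
        rw [partialInt, ← Real.norm_eq_abs]
        refine norm_integral_le_of_norm_le ((i1.const_mul c).add (i2.const_mul B))
          (Eventually.of_forall fun u' => ?_)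
        rw [norm_mul, Real.norm_of_nonneg (hf.nonneg _), Real.norm_eq_abs, one_mul, ← mul_assoc,
          ← add_mul]
        refine mul_le_mul_of_nonneg_right ?_ (hf.nonneg _)
        by_cases h : c < |φ u'|
        · have : bad u' = 1 := Set.indicator_of_mem (s := {u' | c < |φ u'|}) h _
          rw [this]
          linarith [hB u']
        · have : bad u' = 0 := Set.indicator_of_notMem (s := {u' | c < |φ u'|}) h _
          rw [this]
          linarith [not_lt.1 h]
    _ = c * partialInt f (fun _ => 1) u := by
        rw [integral_add (i1.const_mul c) (i2.const_mul B), integral_const_mul c,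
          integral_const_mul B]
        have : (∫ u', bad u' * f (u, u')) = 0 := congrFun hall u
        rw [this]
        simp [partialInt]

end Law

end RegularDensity

end Density

end DDMSLP

namespace DDMSLP

section Problem

variable {p : ℕ} {prog : Program p} {T : ℕ} {Ξ : ℕ → Set (E p)} {μ : Measure (ℕ → E p)}
  {f : ℕ → E p × E p → ℝ}

/-! ### Compactness of the sets of feasible decisions -/

theorem isClosed_feasible_graph (prog : Program p) (t : ℕ) :
    IsClosed {z : prog.Dec t × E p × prog.Dec (t + 1) | z.2.2 ∈ prog.feasible t z.1 z.2.1} := by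
  have hA := prog.continuous_A (t + 1)
  have hB := prog.continuous_B t
  have hb := prog.continuous_b (t + 1)
  have h1 : IsClosed {z : prog.Dec t × E p × prog.Dec (t + 1) | ∀ j, 0 ≤ z.2.2 j} := by
    have : {z : prog.Dec t × E p × prog.Dec (t + 1) | ∀ j, 0 ≤ z.2.2 j}
        = ⋂ j, {z | 0 ≤ z.2.2 j} := by
      ext z
      simp
    rw [this]
    exact isClosed_iInter fun j => isClosed_le continuous_const (by fun_prop)
  have h2 : IsClosed {z : prog.Dec t × E p × prog.Dec (t + 1) |
      (prog.A (t + 1) z.2.1).mulVec z.2.2.ofLp + (prog.B t z.2.1).mulVec z.1.ofLp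
        = prog.b (t + 1) z.2.1} := by
    refine isClosed_eq (Continuous.add ?_ ?_) (by fun_prop)
    · exact Continuous.matrix_mulVec (by fun_prop) (by fun_prop)
    · exact Continuous.matrix_mulVec (by fun_prop) (by fun_prop)
  exact h1.inter h2

theorem smul_recession_mem_feasible {t : ℕ} {x : prog.Dec t} {ξ : E p}
    {y u : prog.Dec (t + 1)} (hy : y ∈ prog.feasible t x ξ) (hu : ∀ j, 0 ≤ u j)
    (hAu : (prog.A (t + 1) ξ).mulVec u.ofLp = 0) {s : ℝ} (hs : 0 ≤ s) :
    y + s • u ∈ prog.feasible t x ξ := by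
  refine ⟨fun j => ?_, ?_⟩
  · have := hy.1 j
    have := mul_nonneg hs (hu j)
    simp only [PiLp.add_apply, PiLp.smul_apply, smul_eq_mul]
    linarith
  · rw [WithLp.ofLp_add, WithLp.ofLp_smul, Matrix.mulVec_add, Matrix.mulVec_smul, hAu, smul_zero,
      add_zero]
    exact hy.2

/-- A nonempty compact polyhedron has no nonzero recession direction. By compactness of `X` and of
the unit sphere this holds with a uniform margin `e`, and since `A y = b - B x` is bounded, so is
`‖y‖`. -/
theorem isBounded_feasible {t : ℕ} {S : Set (prog.Dec t)} {X : Set (E p)} (hS : IsCompact S)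
    (hX : IsCompact X)
    (hrec : ∀ x ∈ S, ∀ ξ ∈ X, (prog.feasible t x ξ).Nonempty ∧ IsCompact (prog.feasible t x ξ)) :
    ∃ R : ℝ, ∀ x ∈ S, ∀ ξ ∈ X, ∀ y ∈ prog.feasible t x ξ, ‖y‖ ≤ R := by
  have hA := prog.continuous_A (t + 1)
  have hB := prog.continuous_B t
  have hb := prog.continuous_b (t + 1)
  rcases S.eq_empty_or_nonempty with rfl | ⟨x₀, hx₀⟩
  · exact ⟨0, by simp⟩
  -- `φ (ξ, u)` measures how far `u` is from the recession cone `{u ≥ 0, A u = 0}`. For `u ≥ 0` it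
  -- reduces to `‖A u‖`.
  let φ : E p × prog.Dec (t + 1) → ℝ := fun z =>
    ‖(prog.A (t + 1) z.1).mulVec z.2.ofLp‖ + ∑ j, max 0 (-z.2 j)
  have hφc : Continuous φ := by
    refine Continuous.add (Continuous.norm ?_) (by fun_prop)
    exact Continuous.matrix_mulVec (by fun_prop) (by fun_prop)
  have hφpos : ∀ z ∈ X ×ˢ Metric.sphere (0 : prog.Dec (t + 1)) 1, 0 < φ z := by
    rintro ⟨ξ, u⟩ ⟨hξ, hu⟩
    rw [mem_sphere_zero_iff_norm] at hu
    by_contra hneg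
    have hsum : ∀ j, 0 ≤ max 0 (-u j) := fun j => le_max_left _ _
    have h1 : ‖(prog.A (t + 1) ξ).mulVec u.ofLp‖ = 0 := le_antisymm
      (by linarith [Finset.sum_nonneg fun j (_ : j ∈ Finset.univ) => hsum j, not_lt.1 hneg])
      (norm_nonneg _)
    have h2 : ∑ j, max 0 (-u j) = 0 := le_antisymm
      (by linarith [norm_nonneg ((prog.A (t + 1) ξ).mulVec u.ofLp), not_lt.1 hneg])
      (Finset.sum_nonneg fun j _ => hsum j)
    have h3 : ∀ j, 0 ≤ u j := fun j => by
      have := (Finset.sum_eq_zero_iff_of_nonneg fun j _ => hsum j).1 h2 j (Finset.mem_univ j)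
      linarith [le_max_right 0 (-u j)]
    obtain ⟨⟨y, hy⟩, hcomp⟩ := hrec x₀ hx₀ ξ hξ
    obtain ⟨R, hR⟩ := hcomp.isBounded.exists_norm_le
    -- A step of this length along the unit vector `u` leaves the ball of radius `R`, which
    -- contradicts boundedness.
    have hs : 0 ≤ R + ‖y‖ + 1 := by linarith [norm_nonneg y, hR y hy]
    have h4 := hR _ (smul_recession_mem_feasible hy h3 (norm_eq_zero.1 h1) hs)
    have h5 := norm_sub_le (y + (R + ‖y‖ + 1) • u) y
    rw [add_sub_cancel_left, norm_smul, hu, Real.norm_of_nonneg hs] at h5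
    linarith
  obtain ⟨e, he, hφe⟩ := (hX.prod (isCompact_sphere (0 : prog.Dec (t + 1)) 1)).exists_forall_le'
    hφc.continuousOn hφpos
  have hrhs : Continuous fun z : prog.Dec t × E p =>
      prog.b (t + 1) z.2 - (prog.B t z.2).mulVec z.1.ofLp := by
    refine Continuous.sub (by fun_prop) ?_
    exact Continuous.matrix_mulVec (by fun_prop) (by fun_prop)
  obtain ⟨M, hM⟩ := (hS.prod hX).exists_bound_of_continuousOn hrhs.continuousOn
  refine ⟨M / e, fun x hx ξ hξ y hy => ?_⟩
  have hMx := hM (x, ξ) ⟨hx, hξ⟩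
  rw [← eq_sub_iff_add_eq.2 hy.2] at hMx
  rw [le_div_iff₀ he]
  by_cases hy0 : y = 0
  · rw [hy0, norm_zero, zero_mul]
    exact (norm_nonneg _).trans hMx
  have hyn : 0 < ‖y‖ := norm_pos_iff.2 hy0
  have h1 := hφe (ξ, ‖y‖⁻¹ • y) ⟨hξ, by
    rw [mem_sphere_zero_iff_norm, norm_smul, norm_inv, norm_norm, inv_mul_cancel₀ hyn.ne']⟩
  have h2 : φ (ξ, ‖y‖⁻¹ • y) = ‖y‖⁻¹ * ‖(prog.A (t + 1) ξ).mulVec y.ofLp‖ := by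
    have h3 : ∀ j, max 0 (-(‖y‖⁻¹ • y) j) = 0 := fun j => by
      have := mul_nonneg (inv_pos.2 hyn).le (hy.1 j)
      simp only [PiLp.smul_apply, smul_eq_mul]
      exact max_eq_left (by linarith)
    simp only [φ]
    rw [Finset.sum_congr rfl fun j _ => h3 j, Finset.sum_const_zero, add_zero, WithLp.ofLp_smul,
      Matrix.mulVec_smul, norm_smul, norm_inv, norm_norm]
  rw [h2, inv_mul_eq_div, le_div_iff₀ hyn] at h1
  linarith

/-- The reachable set of the next stage is a projection of the closed graph of the feasibility map,
cut down to a compact set by the uniform bound on feasible decisions. -/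
theorem isCompact_reach (hA : Assumptions prog T Ξ μ f) : ∀ t ≤ T, IsCompact (prog.reach Ξ t)
  | 0, _ => isCompact_singleton
  | t + 1, ht => by
    have hS := isCompact_reach hA t (by omega)
    have hX := hA.compact (t + 1) ⟨by omega, ht⟩
    obtain ⟨R, hR⟩ := isBounded_feasible hS hX (hA.recourse t (by omega))
    have hG : IsCompact ((prog.reach Ξ t ×ˢ Ξ (t + 1) ×ˢ Metric.closedBall 0 R) ∩
        {z : prog.Dec t × E p × prog.Dec (t + 1) | z.2.2 ∈ prog.feasible t z.1 z.2.1}) :=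
      (hS.prod (hX.prod (isCompact_closedBall _ _))).inter_right (isClosed_feasible_graph prog t)
    have heq : prog.reach Ξ (t + 1) = (fun z => z.2.2) ''
        ((prog.reach Ξ t ×ˢ Ξ (t + 1) ×ˢ Metric.closedBall 0 R) ∩
        {z : prog.Dec t × E p × prog.Dec (t + 1) | z.2.2 ∈ prog.feasible t z.1 z.2.1}) := by
      ext y
      constructor
      · rintro ⟨x, hx, ξ, hξ, hy⟩
        exact ⟨(x, ξ, y), ⟨⟨hx, hξ, by simpa using hR x hx ξ hξ y hy⟩, hy⟩, rfl⟩
      · rintro ⟨⟨x, ξ, y'⟩, ⟨⟨hx, hξ, -⟩, hy⟩, rfl⟩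
        exact ⟨x, hx, ξ, hξ, hy⟩
    rw [heq]
    exact hG.image (by fun_prop)

theorem feasible_subset_reach {t : ℕ} {x : prog.Dec t} (hx : x ∈ prog.reach Ξ t) {ξ : E p}
    (hξ : ξ ∈ Ξ (t + 1)) : prog.feasible t x ξ ⊆ prog.reach Ξ (t + 1) :=
  fun _ hy => ⟨x, hx, ξ, hξ, hy⟩

/-! ### Regularity of the joint densities -/

/-- The complement of the product of the uncertainty sets is open and has probability zero. There
the density is zero almost everywhere, hence everywhere by continuity. -/
theorem Assumptions.density_eq_zero (hA : Assumptions prog T Ξ μ f) {t : ℕ} (h2 : 2 ≤ t)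
    (ht : t < T) {u u' : E p} (h : f t (u, u') ≠ 0) : u ∈ Ξ t ∧ u' ∈ Ξ (t + 1) := by
  have hcont : Continuous (f t) := (hA.density_smooth t h2 ht).continuous
  have hclosed : IsClosed (Ξ t ×ˢ Ξ (t + 1)) :=
    ((hA.compact t ⟨by omega, ht.le⟩).prod (hA.compact (t + 1) ⟨by omega, ht⟩)).isClosed
  set U : Set (E p × E p) := (Ξ t ×ˢ Ξ (t + 1))ᶜ with hU
  have hmU : MeasurableSet U := hclosed.measurableSet.compl
  have h0 : (μ.map fun y => (y t, y (t + 1))) U = 0 := by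
    rw [Measure.map_apply (by fun_prop) hmU]
    have h1 := hA.supported t ⟨by omega, ht.le⟩
    have h2 := hA.supported (t + 1) ⟨by omega, ht⟩
    have h3 : ∀ᵐ y ∂μ, ¬ (y t, y (t + 1)) ∈ U := by
      filter_upwards [h1, h2] with y h1 h2 h3
      exact h3 ⟨h1, h2⟩
    exact measure_mono_null (fun y hy => not_not.2 hy) h3
  rw [hA.density t h2 ht, withDensity_apply _ hmU,
    lintegral_eq_zero_iff hcont.measurable.ennreal_ofReal] at h0
  have h1 : f t =ᵐ[volume.restrict U] fun _ => 0 := h0.mono fun z hz =>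
    le_antisymm (ENNReal.ofReal_eq_zero.1 hz) (hA.density_nonneg t h2 ht z)
  have h2 := Measure.eqOn_open_of_ae_eq h1 hclosed.isOpen_compl hcont.continuousOn
    continuousOn_const
  by_contra hc
  exact h (h2 (x := (u, u')) hc)

theorem Assumptions.regularDensity (hA : Assumptions prog T Ξ μ f) {t : ℕ} (h2 : 2 ≤ t)
    (ht : t < T) : ∃ M : ℝ, 0 ≤ M ∧ RegularDensity (f t) (Ξ t) (Ξ (t + 1)) M := by
  obtain ⟨M, hM⟩ := hA.density_bounded t h2 ht
  have hM0 : 0 ≤ M := (norm_nonneg _).trans (hM 0).1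
  have key := abs_add_sub_le_of_bounded_deriv (hA.density_smooth t h2 ht) hM
  have hnorm : ∀ w : E p, ‖((w, 0) : E p × E p)‖ = ‖w‖ := fun w => by simp [Prod.norm_def]
  refine ⟨2 * M, by positivity, ⟨hA.density_nonneg t h2 ht,
    (hA.density_smooth t h2 ht).continuous, hA.compact t ⟨by omega, ht.le⟩,
    hA.compact (t + 1) ⟨by omega, ht⟩, fun u u' => hA.density_eq_zero h2 ht, fun u w u' => ?_,
    fun u w u' => ?_⟩⟩
  · have := (key (u, u') (w, 0)).1
    rw [Prod.mk_add_mk, add_zero, hnorm] at this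
    nlinarith [norm_nonneg w]
  · have := (key (u, u') (w, 0)).2
    rwa [Prod.mk_add_mk, Prod.mk_sub_mk, add_zero, sub_zero, hnorm] at this

/-- No positivity of the marginal is required: where it vanishes, both sides are zero by the
convention for division. -/
theorem RegularDensity.trueEx_eq {t : ℕ} {K K' : Set (E p)} {M : ℝ}
    (hf : RegularDensity (f t) K K' M) (ht : 2 ≤ t) (ξ : E p) (φ : E p → ℝ) :
    trueEx μ f t ξ φ = partialInt (f t) φ ξ / partialInt (f t) (fun _ => 1) ξ := by
  have hm : Measurable fun ξ' => ENNReal.ofReal (f t (ξ, ξ') / marginal f t ξ) := by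
    have := hf.cont
    exact (Continuous.measurable (by fun_prop)).ennreal_ofReal
  have hm0 : 0 ≤ marginal f t ξ := integral_nonneg fun ξ' => hf.nonneg _
  rw [trueEx, condLaw, if_neg (by omega), integral_withDensity_eq_integral_toReal_smul hm
    (Eventually.of_forall fun _ => ENNReal.ofReal_lt_top), partialInt_one, partialInt,
    ← integral_div]
  refine integral_congr_ae (Eventually.of_forall fun ξ' => ?_)
  simp only [ENNReal.toReal_ofReal (div_nonneg (hf.nonneg _) hm0), smul_eq_mul]
  ring

/-! ### Boundedness and measurability of the true cost-to-go -/

/-- Over a compact piece the infimum is attained, so a sublevel set is the projection of a compact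
set. Continuity is therefore needed only on each of countably many compact pieces, and the value
function need not be continuous. -/
theorem measurable_indicator_sInf {α β : Type*} [TopologicalSpace α] [T2Space α]
    [MeasurableSpace α] [BorelSpace α] [TopologicalSpace β] [T2Space β] {X : Set α}
    {Xn : ℕ → Set α} (hXn : ∀ n, IsCompact (Xn n)) (hX : X = ⋃ n, Xn n) {S : Set β}
    (hS : IsCompact S) {Φ : α → Set β} (hΦ : IsClosed {z : α × β | z.2 ∈ Φ z.1})
    (hne : ∀ a ∈ X, (Φ a).Nonempty) (hsub : ∀ a ∈ X, Φ a ⊆ S) {g : α → β → ℝ}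
    (hg : ∀ n, ContinuousOn (fun z : α × β => g z.1 z.2) (Xn n ×ˢ S)) :
    Measurable (X.indicator fun a => sInf (g a '' Φ a)) := by
  have hXm : MeasurableSet X := by
    rw [hX]
    exact MeasurableSet.iUnion fun n => (hXn n).isClosed.measurableSet
  have hmem : ∀ n, Xn n ⊆ X := fun n => hX ▸ Set.subset_iUnion Xn n
  have himg : ∀ a ∈ X, IsCompact (g a '' Φ a) := fun a ha => by
    obtain ⟨n, hn⟩ := Set.mem_iUnion.1 (hX ▸ ha)
    have h1 : IsClosed (Φ a) := hΦ.preimage (f := fun y : β => (a, y)) (by fun_prop)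
    refine (hS.of_isClosed_subset h1 (hsub a ha)).image_of_continuousOn ?_
    exact (hg n).comp (f := fun y : β => (a, y)) (by fun_prop) fun y hy => ⟨hn, hsub a ha hy⟩
  refine measurable_of_Iic fun c => ?_
  have hlevel : ∀ n, IsCompact {a | a ∈ Xn n ∧ sInf (g a '' Φ a) ≤ c} := fun n => by
    have h1 : IsClosed ((Xn n ×ˢ S) ∩ (fun z : α × β => g z.1 z.2) ⁻¹' Set.Iic c) :=
      (hg n).preimage_isClosed_of_isClosed ((hXn n).prod hS).isClosed isClosed_Iic
    have h2 : IsCompact (((Xn n ×ˢ S) ∩ (fun z : α × β => g z.1 z.2) ⁻¹' Set.Iic c) ∩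
        {z : α × β | z.2 ∈ Φ z.1}) :=
      (((hXn n).prod hS).of_isClosed_subset h1 Set.inter_subset_left).inter_right hΦ
    convert h2.image continuous_fst using 1
    ext a
    constructor
    · rintro ⟨ha, hc⟩
      obtain ⟨y, hy, hya⟩ := (himg a (hmem n ha)).sInf_mem ((hne a (hmem n ha)).image _)
      refine ⟨(a, y), ⟨⟨⟨ha, hsub a (hmem n ha) hy⟩, ?_⟩, hy⟩, rfl⟩
      rw [← hya] at hc
      exact hc
    · rintro ⟨⟨a', y⟩, ⟨⟨⟨ha, -⟩, hc⟩, hy⟩, rfl⟩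
      exact ⟨ha, (csInf_le (himg a' (hmem n ha)).bddBelow ⟨y, hy, rfl⟩).trans hc⟩
  have heq : (X.indicator fun a => sInf (g a '' Φ a)) ⁻¹' Set.Iic c
      = (⋃ n, {a | a ∈ Xn n ∧ sInf (g a '' Φ a) ≤ c}) ∪ (Xᶜ ∩ {_a | 0 ≤ c}) := by
    ext a
    by_cases ha : a ∈ X
    · have : ∃ n, a ∈ Xn n := Set.mem_iUnion.1 (hX ▸ ha)
      simp [ha, this]
    · have : ∀ n, a ∉ Xn n := fun n hn => ha (hmem n hn)
      simp [ha, this]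
  rw [heq]
  exact (MeasurableSet.iUnion fun n => (hlevel n).isClosed.measurableSet).union
    (hXm.compl.inter (MeasurableSet.const _))

theorem abs_csInf_image_le {β : Type*} {Φ : Set β} (hne : Φ.Nonempty) {g : β → ℝ} {B : ℝ}
    (hg : ∀ y ∈ Φ, |g y| ≤ B) : |sInf (g '' Φ)| ≤ B := by
  have hbdd : BddBelow (g '' Φ) := ⟨-B, by
    rintro _ ⟨y, hy, rfl⟩
    exact (abs_le.1 (hg y hy)).1⟩
  refine abs_le.2 ⟨le_csInf (hne.image g) ?_, ?_⟩
  · rintro _ ⟨y, hy, rfl⟩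
    exact (abs_le.1 (hg y hy)).1
  · obtain ⟨y, hy⟩ := hne
    exact (csInf_le hbdd ⟨y, hy, rfl⟩).trans (abs_le.1 (hg y hy)).2

/-- The true cost-to-go of stages `t + 1, …, T` as a function of the parameter vector, set to zero
outside of the uncertainty set. -/
noncomputable def cost (prog : Program p) (T : ℕ) (Ξ : ℕ → Set (E p)) (μ : Measure (ℕ → E p))
    (f : ℕ → E p × E p → ℝ) (t : ℕ) (x : prog.Dec t) : E p → ℝ :=
  (Ξ (t + 1)).indicator fun ξ => prog.costToGo (trueEx μ f) (T - t) t x ξ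

theorem cost_of_mem {t : ℕ} {x : prog.Dec t} {ξ : E p} (hξ : ξ ∈ Ξ (t + 1)) :
    cost prog T Ξ μ f t x ξ = prog.costToGo (trueEx μ f) (T - t) t x ξ :=
  Set.indicator_of_mem hξ _

theorem cost_of_notMem {t : ℕ} {x : prog.Dec t} {ξ : E p} (hξ : ξ ∉ Ξ (t + 1)) :
    cost prog T Ξ μ f t x ξ = 0 :=
  Set.indicator_of_notMem hξ _

theorem cost_lipschitz {L : ℕ → ℝ} (hL : IsLipschitzBound prog T Ξ μ f L) {t : ℕ} (h1 : 1 ≤ t)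
    (ht : t < T) (hL0 : 0 ≤ L (t + 1)) :
    ∀ᵐ y ∂μ, ∀ x ∈ prog.reach Ξ t, ∀ x' ∈ prog.reach Ξ t,
      |cost prog T Ξ μ f t x (y (t + 1)) - cost prog T Ξ μ f t x' (y (t + 1))|
        ≤ L (t + 1) * dist x x' := by
  filter_upwards [hL t h1 ht] with y hy x hx x' hx'
  by_cases hξ : y (t + 1) ∈ Ξ (t + 1)
  · rw [cost_of_mem hξ, cost_of_mem hξ, dist_eq_norm]
    exact hy x hx x' hx'
  · rw [cost_of_notMem hξ, cost_of_notMem hξ, sub_zero, abs_zero]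
    positivity

theorem trueEx_cost (hA : Assumptions prog T Ξ μ f) {t : ℕ} (h2 : 2 ≤ t) (ht : t < T)
    (x : prog.Dec t) (ξ : E p) :
    trueEx μ f t ξ (fun ξ' => prog.costToGo (trueEx μ f) (T - t) t x ξ')
      = partialInt (f t) (cost prog T Ξ μ f t x) ξ / partialInt (f t) (fun _ => 1) ξ := by
  obtain ⟨M, -, hf⟩ := hA.regularDensity h2 ht
  rw [hf.trueEx_eq h2]
  congr 1
  exact hf.partialInt_congr (fun u' hu' => (cost_of_mem hu').symm) ξ

/-- The function is jointly Lipschitz. In `ξ` this comes from the density alone. In the decision it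
comes from the Lipschitz constant of the cost-to-go, which holds only almost surely and is carried
to every `ξ` by `abs_partialInt_le_of_ae`. -/
theorem continuousOn_partialInt_cost (hA : Assumptions prog T Ξ μ f) {L : ℕ → ℝ}
    (hL : IsLipschitzBound prog T Ξ μ f L) {t : ℕ} (h2 : 2 ≤ t) (ht : t < T)
    (hL0 : 0 ≤ L (t + 1)) {B : ℝ} (hB : ∀ x ∈ prog.reach Ξ t, ∀ ξ, |cost prog T Ξ μ f t x ξ| ≤ B)
    (hm : ∀ x ∈ prog.reach Ξ t, Measurable (cost prog T Ξ μ f t x)) :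
    ContinuousOn (fun z : E p × prog.Dec t => partialInt (f t) (cost prog T Ξ μ f t z.2) z.1)
      (Set.univ ×ˢ prog.reach Ξ t) := by
  obtain ⟨M, hM, hf⟩ := hA.regularDensity h2 ht
  obtain ⟨R, hR0, hR⟩ := hf.exists_partialInt_one_le
  have hlip := cost_lipschitz hL (by omega) ht hL0
  refine (LipschitzOnWith.of_dist_le' (K := |B| * M * volume.real (Ξ (t + 1)) + L (t + 1) * R)
    ?_).continuousOn
  rintro ⟨ξ, x⟩ ⟨-, hx⟩ ⟨ξ', x'⟩ ⟨-, hx'⟩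
  dsimp only at hx hx' ⊢
  have hB' : ∀ ξ, |cost prog T Ξ μ f t x ξ| ≤ |B| := fun ξ => (hB x hx ξ).trans (le_abs_self B)
  have hB0 := abs_nonneg B
  have h3 : |partialInt (f t) (cost prog T Ξ μ f t x) ξ'
      - partialInt (f t) (cost prog T Ξ μ f t x') ξ'| ≤ L (t + 1) * dist x x' * R := by
    have hsub : partialInt (f t) (cost prog T Ξ μ f t x) ξ'
        - partialInt (f t) (cost prog T Ξ μ f t x') ξ'
        = partialInt (f t) (fun u => cost prog T Ξ μ f t x u - cost prog T Ξ μ f t x' u) ξ' := by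
      rw [partialInt, partialInt, partialInt, ← integral_sub
        (hf.integrable_mul_slice (hm x hx) (hB x hx) _)
        (hf.integrable_mul_slice (hm x' hx') (hB x' hx') _)]
      simp only [sub_mul]
    rw [hsub]
    refine (hf.abs_partialInt_le_of_ae (measurable_pi_apply t) (measurable_pi_apply (t + 1))
      (hA.density t h2 ht) ((hm x hx).sub (hm x' hx')) (B := B + B)
      (c := L (t + 1) * dist x x') (fun u => (abs_sub _ _).trans
        (add_le_add (hB x hx u) (hB x' hx' u))) (by positivity) ?_ ξ').trans ?_
    · exact hlip.mono fun y hy => hy x hx x' hx'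
    · exact mul_le_mul_of_nonneg_left (hR ξ') (by positivity)
  have h4 := hf.abs_partialInt_sub_le (hm x hx) hB' ξ ξ'
  rw [Real.dist_eq, Prod.dist_eq]
  have hV := measureReal_nonneg (μ := volume) (s := Ξ (t + 1))
  calc _ ≤ |partialInt (f t) (cost prog T Ξ μ f t x) ξ
          - partialInt (f t) (cost prog T Ξ μ f t x) ξ'|
        + |partialInt (f t) (cost prog T Ξ μ f t x) ξ'
          - partialInt (f t) (cost prog T Ξ μ f t x') ξ'| := abs_sub_le _ _ _
    _ ≤ |B| * M * volume.real (Ξ (t + 1)) * dist ξ ξ' + L (t + 1) * dist x x' * R := by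
        rw [dist_eq_norm ξ]
        exact add_le_add h4 h3
    _ ≤ |B| * M * volume.real (Ξ (t + 1)) * max (dist ξ ξ') (dist x x')
        + L (t + 1) * max (dist ξ ξ') (dist x x') * R := by
        gcongr
        · exact le_max_left _ _
        · exact le_max_right _ _
    _ = _ := by ring

/-- Backward induction on the stages. The conditional expectation is a quotient by the marginal
density and may be discontinuous where the marginal vanishes, which is why the uncertainty set is
split into compact pieces. -/
theorem cost_bounded_measurable (hA : Assumptions prog T Ξ μ f) {L : ℕ → ℝ}
    (hL_pos : ∀ t ∈ Finset.Icc 2 T, 0 < L t) (hL : IsLipschitzBound prog T Ξ μ f L) (k : ℕ) :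
    ∀ t, 1 ≤ t → t + k = T →
      (∃ B : ℝ, ∀ x ∈ prog.reach Ξ t, ∀ ξ, |cost prog T Ξ μ f t x ξ| ≤ B) ∧
      ∀ x ∈ prog.reach Ξ t, Measurable (cost prog T Ξ μ f t x) := by
  induction k with
  | zero =>
    intro t _ htT
    have h0 : ∀ x, cost prog T Ξ μ f t x = 0 := fun x => by
      funext ξ
      rw [cost, show T - t = 0 by omega]
      simp [Program.costToGo]
    exact ⟨⟨0, fun x _ ξ => by simp [h0]⟩, fun x _ => by
      rw [h0]
      exact measurable_zero⟩
  | succ k ih =>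
    intro t ht1 htT
    obtain ⟨⟨B, hB⟩, hm⟩ := ih (t + 1) (by omega) (by omega)
    have hX := hA.compact (t + 1) ⟨by omega, by omega⟩
    have hS := isCompact_reach hA (t + 1) (by omega)
    have hc := prog.continuous_c (t + 1)
    set V : E p → prog.Dec (t + 1) → ℝ := fun ξ y =>
      trueEx μ f (t + 1) ξ (fun ξ' => prog.costToGo (trueEx μ f) k (t + 1) y ξ') with hV
    have hcost : ∀ x, cost prog T Ξ μ f t x = (Ξ (t + 1)).indicator fun ξ =>
        sInf ((fun y => prog.c (t + 1) ξ ⬝ᵥ y.ofLp + V ξ y) '' prog.feasible t x ξ) := fun x => by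
      rw [cost, show T - t = k + 1 by omega]
      rfl
    have hlin : Continuous fun z : E p × prog.Dec (t + 1) => prog.c (t + 1) z.1 ⬝ᵥ z.2.ofLp := by
      simp only [dotProduct]
      fun_prop
    have hstruct : (∃ B' : ℝ, ∀ ξ, ∀ y ∈ prog.reach Ξ (t + 1), |V ξ y| ≤ B') ∧
        ∃ Xn : ℕ → Set (E p), (∀ n, IsCompact (Xn n)) ∧ Ξ (t + 1) = (⋃ n, Xn n) ∧
          ∀ n, ContinuousOn (fun z : E p × prog.Dec (t + 1) => V z.1 z.2)
            (Xn n ×ˢ prog.reach Ξ (t + 1)) := by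
      rcases Nat.eq_zero_or_pos k with rfl | hk
      · have hV0 : ∀ ξ y, V ξ y = 0 := fun ξ y => by simp [hV, Program.costToGo, trueEx]
        refine ⟨⟨0, fun ξ y _ => by simp [hV0]⟩, fun _ => Ξ (t + 1), fun _ => hX,
          (Set.iUnion_const _).symm, fun n => ?_⟩
        simp only [hV0]
        exact continuousOn_const
      · obtain ⟨M, -, hf⟩ := hA.regularDensity (t := t + 1) (by omega) (by omega)
        set m : E p → ℝ := partialInt (f (t + 1)) (fun _ => 1) with hm_def
        have hmc : Continuous m := hf.continuous_partialInt measurable_const (B := 1) (by simp)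
        have hm0 : ∀ ξ, 0 ≤ m ξ := hf.partialInt_nonneg fun _ => zero_le_one
        have hVeq : ∀ ξ y, V ξ y
            = partialInt (f (t + 1)) (cost prog T Ξ μ f (t + 1) y) ξ / m ξ := fun ξ y => by
          rw [hV, ← trueEx_cost hA (by omega) (by omega), show T - (t + 1) = k by omega]
        -- The pieces are the zero set of the marginal, where the quotient is identically zero by
        -- the division convention, and the sets where the marginal is at least `1 / (n + 1)`, where
        -- the quotient is continuous.
        refine ⟨⟨|B|, fun ξ y hy => ?_⟩, fun n => Nat.casesOn n (Ξ (t + 1) ∩ {ξ | m ξ ≤ 0})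
          fun n => Ξ (t + 1) ∩ {ξ | 1 / ((n : ℝ) + 1) ≤ m ξ}, fun n => ?_, ?_, fun n => ?_⟩
        · rw [hVeq, abs_div, abs_of_nonneg (hm0 ξ)]
          refine div_le_of_le_mul₀ (hm0 ξ) (abs_nonneg B) ?_
          refine (hf.abs_partialInt_le (hB y hy) ξ).trans ?_
          exact mul_le_mul_of_nonneg_right (le_abs_self B) (hm0 ξ)
        · cases n with
          | zero => exact hX.inter_right (isClosed_le hmc continuous_const)
          | succ n => exact hX.inter_right (isClosed_le continuous_const hmc)
        · ext ξ
          rw [Set.mem_iUnion]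
          constructor
          · intro hξ
            rcases (hm0 ξ).eq_or_lt with h0 | hpos
            · exact ⟨0, hξ, h0.ge⟩
            · obtain ⟨n, hn⟩ := exists_nat_one_div_lt hpos
              exact ⟨n + 1, hξ, hn.le⟩
          · rintro ⟨n, hn⟩
            cases n with
            | zero => exact hn.1
            | succ n => exact hn.1
        · cases n with
          | zero =>
            refine (continuousOn_const (c := (0 : ℝ))).congr ?_
            rintro ⟨ξ, y⟩ ⟨⟨-, hξ⟩, -⟩
            have h0 : m ξ = 0 := le_antisymm hξ (hm0 ξ)
            simp only [hVeq, h0, div_zero]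
          | succ n =>
            simp only [hVeq]
            refine ContinuousOn.div ?_ (by fun_prop) ?_
            · exact (continuousOn_partialInt_cost hA hL (by omega) (by omega)
                (hL_pos (t + 1 + 1) (Finset.mem_Icc.2 ⟨by omega, by omega⟩)).le hB hm).mono
                (Set.prod_mono (Set.subset_univ _) subset_rfl)
            · rintro ⟨ξ, y⟩ ⟨⟨-, hξ⟩, -⟩
              have : (0 : ℝ) < 1 / ((n : ℝ) + 1) := by positivity
              exact (this.trans_le hξ).ne'
    obtain ⟨⟨B', hB'⟩, Xn, hXn, hXeq, hVc⟩ := hstruct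
    obtain ⟨C, hC⟩ := (hX.prod hS).exists_bound_of_continuousOn hlin.continuousOn
    constructor
    · refine ⟨max 0 (C + B'), fun x hx ξ => ?_⟩
      by_cases hξ : ξ ∈ Ξ (t + 1)
      · rw [hcost, Set.indicator_of_mem hξ]
        refine (abs_csInf_image_le (hA.recourse t (by omega) x hx ξ hξ).1
          fun y hy => ?_).trans (le_max_right _ _)
        have hy' := feasible_subset_reach hx hξ hy
        exact (abs_add_le _ _).trans (add_le_add (hC (ξ, y) ⟨hξ, hy'⟩) (hB' ξ y hy'))
      · rw [cost_of_notMem hξ, abs_zero]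
        exact le_max_left _ _
    · intro x hx
      rw [hcost]
      refine measurable_indicator_sInf hXn hXeq hS (Φ := prog.feasible t x) ?_
        (fun ξ hξ => (hA.recourse t (by omega) x hx ξ hξ).1)
        (fun ξ hξ => feasible_subset_reach hx hξ) fun n => ?_
      · exact (isClosed_feasible_graph prog t).preimage
          (f := fun z : E p × prog.Dec (t + 1) => (x, z.1, z.2)) (by fun_prop)
      · exact hlin.continuousOn.add (hVc n)

end Problem

end DDMSLP

namespace DDMSLP

/-! ### The order of the bandwidth -/

section Rate

/-- The rate `N ^ (-1 / (p + 4))` of the bandwidth. -/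
noncomputable def rate (p N : ℕ) : ℝ := (N : ℝ) ^ (-(1 : ℝ) / (p + 4))

theorem rate_pos (p : ℕ) {N : ℕ} (hN : 1 ≤ N) : 0 < rate p N :=
  Real.rpow_pos_of_pos (by exact_mod_cast hN) _

theorem rate_le_one (p : ℕ) {N : ℕ} (hN : 1 ≤ N) : rate p N ≤ 1 :=
  Real.rpow_le_one_of_one_le_of_nonpos (by exact_mod_cast hN)
    (div_nonpos_of_nonpos_of_nonneg (by norm_num) (by positivity))

theorem rate_pow_mul (p : ℕ) {N : ℕ} (hN : 1 ≤ N) : rate p N ^ (p + 4) * N = 1 := by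
  have hN' : (0 : ℝ) < N := by exact_mod_cast hN
  have hp : ((p + 4 : ℕ) : ℝ) = (p : ℝ) + 4 := by push_cast; ring
  rw [rate, ← Real.rpow_natCast, ← Real.rpow_mul hN'.le, hp, div_mul_cancel₀ _ (by positivity),
    Real.rpow_neg_one, inv_mul_cancel₀ hN'.ne']

theorem rate_sq (p N : ℕ) : rate p N ^ 2 = 1 / (N : ℝ) ^ ((2 : ℝ) / (p + 4)) := by
  have hN' : (0 : ℝ) ≤ N := Nat.cast_nonneg N
  rw [rate, ← Real.rpow_natCast, ← Real.rpow_mul hN', one_div, ← Real.rpow_neg hN']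
  congr 1
  push_cast
  ring

theorem inv_rate_le (p : ℕ) {N : ℕ} (hN : 1 ≤ N) : (rate p N)⁻¹ ≤ N := by
  have h1 := rate_pos p hN
  have h2 := rate_pow_mul p hN
  have h3 : rate p N ^ (p + 4) ≤ rate p N := pow_le_of_le_one h1.le (rate_le_one p hN) (by omega)
  rw [inv_le_iff_one_le_mul₀ h1]
  nlinarith [mul_le_mul_of_nonneg_left h3 (Nat.cast_nonneg (α := ℝ) N)]

theorem tendsto_rate (p : ℕ) : Tendsto (rate p) atTop (𝓝 0) := by
  have h1 : (0 : ℝ) < 1 / ((p : ℝ) + 4) := by positivity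
  refine ((tendsto_rpow_neg_atTop h1).comp tendsto_natCast_atTop_atTop).congr fun N => ?_
  simp only [Function.comp_apply, rate, neg_div]

theorem tendsto_log_mul_rate_pow (p : ℕ) {k : ℕ} (hk : 1 ≤ k) :
    Tendsto (fun N : ℕ => Real.log N * rate p N ^ k) atTop (𝓝 0) := by
  have h1 : (0 : ℝ) < k / ((p : ℝ) + 4) := by
    have : (0 : ℝ) < k := by exact_mod_cast hk
    positivity
  refine (((isLittleO_log_rpow_atTop h1).tendsto_div_nhds_zero).comp
    tendsto_natCast_atTop_atTop).congr fun N => ?_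
  have hN' : (0 : ℝ) ≤ N := Nat.cast_nonneg N
  simp only [Function.comp_apply, rate]
  rw [← Real.rpow_natCast ((N : ℝ) ^ _), ← Real.rpow_mul hN', div_eq_mul_inv,
    ← Real.rpow_neg hN']
  congr 2
  ring

theorem eventually_one_le_log : ∀ᶠ N : ℕ in atTop, 1 ≤ Real.log N :=
  (Real.tendsto_log_atTop.comp tendsto_natCast_atTop_atTop).eventually_ge_atTop 1

/-- Bandwidths between multiples `c` and `C` of the rate. -/
structure IsBandwidth (p : ℕ) (c C : ℝ) (h : ℕ → ℝ) : Prop where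
  pos : 0 < c
  pos' : 0 < C
  bounds : ∀ᶠ N : ℕ in atTop, c * rate p N ≤ h N ∧ h N ≤ C * rate p N

variable {p : ℕ} {c C : ℝ} {h : ℕ → ℝ}

theorem exists_isBandwidth (hc : 0 < c)
    (h_upper : h =O[atTop] fun N : ℕ => (N : ℝ) ^ (-(1 : ℝ) / (p + 4)))
    (h_lower : ∀ᶠ N : ℕ in atTop, c * (N : ℝ) ^ (-(1 : ℝ) / (p + 4)) ≤ h N) :
    ∃ C, IsBandwidth p c C h := by
  obtain ⟨C, hC, hb⟩ := h_upper.exists_pos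
  refine ⟨C, hc, hC, ?_⟩
  filter_upwards [h_lower, hb.bound] with N h1 h2
  refine ⟨h1, (le_abs_self _).trans ?_⟩
  rwa [Real.norm_eq_abs, Real.norm_of_nonneg (Real.rpow_nonneg (Nat.cast_nonneg N) _)] at h2

namespace IsBandwidth

theorem eventually_pos (hh : IsBandwidth p c C h) : ∀ᶠ N in atTop, 0 < h N := by
  filter_upwards [hh.bounds, eventually_ge_atTop 1] with N hb hN
  exact (mul_pos hh.pos (rate_pos p hN)).trans_le hb.1

theorem eventually_le_one (hh : IsBandwidth p c C h) : ∀ᶠ N in atTop, h N ≤ 1 := by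
  have := (tendsto_rate p).const_mul C
  rw [mul_zero] at this
  filter_upwards [hh.bounds, this.eventually (ge_mem_nhds one_pos)] with N hb hN
  exact hb.2.trans hN

theorem eventually_inv_le (hh : IsBandwidth p c C h) : ∀ᶠ N : ℕ in atTop, (h N)⁻¹ ≤ c⁻¹ * N := by
  filter_upwards [hh.bounds, eventually_ge_atTop 1] with N hb hN
  have h1 := mul_pos hh.pos (rate_pos p hN)
  calc (h N)⁻¹ ≤ (c * rate p N)⁻¹ := inv_anti₀ h1 hb.1
    _ = c⁻¹ * (rate p N)⁻¹ := mul_inv _ _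
    _ ≤ c⁻¹ * N := mul_le_mul_of_nonneg_left (inv_rate_le p hN) (inv_pos.2 hh.pos).le

/-- The effective sample size `N h ^ p` is at least of the order `N ^ (4 / (p + 4))`. -/
theorem eventually_le_mul_pow (hh : IsBandwidth p c C h) :
    ∀ᶠ N : ℕ in atTop, c ^ p ≤ N * h N ^ p * rate p N ^ 4 := by
  filter_upwards [hh.bounds, eventually_ge_atTop 1] with N hb hN
  have h1 := mul_pos hh.pos (rate_pos p hN)
  have h2 := rate_pow_mul p hN
  calc c ^ p = c ^ p * (rate p N ^ (p + 4) * N) := by rw [h2, mul_one]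
    _ = N * (c * rate p N) ^ p * rate p N ^ 4 := by rw [mul_pow, pow_add]; ring
    _ ≤ N * h N ^ p * rate p N ^ 4 := by
        have := pow_le_pow_left₀ h1.le hb.1 p
        gcongr

theorem eventually_mul_pow_le (hh : IsBandwidth p c C h) :
    ∀ᶠ N : ℕ in atTop, N * h N ^ p * rate p N ^ 4 ≤ C ^ p := by
  filter_upwards [hh.bounds, eventually_ge_atTop 1, hh.eventually_pos] with N hb hN hpos
  have h2 := rate_pow_mul p hN
  calc N * h N ^ p * rate p N ^ 4 ≤ N * (C * rate p N) ^ p * rate p N ^ 4 := by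
        have := pow_le_pow_left₀ hpos.le hb.2 p
        gcongr
    _ = C ^ p * (rate p N ^ (p + 4) * N) := by rw [mul_pow, pow_add]; ring
    _ = C ^ p := by rw [h2, mul_one]

theorem tendsto_log_div (hh : IsBandwidth p c C h) :
    Tendsto (fun N : ℕ => Real.log N / (N * h N ^ p)) atTop (𝓝 0) := by
  have h0 := (tendsto_log_mul_rate_pow p (k := 4) (by norm_num)).const_mul (c ^ p)⁻¹
  rw [mul_zero] at h0
  refine tendsto_of_tendsto_of_tendsto_of_le_of_le' tendsto_const_nhds h0 ?_ ?_
  · filter_upwards [hh.eventually_pos, eventually_one_le_log] with N hpos hlog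
    positivity
  · filter_upwards [hh.eventually_pos, eventually_one_le_log, hh.eventually_le_mul_pow,
      eventually_ge_atTop 1] with N hpos hlog hle hN
    have hN' : (0 : ℝ) < N := by exact_mod_cast hN
    have hcp := pow_pos hh.pos p
    rw [div_le_iff₀ (by positivity), ← div_eq_inv_mul, div_mul_eq_mul_div, le_div_iff₀ hcp]
    nlinarith

/-- The statistical error, the discretization error and the bias of the kernel sums are all of the
order `N h ^ p * rate ^ 2 * √(log N)`. -/
theorem eventually_error_le (hh : IsBandwidth p c C h) {κ Λ M : ℝ} (hκ : 0 ≤ κ) (hΛ : 0 ≤ Λ)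
    (hM : 0 ≤ M) :
    ∃ A : ℝ, 0 ≤ A ∧ ∀ᶠ N : ℕ in atTop,
      κ * √(N * h N ^ p * Real.log N) + 2 * Λ + N * (h N ^ p * (h N ^ 2 * M))
        ≤ A * (N * h N ^ p * (rate p N ^ 2 * √(Real.log N))) := by
  have hcp := pow_pos hh.pos p
  -- One summand per source of error: for the deviation, `c ^ p ≤ N h ^ p rate ^ 4`; for the
  -- constant `2 Λ`, the consequence `c ^ p ≤ N h ^ p rate ^ 2`; for the bias, `h ≤ C rate`.
  refine ⟨κ * (√(c ^ p))⁻¹ + 2 * Λ * (c ^ p)⁻¹ + C ^ 2 * M, by positivity, ?_⟩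
  filter_upwards [hh.eventually_pos, eventually_one_le_log, hh.eventually_le_mul_pow,
    eventually_ge_atTop 1, hh.bounds] with N hpos hlog hle hN hb
  have hN' : (0 : ℝ) < N := by exact_mod_cast hN
  have hr := rate_pos p hN
  have hr1 := rate_le_one p hN
  have hs : 1 ≤ √(Real.log N) := Real.one_le_sqrt.2 hlog
  set n : ℝ := N * h N ^ p with hn
  have hn0 : 0 < n := by positivity
  have h1 : √(n * Real.log N) ≤ (√(c ^ p))⁻¹ * (n * (rate p N ^ 2 * √(Real.log N))) := by
    rw [Real.sqrt_mul hn0.le, ← div_eq_inv_mul, le_div_iff₀ (Real.sqrt_pos.2 hcp)]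
    have h2 : √(c ^ p) ≤ √n * rate p N ^ 2 := by
      refine Real.sqrt_le_iff.2 ⟨by positivity, hle.trans (le_of_eq ?_)⟩
      rw [mul_pow, Real.sq_sqrt hn0.le]
      ring
    calc √n * √(Real.log N) * √(c ^ p) ≤ √n * √(Real.log N) * (√n * rate p N ^ 2) := by gcongr
      _ = (√n * √n) * (rate p N ^ 2 * √(Real.log N)) := by ring
      _ = _ := by rw [Real.mul_self_sqrt hn0.le]
  have h2 : 1 ≤ (c ^ p)⁻¹ * (n * (rate p N ^ 2 * √(Real.log N))) := by
    rw [← div_eq_inv_mul, le_div_iff₀ hcp, one_mul]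
    have h3 : rate p N ^ 4 ≤ rate p N ^ 2 := pow_le_pow_of_le_one hr.le hr1 (by norm_num)
    calc c ^ p ≤ n * rate p N ^ 4 := hle
      _ ≤ n * (rate p N ^ 2 * 1) := by rw [mul_one]; gcongr
      _ ≤ n * (rate p N ^ 2 * √(Real.log N)) := by gcongr
  have h3 : N * (h N ^ p * (h N ^ 2 * M)) ≤ C ^ 2 * M * (n * (rate p N ^ 2 * √(Real.log N))) := by
    have h4 : h N ^ 2 ≤ (C * rate p N) ^ 2 := pow_le_pow_left₀ hpos.le hb.2 2
    calc N * (h N ^ p * (h N ^ 2 * M)) = n * (h N ^ 2 * M) := by rw [hn]; ring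
      _ ≤ n * ((C * rate p N) ^ 2 * M) := by gcongr
      _ = C ^ 2 * M * (n * (rate p N ^ 2 * 1)) := by ring
      _ ≤ _ := by
        have := hh.pos'
        gcongr
  have h5 := mul_le_mul_of_nonneg_left h1 hκ
  have h6 := mul_le_mul_of_nonneg_left h2 (by positivity : 0 ≤ 2 * Λ)
  linarith

end IsBandwidth

end Rate

/-! ### Uniform convergence of the estimated conditional expectations -/

section Uniform

variable {p : ℕ} {c C : ℝ} {h : ℕ → ℝ} {μ : Measure (ℕ → E p)} [IsProbabilityMeasure μ]
  {Ω : Type*} [MeasurableSpace Ω] {P : Measure Ω} [IsProbabilityMeasure P]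
  {X : ℕ → Ω → ℕ → E p}

/-- The uniform deviation bound is applied with index `(x, ξ)` and `v = h ^ p`: integrating the
squared kernel against a bounded marginal gives second moments of this order. The Lipschitz constant
in `ξ` is of order `1 / h`, hence at most of order `N`. The mean of a term is a smoothed partial
integral, whose bias is of second order. -/
theorem tendsto_measure_kernelSum (hX_meas : ∀ i, Measurable (X i)) (hX_law : ∀ i, P.map (X i) = μ)
    (hX_indep : iIndepFun X P) (hh : IsBandwidth p c C h) {f : E p × E p → ℝ} {K K' : Set (E p)}
    {M : ℝ} (hM : 0 ≤ M) (hf : RegularDensity f K K' M) {t : ℕ}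
    (hμ : μ.map (fun y => (y t, y (t + 1))) = volume.withDensity fun z => ENNReal.ofReal (f z))
    {n : ℕ} {S : Set (EuclideanSpace ℝ (Fin n))} (hS : Bornology.IsBounded S)
    {q : EuclideanSpace ℝ (Fin n) → E p → ℝ} (hq : ∀ x ∈ S, Measurable (q x)) {B L : ℝ}
    (hB0 : 0 ≤ B) (hL0 : 0 ≤ L) (hB : ∀ x ∈ S, ∀ u, |q x u| ≤ B)
    (hL : ∀ᵐ y ∂μ, ∀ x ∈ S, ∀ x' ∈ S, |q x (y (t + 1)) - q x' (y (t + 1))| ≤ L * dist x x') :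
    ∃ A : ℝ, 0 ≤ A ∧ Tendsto (fun N : ℕ => P {ω | ¬ ∀ x ∈ S, ∀ ξ ∈ K,
      |∑ j ∈ Finset.range N, kern ((h N)⁻¹ • (ξ - X j ω t)) * q x (X j ω (t + 1))
          - N * (h N ^ p * ((∫ v : E p, kern v) * partialInt f (q x) ξ))|
        ≤ A * (N * h N ^ p * (rate p N ^ 2 * √(Real.log N)))}) atTop (𝓝 0) := by
  obtain ⟨R, hR0, hR⟩ := hf.exists_partialInt_one_le
  have hkc := continuous_kern (p := p)
  have hkm : ∀ (b : ℝ) (ξ : E p), Measurable fun u : E p => kern (b • (ξ - u)) := fun b ξ =>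
    Continuous.measurable (by fun_prop)
  set S' : Set (EuclideanSpace ℝ (Fin n) × E p) := S ×ˢ K with hS'
  set Z : ℕ → EuclideanSpace ℝ (Fin n) × E p → (ℕ → E p) → ℝ := fun N θ y =>
    kern ((h N)⁻¹ • (θ.2 - y t)) * q θ.1 (y (t + 1)) with hZ_def
  have hZm : ∀ N, ∀ θ ∈ S', Measurable (Z N θ) := fun N θ hθ =>
    ((hkm _ _).comp (measurable_pi_apply t)).mul ((hq _ hθ.1).comp (measurable_pi_apply (t + 1)))
  have hZB : ∀ N, ∀ θ ∈ S', ∀ y, |Z N θ y| ≤ B := fun N θ hθ y => by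
    rw [hZ_def, abs_mul]
    exact (mul_le_of_le_one_left (abs_nonneg _) (abs_kern_le_one _)).trans (hB _ hθ.1 _)
  set Λ : ℝ := c⁻¹ * B + L with hΛ
  have hc := hh.pos
  have hΛ0 : 0 ≤ Λ := by positivity
  have hW : ∀ᶠ N in atTop, ∀ θ ∈ S',
      ∫ y, Z N θ y ^ 2 ∂μ ≤ (B ^ 2 * (R * ∫ v : E p, kern v ^ 2)) * h N ^ p := by
    filter_upwards [hh.eventually_pos] with N hpos θ hθ
    have hψm : Measurable fun u : E p => kern ((h N)⁻¹ • (θ.2 - u)) ^ 2 := (hkm _ _).pow_const 2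
    have hψ1 : ∀ u : E p, |kern ((h N)⁻¹ • (θ.2 - u)) ^ 2| ≤ 1 := fun u => by
      rw [abs_pow]
      exact pow_le_one₀ (abs_nonneg _) (abs_kern_le_one _)
    have hiψ : Integrable fun u : E p => kern ((h N)⁻¹ • (θ.2 - u)) ^ 2 :=
      integrable_comp_scaled_sub hpos θ.2 integrable_kern_sq
    calc ∫ y, Z N θ y ^ 2 ∂μ ≤ ∫ y, B ^ 2 * kern ((h N)⁻¹ • (θ.2 - y t)) ^ 2 ∂μ := by
          refine integral_mono (integrable_of_abs_le (B := B ^ 2) ((hZm N θ hθ).pow_const 2)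
            fun y => ?_) (integrable_of_abs_le (B := B ^ 2)
            ((hψm.comp (measurable_pi_apply t)).const_mul _) fun y => ?_) fun y => ?_
          · rw [abs_pow]
            exact pow_le_pow_left₀ (abs_nonneg _) (hZB N θ hθ y) 2
          · rw [abs_mul, abs_of_nonneg (sq_nonneg B)]
            exact mul_le_of_le_one_right (sq_nonneg B) (hψ1 _)
          · simp only [hZ_def, mul_pow]
            rw [mul_comm]
            refine mul_le_mul_of_nonneg_right ?_ (sq_nonneg _)
            rw [← sq_abs]
            exact pow_le_pow_left₀ (abs_nonneg _) (hB _ hθ.1 _) 2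
      _ = B ^ 2 * ∫ u, kern ((h N)⁻¹ • (θ.2 - u)) ^ 2 * partialInt f (fun _ => 1) u := by
          rw [integral_const_mul, hf.integral_comp_fst (measurable_pi_apply t)
            (measurable_pi_apply (t + 1)) hμ hψm hψ1]
      _ ≤ B ^ 2 * ∫ u : E p, kern ((h N)⁻¹ • (θ.2 - u)) ^ 2 * R := by
          refine mul_le_mul_of_nonneg_left (integral_mono_of_nonneg ?_ (hiψ.mul_const R) ?_)
            (sq_nonneg B)
          · exact Eventually.of_forall fun u => mul_nonneg (sq_nonneg _)
              (hf.partialInt_nonneg (fun _ => zero_le_one) u)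
          · exact Eventually.of_forall fun u => mul_le_mul_of_nonneg_left (hR u) (sq_nonneg _)
      _ = _ := by
          rw [integral_mul_const, integral_comp_scaled_sub hpos θ.2 fun v => kern v ^ 2]
          ring
  have hlip : ∀ᶠ N : ℕ in atTop, ∀ᵐ y ∂μ, ∀ θ ∈ S', ∀ θ' ∈ S',
      |Z N θ y - Z N θ' y| ≤ (Λ * N) * dist θ θ' := by
    filter_upwards [hh.eventually_pos, hh.eventually_inv_le, eventually_ge_atTop 1]
      with N hpos hinv hN
    have hN' : (1 : ℝ) ≤ N := by exact_mod_cast hN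
    filter_upwards [hL] with y hy θ hθ θ' hθ'
    have e1 : Z N θ y - Z N θ' y = (kern ((h N)⁻¹ • (θ.2 - y t)) - kern ((h N)⁻¹ • (θ'.2 - y t)))
        * q θ.1 (y (t + 1)) + kern ((h N)⁻¹ • (θ'.2 - y t))
        * (q θ.1 (y (t + 1)) - q θ'.1 (y (t + 1))) := by
      simp only [hZ_def]
      ring
    have e2 : |kern ((h N)⁻¹ • (θ.2 - y t)) - kern ((h N)⁻¹ • (θ'.2 - y t))|
        ≤ c⁻¹ * N * dist θ θ' := by
      refine (abs_kern_sub_le _ _).trans ?_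
      rw [← smul_sub, sub_sub_sub_cancel_right, norm_smul,
        Real.norm_of_nonneg (inv_pos.2 hpos).le, ← dist_eq_norm]
      exact mul_le_mul hinv (le_max_right _ _) dist_nonneg (by positivity)
    have e3 : |q θ.1 (y (t + 1)) - q θ'.1 (y (t + 1))| ≤ L * N * dist θ θ' := by
      refine (hy θ.1 hθ.1 θ'.1 hθ'.1).trans ?_
      have : dist θ.1 θ'.1 ≤ dist θ θ' := le_max_left _ _
      have h1 : L ≤ L * N := le_mul_of_one_le_right hL0 hN'
      exact mul_le_mul h1 this dist_nonneg (by positivity)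
    rw [e1]
    refine (abs_add_le _ _).trans ?_
    rw [abs_mul, abs_mul]
    have e4 := mul_le_mul e2 (hB θ.1 hθ.1 (y (t + 1))) (abs_nonneg _) (by positivity)
    have e5 := (mul_le_of_le_one_left (abs_nonneg (q θ.1 (y (t + 1)) - q θ'.1 (y (t + 1))))
      (abs_kern_le_one ((h N)⁻¹ • (θ'.2 - y t)))).trans e3
    rw [hΛ]
    linarith
  obtain ⟨κ, hκ, hlim⟩ := tendsto_measure_uniform_deviation hX_meas hX_law hX_indep
    ((hasPolyCover_of_isBounded hS).prod (hasPolyCover_of_isBounded hf.compact.isBounded)) hZm hΛ0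
    hZB (hh.eventually_pos.mono fun N hN => pow_pos hN p) hW hlip hh.tendsto_log_div
  set M' : ℝ := B * M * volume.real K' * ∫ v : E p, ‖v‖ ^ 2 * kern v with hM'
  have hM'0 : 0 ≤ M' := mul_nonneg (mul_nonneg (by positivity) measureReal_nonneg)
    (integral_nonneg fun v => mul_nonneg (by positivity) (kern_pos v).le)
  obtain ⟨A, hA0, hA⟩ := hh.eventually_error_le hκ hΛ0 hM'0
  refine ⟨A, hA0, tendsto_of_tendsto_of_tendsto_of_le_of_le' tendsto_const_nhds hlim
    (Eventually.of_forall fun _ => zero_le) ?_⟩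
  filter_upwards [hA, hh.eventually_pos] with N hAN hpos
  refine measure_mono fun ω hω hgood => hω fun x hx ξ hξ => ?_
  have hdev := hgood (x, ξ) ⟨hx, hξ⟩
  have hmean : ∫ y, Z N (x, ξ) y ∂μ = ∫ u, kern ((h N)⁻¹ • (ξ - u)) * partialInt f (q x) u :=
    hf.integral_mul_comp (measurable_pi_apply t) (measurable_pi_apply (t + 1)) hμ (hkm _ _)
      (hq x hx) (A := 1) (fun u => abs_kern_le_one _) (hB x hx)
  have hbias := abs_integral_kern_mul_sub_le hpos (r := partialInt f (q x))
    (hf.continuous_partialInt (hq x hx) (hB x hx)).measurable (R := B * R)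
    (fun u => (hf.abs_partialInt_le (hB x hx) u).trans (mul_le_mul_of_nonneg_left (hR u) hB0))
    (hf.diff_two_partialInt (hq x hx) (hB x hx)) ξ
  rw [← hmean] at hbias
  have hbias' := mul_le_mul_of_nonneg_left hbias (Nat.cast_nonneg (α := ℝ) N)
  rw [← abs_of_nonneg (Nat.cast_nonneg (α := ℝ) N), ← abs_mul,
    abs_of_nonneg (Nat.cast_nonneg (α := ℝ) N), mul_sub] at hbias'
  refine le_trans ?_ hAN
  refine (abs_sub_le _ (N * ∫ y, Z N (x, ξ) y ∂μ) _).trans ?_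
  exact add_le_add hdev hbias'

end Uniform

end DDMSLP

namespace DDMSLP

/-! ### Events whose probability tends to one -/

section HighProbability

variable {Ω : Type*} [MeasurableSpace Ω] {P : Measure Ω}

/-- The probability of the complement of `Q N` tends to zero. -/
def WHP (P : Measure Ω) (Q : ℕ → Ω → Prop) : Prop :=
  Tendsto (fun N => P {ω | ¬ Q N ω}) atTop (𝓝 0)

theorem WHP.mono {Q Q' : ℕ → Ω → Prop} (hQ : WHP P Q)
    (h : ∀ᶠ N in atTop, ∀ ω, Q N ω → Q' N ω) : WHP P Q' := by
  refine tendsto_of_tendsto_of_tendsto_of_le_of_le' tendsto_const_nhds hQ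
    (Eventually.of_forall fun _ => zero_le) ?_
  filter_upwards [h] with N hN
  exact measure_mono fun ω hω hq => hω (hN ω hq)

theorem WHP.and {Q Q' : ℕ → Ω → Prop} (hQ : WHP P Q) (hQ' : WHP P Q') :
    WHP P fun N ω => Q N ω ∧ Q' N ω := by
  have h0 := hQ.add hQ'
  rw [add_zero] at h0
  refine tendsto_of_tendsto_of_tendsto_of_le_of_le tendsto_const_nhds h0
    (fun _ => zero_le) fun N => ?_
  refine (measure_mono fun ω hω => ?_).trans (measure_union_le _ _)
  by_cases h : Q N ω
  · exact Or.inr fun h' => hω ⟨h, h'⟩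
  · exact Or.inl h

theorem WHP.of_ae {Q : Ω → Prop} (h : ∀ᵐ ω ∂P, Q ω) : WHP P fun _ ω => Q ω := by
  have h0 : P {ω | ¬ Q ω} = 0 := h
  simp only [WHP, h0]
  exact tendsto_const_nhds

theorem WHP.forall_finset {ι : Type*} (s : Finset ι) {Q : ι → ℕ → Ω → Prop}
    (h : ∀ i ∈ s, WHP P (Q i)) : WHP P fun N ω => ∀ i ∈ s, Q i N ω := by
  classical
  induction s using Finset.induction_on with
  | empty => simp [WHP]
  | insert a s _ ih =>
    refine ((h a (Finset.mem_insert_self a s)).and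
      (ih fun i hi => h i (Finset.mem_insert_of_mem hi))).mono ?_
    refine Eventually.of_forall fun N ω hω i hi => ?_
    rcases Finset.mem_insert.1 hi with rfl | hi
    · exact hω.1
    · exact hω.2 i hi

theorem WHP.eventually_le {Q : ℕ → Ω → Prop} (hQ : WHP P Q) {a : ENNReal} (ha : 0 < a) :
    ∀ᶠ N in atTop, P {ω | ¬ Q N ω} ≤ a :=
  hQ.eventually (ge_mem_nhds ha)

end HighProbability

section Stages

variable {p : ℕ} {prog : Program p} {T : ℕ} {Ξ : ℕ → Set (E p)} {μ : Measure (ℕ → E p)}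
  {f : ℕ → E p × E p → ℝ} {c C : ℝ} {h : ℕ → ℝ} {L : ℕ → ℝ}
  {Ω : Type*} [MeasurableSpace Ω] {P : Measure Ω} [IsProbabilityMeasure P] {X : ℕ → Ω → ℕ → E p}

/-! ### The error of the estimated conditional expectation of the true cost-to-go -/

/-- With numerator `G`, denominator `F` and their limits proportional to `r` and `m`, the difference
`r / m - G / F` equals `(r / m * (F - F̄) - (G - Ḡ)) / F`, where `F̄` and `Ḡ` are the limits. Since
`r / m` is bounded, only `1 / F` remains on the right, and neither `F` nor `m` has to be bounded
below. -/
theorem whp_trueEx_sub_nwEx [IsProbabilityMeasure μ] (hA : Assumptions prog T Ξ μ f)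
    (hX_meas : ∀ i, Measurable (X i))
    (hX_law : ∀ i, P.map (X i) = μ) (hX_indep : iIndepFun X P) (hh : IsBandwidth p c C h)
    (hL_pos : ∀ t ∈ Finset.Icc 2 T, 0 < L t) (hL : IsLipschitzBound prog T Ξ μ f L) {t : ℕ}
    (h2 : 2 ≤ t) (ht : t < T) :
    ∃ A : ℝ, 0 ≤ A ∧ WHP P fun N ω => ∀ x ∈ prog.reach Ξ t, ∀ ξ ∈ Ξ t,
      |trueEx μ f t ξ (fun ξ' => prog.costToGo (trueEx μ f) (T - t) t x ξ')
          - nwEx (fun i => X i ω) N (h N) t ξ (cost prog T Ξ μ f t x)|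
        ≤ A * (N * h N ^ p * (rate p N ^ 2 * √(Real.log N)))
          * (∑ j ∈ Finset.range N, kern ((h N)⁻¹ • (ξ - X j ω t)))⁻¹ := by
  obtain ⟨M, hM, hf⟩ := hA.regularDensity h2 ht
  obtain ⟨⟨B, hB⟩, hm⟩ := cost_bounded_measurable hA hL_pos hL (T - t) t (by omega) (by omega)
  have hS := (isCompact_reach hA t ht.le).isBounded
  have hL0 := (hL_pos (t + 1) (Finset.mem_Icc.2 ⟨by omega, by omega⟩)).le
  obtain ⟨A₁, hA₁, hw₁⟩ := tendsto_measure_kernelSum hX_meas hX_law hX_indep hh hM hf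
    (hA.density t h2 ht) hS hm (abs_nonneg B) hL0
    (fun x hx u => (hB x hx u).trans (le_abs_self B)) (cost_lipschitz hL (by omega) ht hL0)
  -- The denominator is the case of the constant function one.
  obtain ⟨A₂, hA₂, hw₂⟩ := tendsto_measure_kernelSum hX_meas hX_law hX_indep hh hM hf
    (hA.density t h2 ht) hS (q := fun _ _ => 1) (fun _ _ => measurable_const) zero_le_one le_rfl
    (fun x _ u => by simp) (by simp)
  refine ⟨A₁ + |B| * A₂, by positivity, (WHP.and hw₁ hw₂).mono ?_⟩
  filter_upwards [eventually_ge_atTop 1] with N hN ω ⟨hq, h1⟩ x hx ξ hξ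
  have e1 := hq x hx ξ hξ
  have e2 := h1 x hx ξ hξ
  simp only [mul_one] at e2
  set F : ℝ := ∑ j ∈ Finset.range N, kern ((h N)⁻¹ • (ξ - X j ω t)) with hF
  have hFpos : 0 < F := Finset.sum_pos (fun j _ => kern_pos _) ⟨0, Finset.mem_range.2 (by omega)⟩
  set m : ℝ := partialInt (f t) (fun _ => 1) ξ with hm_def
  set r : ℝ := partialInt (f t) (cost prog T Ξ μ f t x) ξ with hr_def
  set κ : ℝ := ∫ v : E p, kern v
  set G : ℝ := ∑ j ∈ Finset.range N,
    kern ((h N)⁻¹ • (ξ - X j ω t)) * cost prog T Ξ μ f t x (X j ω (t + 1)) with hG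
  have hm0 : 0 ≤ m := hf.partialInt_nonneg (fun _ => zero_le_one) ξ
  have hrm : |r| ≤ B * m := hf.abs_partialInt_le (hB x hx) ξ
  have hnw : nwEx (fun i => X i ω) N (h N) t ξ (cost prog T Ξ μ f t x) = G / F := by
    rw [nwEx, hG, Finset.sum_div]
    exact Finset.sum_congr rfl fun j _ => by rw [nwWeight, div_mul_eq_mul_div]
  rw [trueEx_cost hA h2 ht, hnw, ← hm_def, ← hr_def]
  -- This survives `m = 0`, because `|r| ≤ B * m` then forces `r = 0`.
  have hVm : r / m * m = r := by
    rcases hm0.eq_or_lt with h0 | hpos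
    · rw [← h0, mul_zero] at hrm
      rw [← h0, mul_zero, abs_nonpos_iff.1 hrm]
    · exact div_mul_cancel₀ _ hpos.ne'
  have hV : |r / m| ≤ |B| := by
    rw [abs_div, abs_of_nonneg hm0]
    exact div_le_of_le_mul₀ hm0 (abs_nonneg B)
      (hrm.trans (mul_le_mul_of_nonneg_right (le_abs_self B) hm0))
  have e3 : r / m - G / F = (r / m * (F - N * (h N ^ p * (κ * m)))
      - (G - N * (h N ^ p * (κ * r)))) * F⁻¹ := by
    have : r / m * (F - N * (h N ^ p * (κ * m))) = r / m * F - N * (h N ^ p * (κ * r)) := by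
      calc _ = r / m * F - N * (h N ^ p * (κ * (r / m * m))) := by ring
        _ = _ := by rw [hVm]
    rw [this, sub_sub_sub_cancel_right, sub_mul, mul_assoc, mul_inv_cancel₀ hFpos.ne', mul_one,
      div_eq_mul_inv G]
  rw [e3, abs_mul, abs_of_pos (inv_pos.2 hFpos)]
  refine mul_le_mul_of_nonneg_right ((abs_sub _ _).trans ?_) (inv_pos.2 hFpos).le
  rw [abs_mul]
  have e4 := mul_le_mul hV e2 (abs_nonneg _) (abs_nonneg B)
  linarith

/-- The uniform deviation bound with `v = 1`. At stage one the conditional law ignores `ξ`, so there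
is neither smoothing nor bias, and the constant `2 L₂` is absorbed because `√(N log N) ≥ 1`. -/
theorem whp_trueEx_sub_average [IsProbabilityMeasure μ] (hA : Assumptions prog T Ξ μ f)
    (hX_meas : ∀ i, Measurable (X i))
    (hX_law : ∀ i, P.map (X i) = μ) (hX_indep : iIndepFun X P)
    (hL_pos : ∀ t ∈ Finset.Icc 2 T, 0 < L t) (hL : IsLipschitzBound prog T Ξ μ f L)
    (hT : 2 ≤ T) :
    ∃ A : ℝ, 0 ≤ A ∧ WHP P fun N ω => ∀ x ∈ prog.reach Ξ 1, ∀ ξ,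
      |trueEx μ f 1 ξ (fun ξ' => prog.costToGo (trueEx μ f) (T - 1) 1 x ξ')
          - (∑ j ∈ Finset.range N, cost prog T Ξ μ f 1 x (X j ω 2)) / N|
        ≤ A * √(Real.log N / N) := by
  obtain ⟨⟨B, hB⟩, hm⟩ := cost_bounded_measurable hA hL_pos hL (T - 1) 1 le_rfl (by omega)
  have hS := (isCompact_reach hA 1 (by omega)).isBounded
  have hL0 := (hL_pos 2 (Finset.mem_Icc.2 ⟨le_rfl, hT⟩)).le
  have hlip := cost_lipschitz hL le_rfl (by omega) hL0
  have hZm : ∀ x ∈ prog.reach Ξ 1, Measurable fun y : ℕ → E p => cost prog T Ξ μ f 1 x (y 2) :=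
    fun x hx => (hm x hx).comp (measurable_pi_apply 2)
  have hgrowth : Tendsto (fun N : ℕ => Real.log N / (N * (1 : ℝ))) atTop (𝓝 0) := by
    simp only [mul_one]
    have := (isLittleO_log_rpow_atTop one_pos).tendsto_div_nhds_zero
    simp only [Real.rpow_one] at this
    exact this.comp tendsto_natCast_atTop_atTop
  obtain ⟨κ, hκ, hw⟩ := tendsto_measure_uniform_deviation hX_meas hX_law hX_indep
    (hasPolyCover_of_isBounded hS) (Z := fun _ x y => cost prog T Ξ μ f 1 x (y 2))
    (fun _ => hZm) (W := B ^ 2) hL0 (fun _ x hx y => hB x hx _) (v := fun _ => 1)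
    (Eventually.of_forall fun _ => one_pos) (Eventually.of_forall fun _ x hx => by
      have hsq : ∀ y : ℕ → E p, cost prog T Ξ μ f 1 x (y 2) ^ 2 ≤ B ^ 2 := fun y => by
        rw [← sq_abs]
        exact pow_le_pow_left₀ (abs_nonneg _) (hB x hx _) 2
      calc ∫ y, cost prog T Ξ μ f 1 x (y 2) ^ 2 ∂μ ≤ ∫ _y, B ^ 2 ∂μ :=
            integral_mono (integrable_of_abs_le (B := B ^ 2) ((hZm x hx).pow_const 2) fun y => by
              rw [abs_of_nonneg (sq_nonneg _)]
              exact hsq y) (integrable_const _) hsq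
        _ = B ^ 2 * 1 := by simp)
    (by
      filter_upwards [eventually_ge_atTop 1] with N hN
      filter_upwards [hlip] with y hy x hx x' hx'
      refine (hy x hx x' hx').trans (mul_le_mul_of_nonneg_right ?_ dist_nonneg)
      exact le_mul_of_one_le_right hL0 (by exact_mod_cast hN)) hgrowth
  refine ⟨κ + 2 * L 2, by positivity, WHP.mono hw ?_⟩
  filter_upwards [eventually_ge_atTop 1, eventually_one_le_log] with N hN hlog ω hω x hx ξ
  have hN' : (1 : ℝ) ≤ N := by exact_mod_cast hN
  have hN0 : (0 : ℝ) < N := by linarith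
  have hXm : MeasurableSet (Ξ 2) := (hA.compact 2 ⟨by omega, hT⟩).isClosed.measurableSet
  have hV : trueEx μ f 1 ξ (fun ξ' => prog.costToGo (trueEx μ f) (T - 1) 1 x ξ')
      = ∫ y, cost prog T Ξ μ f 1 x (y 2) ∂μ := by
    rw [trueEx, condLaw, if_pos le_rfl, ← integral_map (φ := fun y : ℕ → E p => y 2)
      (measurable_pi_apply 2).aemeasurable (hm x hx).aestronglyMeasurable]
    refine integral_congr_ae ?_
    have h3 : ∀ᵐ ξ' ∂(μ.map fun y => y 2), ξ' ∈ Ξ 2 :=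
      (mem_ae_map_iff (measurable_pi_apply 2).aemeasurable hXm).2 (hA.supported 2 ⟨by omega, hT⟩)
    exact h3.mono fun ξ' hξ' => (cost_of_mem hξ').symm
  have hdev := hω x hx
  rw [mul_one] at hdev
  rw [hV, abs_sub_comm, div_sub' hN0.ne', abs_div, abs_of_pos hN0, div_le_iff₀ hN0]
  refine hdev.trans ?_
  have hsqrt : √(Real.log N / N) * N = √(N * Real.log N) := by
    rw [Real.sqrt_div (by linarith), div_mul_eq_mul_div, mul_div_assoc, Real.div_sqrt, mul_comm,
      Real.sqrt_mul hN0.le]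
  have h1 : 1 ≤ √(N * Real.log N) := Real.one_le_sqrt.2 (by nlinarith)
  rw [mul_assoc, hsqrt]
  nlinarith

/-! ### Propagation of the errors through the Bellman recursion -/

theorem abs_sInf_image_sub_le {β : Type*} {Φ : Set β} (hne : Φ.Nonempty) {g g' : β → ℝ} {e : ℝ}
    (he : 0 ≤ e) (hg : ∀ y ∈ Φ, |g y - g' y| ≤ e) : |sInf (g '' Φ) - sInf (g' '' Φ)| ≤ e := by
  have hbdd : ∀ {g g' : β → ℝ}, (∀ y ∈ Φ, |g y - g' y| ≤ e) → BddBelow (g '' Φ) →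
      BddBelow (g' '' Φ) ∧ sInf (g '' Φ) - e ≤ sInf (g' '' Φ) := by
    intro g g' hg hb
    have h1 : ∀ z ∈ g' '' Φ, sInf (g '' Φ) - e ≤ z := by
      rintro _ ⟨y, hy, rfl⟩
      have := (abs_le.1 (hg y hy)).2
      have := csInf_le hb ⟨y, hy, rfl⟩
      linarith
    exact ⟨⟨_, h1⟩, le_csInf (hne.image g') h1⟩
  have hg' : ∀ y ∈ Φ, |g' y - g y| ≤ e := fun y hy => by
    rw [abs_sub_comm]
    exact hg y hy
  by_cases hb : BddBelow (g '' Φ)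
  · obtain ⟨hb', h1⟩ := hbdd hg hb
    obtain ⟨-, h2⟩ := hbdd hg' hb'
    exact abs_le.2 ⟨by linarith, by linarith⟩
  -- Uniformly close functions are bounded below together. If they are not, both infima have the
  -- default value zero, so no boundedness of the estimated objective is needed.
  · have hb' : ¬ BddBelow (g' '' Φ) := fun hb' => hb (hbdd hg' hb').1
    rw [Real.sInf_of_not_bddBelow hb, Real.sInf_of_not_bddBelow hb', sub_zero, abs_zero]
    exact he

theorem abs_nwEx_sub_le (data : ℕ → ℕ → E p) (N : ℕ) (b : ℝ) (t : ℕ) (ξ : E p) {φ φ' : E p → ℝ}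
    {e : ℕ → ℝ} (he : ∀ j < N, |φ (data j (t + 1)) - φ' (data j (t + 1))| ≤ e j) :
    |nwEx data N b t ξ φ - nwEx data N b t ξ φ'|
      ≤ ∑ j ∈ Finset.range N, nwWeight data N b t ξ j * e j := by
  rw [nwEx, nwEx, ← Finset.sum_sub_distrib]
  refine (Finset.abs_sum_le_sum_abs _ _).trans (Finset.sum_le_sum fun j hj => ?_)
  have hw : 0 ≤ nwWeight data N b t ξ j :=
    div_nonneg (kern_pos _).le (Finset.sum_nonneg fun k _ => (kern_pos _).le)
  rw [← mul_sub, abs_mul, abs_of_nonneg hw]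
  exact mul_le_mul_of_nonneg_left (he j (Finset.mem_range.1 hj)) hw

theorem exists_norm_le_of_mem (hA : Assumptions prog T Ξ μ f) :
    ∃ R : ℝ, ∀ t ∈ Set.Icc 1 T, ∀ ξ ∈ Ξ t, ‖ξ‖ ≤ R := by
  obtain ⟨R, hR⟩ := ((Set.finite_Icc 1 T).isCompact_biUnion
    fun t ht => hA.compact t ht).isBounded.exists_norm_le
  exact ⟨R, fun t ht ξ hξ => hR ξ (Set.mem_biUnion ht hξ)⟩

/-- The sum over the data points of the errors of the cost-to-go with `k` stages left. -/
theorem exists_sum_error_le (hA : Assumptions prog T Ξ μ f) (k : ℕ) :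
    ∃ G : ℝ, 0 ≤ G ∧ ∀ t, 1 ≤ t → t + k = T → ∀ (data : ℕ → ℕ → E p) (N : ℕ) (b ε : ℝ),
      0 < b → b ≤ 1 → 0 ≤ ε → (∀ i < N, ∀ s ∈ Set.Icc 1 T, data i s ∈ Ξ s) →
      (∀ s, 2 ≤ s → s < T → ∀ x ∈ prog.reach Ξ s, ∀ ξ ∈ Ξ s,
        |trueEx μ f s ξ (fun ξ' => prog.costToGo (trueEx μ f) (T - s) s x ξ')
          - nwEx data N b s ξ (cost prog T Ξ μ f s x)|
        ≤ ε * (∑ j ∈ Finset.range N, kern (b⁻¹ • (ξ - data j s)))⁻¹) →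
      ∃ e : ℕ → ℝ, (∀ i, 0 ≤ e i) ∧ (∀ i < N, ∀ x ∈ prog.reach Ξ t,
        |prog.costToGo (trueEx μ f) k t x (data i (t + 1))
          - prog.costToGo (nwEx data N b) k t x (data i (t + 1))| ≤ e i) ∧
        ∑ i ∈ Finset.range N, e i ≤ G * (ε / b ^ p) := by
  induction k with
  | zero =>
    refine ⟨0, le_rfl, fun t _ _ data N b ε _ _ _ _ _ => ⟨fun _ => 0, fun _ => le_rfl, ?_, by simp⟩⟩
    intro i _ x _
    simp [Program.costToGo]
  | succ k ih =>
    obtain ⟨G, hG, ih⟩ := ih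
    obtain ⟨R, hR⟩ := exists_norm_le_of_mem hA
    obtain ⟨C₁, hC₁, hinv⟩ := sum_inv_kernelSum_le (p := p) (R := R)
    obtain ⟨C₂, hC₂, hwt⟩ := sum_weight_le p
    -- `C₁` accounts for the estimation error made at this stage and `C₂ * G` for the errors of
    -- later stages, passed on through the weights.
    refine ⟨C₁ + C₂ * G, by positivity, fun t ht1 htT data N b ε hb hb1 hε hdata hest => ?_⟩
    obtain ⟨e, he0, he, hsum⟩ := ih (t + 1) (by omega) (by omega) data N b ε hb hb1 hε hdata hest
    set e' : ℕ → ℝ := fun i =>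
      ε * (∑ j ∈ Finset.range N, kern (b⁻¹ • (data i (t + 1) - data j (t + 1))))⁻¹
        + ∑ j ∈ Finset.range N, nwWeight data N b (t + 1) (data i (t + 1)) j * e j with he'
    have hF0 : ∀ i, 0 ≤ ∑ j ∈ Finset.range N, kern (b⁻¹ • (data i (t + 1) - data j (t + 1))) :=
      fun i => Finset.sum_nonneg fun k _ => (kern_pos _).le
    have hw0 : ∀ i j, 0 ≤ nwWeight data N b (t + 1) (data i (t + 1)) j := fun i j =>
      div_nonneg (kern_pos _).le (hF0 i)
    have he'0 : ∀ i, 0 ≤ e' i := fun i => add_nonneg (mul_nonneg hε (inv_nonneg.2 (hF0 i)))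
      (Finset.sum_nonneg fun j _ => mul_nonneg (hw0 i j) (he0 j))
    refine ⟨e', he'0, fun i hi x hx => ?_, ?_⟩
    · have hξ : data i (t + 1) ∈ Ξ (t + 1) := hdata i hi (t + 1) ⟨by omega, by omega⟩
      refine abs_sInf_image_sub_le (hA.recourse t (by omega) x hx _ hξ).1 (he'0 i) fun y hy => ?_
      have hy' := feasible_subset_reach hx hξ hy
      rw [add_sub_add_left_eq_sub]
      -- At the last stage both expectations are of the zero function; the estimate `hest` covers
      -- only stages before `T`.
      rcases Nat.eq_zero_or_pos k with rfl | hk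
      · simpa [Program.costToGo, trueEx, nwEx] using he'0 i
      · have h1 := hest (t + 1) (by omega) (by omega) y hy' _ hξ
        rw [show T - (t + 1) = k by omega] at h1
        have h2 := abs_nwEx_sub_le data N b (t + 1) (data i (t + 1))
          (φ := cost prog T Ξ μ f (t + 1) y)
          (φ' := fun ξ' => prog.costToGo (nwEx data N b) k (t + 1) y ξ') (e := e) fun j hj => by
            rw [cost_of_mem (hdata j hj (t + 1 + 1) ⟨by omega, by omega⟩),
              show T - (t + 1) = k by omega]
            exact he j hj y hy'
        exact (abs_sub_le _ _ _).trans (add_le_add h1 h2)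
    · have h1 := hinv b (fun i => data i (t + 1)) N hb hb1 fun i hi =>
        hR (t + 1) ⟨by omega, by omega⟩ _ (hdata i hi (t + 1) ⟨by omega, by omega⟩)
      have h2 : ∑ i ∈ Finset.range N, ∑ j ∈ Finset.range N,
          nwWeight data N b (t + 1) (data i (t + 1)) j * e j
          ≤ C₂ * ∑ j ∈ Finset.range N, e j := by
        -- Exchanging the sums turns the total propagated error into column sums of the weight
        -- matrix.
        rw [Finset.sum_comm, Finset.mul_sum]
        refine Finset.sum_le_sum fun j _ => ?_
        rw [← Finset.sum_mul]
        exact mul_le_mul_of_nonneg_right (hwt b (fun i => data i (t + 1)) N j hb) (he0 j)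
      calc ∑ i ∈ Finset.range N, e' i
          = ε * ∑ i ∈ Finset.range N,
            (∑ j ∈ Finset.range N, kern (b⁻¹ • (data i (t + 1) - data j (t + 1))))⁻¹
            + ∑ i ∈ Finset.range N, ∑ j ∈ Finset.range N,
              nwWeight data N b (t + 1) (data i (t + 1)) j * e j := by
            rw [he', Finset.sum_add_distrib, Finset.mul_sum]
        _ ≤ ε * (C₁ / b ^ p) + C₂ * (G * (ε / b ^ p)) :=
            add_le_add (mul_le_mul_of_nonneg_left h1 hε)
              (h2.trans (mul_le_mul_of_nonneg_left hsum hC₂))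
        _ = _ := by ring

theorem nwWeight_first {data : ℕ → ℕ → E p} {N : ℕ} {b : ℝ} {ξ : E p}
    (hdata : ∀ i < N, data i 1 = ξ) {i : ℕ} (hi : i < N) :
    nwWeight data N b 1 ξ i = 1 / N := by
  have h1 : ∀ j < N, kern (b⁻¹ • (ξ - data j 1)) = 1 := fun j hj => by
    rw [hdata j hj]
    simp [kern]
  rw [nwWeight, h1 i hi, Finset.sum_congr rfl fun j hj => h1 j (Finset.mem_range.1 hj)]
  simp

/-- All trajectories share the first-stage parameter, so every first-stage weight is `1 / N`. The
later errors enter only through their mean over the data, which is the quantity controlled by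
`exists_sum_error_le`. -/
theorem exists_outOfSampleError_le (hA : Assumptions prog T Ξ μ f) (hT : 2 ≤ T) :
    ∃ G : ℝ, 0 ≤ G ∧ ∀ (data : ℕ → ℕ → E p) (N : ℕ) (b ε a : ℝ),
      0 < b → b ≤ 1 → 0 ≤ ε → 0 ≤ a → (∀ i < N, ∀ s ∈ Set.Icc 1 T, data i s ∈ Ξ s) →
      (∀ s, 2 ≤ s → s < T → ∀ x ∈ prog.reach Ξ s, ∀ ξ ∈ Ξ s,
        |trueEx μ f s ξ (fun ξ' => prog.costToGo (trueEx μ f) (T - s) s x ξ')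
          - nwEx data N b s ξ (cost prog T Ξ μ f s x)|
        ≤ ε * (∑ j ∈ Finset.range N, kern (b⁻¹ • (ξ - data j s)))⁻¹) →
      (∀ x ∈ prog.reach Ξ 1, ∀ ξ,
        |trueEx μ f 1 ξ (fun ξ' => prog.costToGo (trueEx μ f) (T - 1) 1 x ξ')
          - (∑ j ∈ Finset.range N, cost prog T Ξ μ f 1 x (data j 2)) / N| ≤ a) →
      outOfSampleError prog T μ f data N b ≤ a + G * (ε / (N * b ^ p)) := by
  obtain ⟨G, hG, key⟩ := exists_sum_error_le hA (T - 1)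
  refine ⟨G, hG, fun data N b ε a hb hb1 hε ha hdata hest hfirst => ?_⟩
  obtain ⟨e, he0, he, hsum⟩ := key 1 le_rfl (by omega) data N b ε hb hb1 hε hdata hest
  have hξ₁ : prog.ξ₁ ∈ Ξ 1 := by
    rw [hA.first]
    exact rfl
  have hdata1 : ∀ i < N, data i 1 = prog.ξ₁ := fun i hi => by
    have := hdata i hi 1 ⟨le_rfl, by omega⟩
    rw [hA.first] at this
    exact this
  have hnw1 : ∀ φ : E p → ℝ, nwEx data N b 1 prog.ξ₁ φ
      = (∑ j ∈ Finset.range N, φ (data j 2)) / N := fun φ => by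
    rw [nwEx, Finset.sum_div]
    refine Finset.sum_congr rfl fun j hj => ?_
    rw [nwWeight_first hdata1 (Finset.mem_range.1 hj)]
    ring
  have hsum' : (∑ j ∈ Finset.range N, e j) / N ≤ G * (ε / (N * b ^ p)) := by
    calc (∑ j ∈ Finset.range N, e j) / N ≤ G * (ε / b ^ p) / N := by gcongr
      _ = _ := by ring
  have htot : 0 ≤ a + G * (ε / (N * b ^ p)) := by positivity
  rw [outOfSampleError, Program.optVal, Program.optVal, show T = (T - 1) + 1 by omega]
  refine abs_sInf_image_sub_le (hA.recourse 0 (by omega) _ rfl _ hξ₁).1 htot fun y hy => ?_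
  have hy' : y ∈ prog.reach Ξ 1 := feasible_subset_reach (t := 0) rfl hξ₁ hy
  rw [add_sub_add_left_eq_sub]
  have h1 := hfirst y hy' prog.ξ₁
  rw [← hnw1] at h1
  have h2 := abs_nwEx_sub_le data N b 1 prog.ξ₁ (φ := cost prog T Ξ μ f 1 y)
    (φ' := fun ξ' => prog.costToGo (nwEx data N b) (T - 1) 1 y ξ') (e := e) fun j hj => by
      rw [cost_of_mem (hdata j hj 2 ⟨by omega, hT⟩)]
      exact he j hj y hy'
  have h3 : ∑ j ∈ Finset.range N, nwWeight data N b 1 prog.ξ₁ j * e j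
      = (∑ j ∈ Finset.range N, e j) / N := by
    rw [Finset.sum_div]
    refine Finset.sum_congr rfl fun j hj => ?_
    rw [nwWeight_first hdata1 (Finset.mem_range.1 hj)]
    ring
  exact (abs_sub_le _ _ _).trans (add_le_add h1 (h2.trans (h3.le.trans hsum')))

/-- The out-of-sample error is of the order `√(log N / N)`, plus `rate ^ 2 * √(log N)` if there are
at least three stages. -/
theorem exists_whp_outOfSampleError_le [IsProbabilityMeasure μ] (hA : Assumptions prog T Ξ μ f)
    (hX_meas : ∀ i, Measurable (X i)) (hX_law : ∀ i, P.map (X i) = μ) (hX_indep : iIndepFun X P)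
    (hh : IsBandwidth p c C h) (hL_pos : ∀ t ∈ Finset.Icc 2 T, 0 < L t)
    (hL : IsLipschitzBound prog T Ξ μ f L) (hT : 2 ≤ T) :
    ∃ a A : ℝ, 0 ≤ a ∧ 0 ≤ A ∧ (T = 2 → A = 0) ∧ WHP P fun N ω =>
      outOfSampleError prog T μ f (fun i => X i ω) N (h N)
        ≤ a * √(Real.log N / N) + A * (rate p N ^ 2 * √(Real.log N)) := by
  obtain ⟨G, hG, hdet⟩ := exists_outOfSampleError_le hA hT
  obtain ⟨a, ha, hw₁⟩ := whp_trueEx_sub_average hA hX_meas hX_law hX_indep hL_pos hL hT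
  have hex : ∀ t, ∃ A : ℝ, 0 ≤ A ∧ (t ∈ Finset.Ico 2 T → WHP P fun N ω =>
      ∀ x ∈ prog.reach Ξ t, ∀ ξ ∈ Ξ t,
      |trueEx μ f t ξ (fun ξ' => prog.costToGo (trueEx μ f) (T - t) t x ξ')
          - nwEx (fun i => X i ω) N (h N) t ξ (cost prog T Ξ μ f t x)|
        ≤ A * (N * h N ^ p * (rate p N ^ 2 * √(Real.log N)))
          * (∑ j ∈ Finset.range N, kern ((h N)⁻¹ • (ξ - X j ω t)))⁻¹) := fun t => by
    by_cases ht : t ∈ Finset.Ico 2 T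
    · obtain ⟨A, hA0, hw⟩ := whp_trueEx_sub_nwEx hA hX_meas hX_law hX_indep hh hL_pos hL
        (Finset.mem_Ico.1 ht).1 (Finset.mem_Ico.1 ht).2
      exact ⟨A, hA0, fun _ => hw⟩
    · exact ⟨0, le_rfl, fun h => absurd h ht⟩
  choose A hA0 hw using hex
  have hsupp : ∀ᵐ ω ∂P, ∀ i, ∀ s ∈ Set.Icc 1 T, X i ω s ∈ Ξ s := by
    refine ae_all_iff.2 fun i => (ae_ball_iff (Set.to_countable _)).2 fun s hs => ?_
    refine ae_of_ae_map (p := fun y : ℕ → E p => y s ∈ Ξ s) (hX_meas i).aemeasurable ?_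
    rw [hX_law i]
    exact hA.supported s hs
  -- For `T = 2` no stage uses genuine kernel smoothing: the index set is empty and the second
  -- coefficient is zero.
  refine ⟨a, G * ∑ t ∈ Finset.Ico 2 T, A t, ha,
    mul_nonneg hG (Finset.sum_nonneg fun t _ => hA0 t), fun h2 => by simp [h2], ?_⟩
  refine ((hw₁.and (WHP.forall_finset (Finset.Ico 2 T) fun t ht => hw t ht)).and
    (WHP.of_ae hsupp)).mono ?_
  filter_upwards [hh.eventually_pos, hh.eventually_le_one, eventually_ge_atTop 1]
    with N hpos hle hN ω ⟨⟨h1, h2⟩, h3⟩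
  have hN' : (0 : ℝ) < N := by exact_mod_cast hN
  set r : ℝ := rate p N ^ 2 * √(Real.log N) with hr
  have hr0 : 0 ≤ r := by positivity
  have hAsum : 0 ≤ ∑ t ∈ Finset.Ico 2 T, A t := Finset.sum_nonneg fun t _ => hA0 t
  -- The factor `N h ^ p` in this choice of `ε` cancels the denominator of the deterministic bound.
  have key := hdet (fun i => X i ω) N (h N) ((∑ t ∈ Finset.Ico 2 T, A t) * (N * h N ^ p * r))
    (a * √(Real.log N / N)) hpos hle (by positivity) (by positivity) (fun i _ => h3 i)
    (fun s hs2 hsT x hx ξ hξ => by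
      have hs := Finset.mem_Ico.2 ⟨hs2, hsT⟩
      refine (h2 s hs x hx ξ hξ).trans ?_
      refine mul_le_mul_of_nonneg_right (mul_le_mul_of_nonneg_right
        (Finset.single_le_sum (fun t _ => hA0 t) hs) (by positivity)) ?_
      exact inv_nonneg.2 (Finset.sum_nonneg fun j _ => (kern_pos _).le)) h1
  refine key.trans (le_of_eq ?_)
  have : (N : ℝ) * h N ^ p ≠ 0 := by positivity
  rw [mul_div_assoc, mul_div_cancel_left₀ _ this]
  ring

end Stages

end DDMSLP

namespace DDMSLP

/-! ### Comparison of the three forms of the bound -/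

section Bounds

theorem le_maxOver {s : Finset ℕ} (u : ℕ → ℝ) {t : ℕ} (ht : t ∈ s) : u t ≤ maxOver s u :=
  le_ciSup (f := fun t : s => u t) (Set.finite_range _).bddAbove ⟨t, ht⟩

theorem minOver_le {s : Finset ℕ} (u : ℕ → ℝ) {t : ℕ} (ht : t ∈ s) : minOver s u ≤ u t :=
  ciInf_le (f := fun t : s => u t) (Set.finite_range _).bddBelow ⟨t, ht⟩

theorem minOver_pos {s : Finset ℕ} (hs : s.Nonempty) {u : ℕ → ℝ} (hu : ∀ t ∈ s, 0 < u t) :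
    0 < minOver s u := by
  have : Nonempty s := hs.to_subtype
  obtain ⟨t, ht⟩ := exists_eq_ciInf_of_finite (f := fun t : s => u t)
  rw [minOver, ← ht]
  exact hu t t.2

variable {p T N : ℕ} {d : ℕ → ℕ} {σ L D δ g : ℕ → ℝ} {c η C ε b : ℝ}

theorem dMax_pos (hT : 2 ≤ T) (hD : ∀ t ∈ Finset.Icc 1 T, 0 < D t) (hη : 0 < η) :
    0 < dMax T d D η := by
  have h1 : 1 ∈ Finset.Icc 1 T := Finset.mem_Icc.2 ⟨le_rfl, by omega⟩
  exact (pow_pos (div_pos (hD 1 h1) hη) (d 1)).trans_le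
    (le_maxOver (fun t => (D t / η) ^ d t) h1)

theorem prod_le_dMax_pow (hD : ∀ t ∈ Finset.Icc 1 T, 0 < D t) (hη : 0 < η) {t : ℕ} (ht : t ≤ T) :
    ∏ s ∈ Finset.Icc 1 (t - 1), (D s / η) ^ d s ≤ dMax T d D η ^ (t - 1) := by
  have hmem : ∀ s ∈ Finset.Icc 1 (t - 1), s ∈ Finset.Icc 1 T := fun s hs => by
    rw [Finset.mem_Icc] at hs ⊢
    omega
  calc ∏ s ∈ Finset.Icc 1 (t - 1), (D s / η) ^ d s
      ≤ ∏ _s ∈ Finset.Icc 1 (t - 1), dMax T d D η :=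
        Finset.prod_le_prod (fun s hs => (pow_pos (div_pos (hD s (hmem s hs)) hη) _).le)
          fun s hs => le_maxOver (fun t => (D t / η) ^ d t) (hmem s hs)
    _ = dMax T d D η ^ (t - 1) := by simp

theorem sqrt_nonpos_log_div_eq_zero {s x m : ℝ} (hx0 : 0 ≤ x) (hx : x ≤ 1) (hm : 0 ≤ m) :
    √(s ^ 2 * (Real.log x / m)) = 0 :=
  Real.sqrt_eq_zero_of_nonpos (mul_nonpos_of_nonneg_of_nonpos (sq_nonneg s)
    (div_nonpos_of_nonpos_of_nonneg (Real.log_nonpos hx0 hx) hm))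

/-- The summands are compared one by one. The delicate point is that `η` is arbitrary: for large `η`
the number `N * dMax` can be below one, and then `N ^ (t - 2) * dMax ^ (t - 1)` is not increasing in
`t`. In that regime the logarithm is nonpositive and the root is read as zero. -/
theorem errorTerm_le_asymptoticBound (hT : 2 ≤ T) (hN : 1 ≤ N) (hC : 1 ≤ C)
    (hσ : ∀ t ∈ Finset.Icc 2 T, 0 < σ t) (hL : ∀ t ∈ Finset.Icc 2 T, 0 < L t)
    (hD : ∀ t ∈ Finset.Icc 1 T, 0 < D t) (hδ : ∀ t ∈ Finset.Icc 2 T, 0 < δ t)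
    (hg : ∀ t ∈ Finset.Icc 1 (T - 1), 0 < g t) (hη : 0 < η) (hε : 0 < 1 + ε) (hc : 0 < c)
    (hb : 0 < b) (hNb : c ^ p ≤ N * b ^ p * rate p N ^ 4)
    (hNδ : C / minOver (Finset.Icc 2 T) δ ≤ N) :
    errorTerm p T d σ L D δ g η C ε N b ≤ asymptoticBound p T d σ L D δ g c η C ε N := by
  have hN' : (1 : ℝ) ≤ N := by exact_mod_cast hN
  have hN0 : (0 : ℝ) < N := by linarith
  have hcp := pow_pos hc p
  have hr := rate_pos p hN
  set S : ℝ := maxOver (Finset.Icc 2 T) (fun t => σ t ^ 2) with hS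
  set Lm : ℝ := maxOver (Finset.Icc 2 T) L with hLm
  set gm : ℝ := minOver (Finset.Icc 1 (T - 1)) g with hgm_def
  set dm : ℝ := dMax T d D η with hdm_def
  set δm : ℝ := minOver (Finset.Icc 2 T) δ with hδm_def
  have h2T : 2 ∈ Finset.Icc 2 T := Finset.mem_Icc.2 ⟨le_rfl, hT⟩
  have hS0 : 0 < S := (pow_pos (hσ 2 h2T) 2).trans_le (le_maxOver (fun t => σ t ^ 2) h2T)
  have hLm0 : 0 < Lm := (hL 2 h2T).trans_le (le_maxOver L h2T)
  have hgm : 0 < gm := minOver_pos ⟨1, Finset.mem_Icc.2 ⟨le_rfl, by omega⟩⟩ hg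
  have hdm : 0 < dm := dMax_pos hT hD hη
  have hδm : 0 < δm := minOver_pos ⟨2, h2T⟩ hδ
  have hC0 : 0 < C := by linarith
  set Y : ℝ := S / (c ^ p * gm * (1 + ε)) *
    Real.log (C * (N : ℝ) ^ (T - 2) * dm ^ (T - 1) / δm) with hY
  have hterm : ∀ t ∈ Finset.Icc 2 T, √(σ t ^ 2 *
        (Real.log (C * (N : ℝ) ^ (t - 2) * (∏ s ∈ Finset.Icc 1 (t - 1), (D s / η) ^ d s) / δ t)
          / (N * b ^ p * (g (t - 1) * (1 + ε))))) ≤ rate p N ^ 2 * √Y := by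
    intro t ht
    obtain ⟨ht2, htT⟩ := Finset.mem_Icc.1 ht
    have hgt : t - 1 ∈ Finset.Icc 1 (T - 1) := Finset.mem_Icc.2 ⟨by omega, by omega⟩
    have hgpos := hg _ hgt
    have hprod0 : 0 < ∏ s ∈ Finset.Icc 1 (t - 1), (D s / η) ^ d s :=
      Finset.prod_pos fun s hs => pow_pos (div_pos (hD s (Finset.mem_Icc.2
        ⟨(Finset.mem_Icc.1 hs).1, by have := (Finset.mem_Icc.1 hs).2; omega⟩)) hη) _
    have hδt := hδ t ht
    have hx0 : 0 < C * (N : ℝ) ^ (t - 2) * (∏ s ∈ Finset.Icc 1 (t - 1), (D s / η) ^ d s) / δ t := by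
      positivity
    have hx1 : C * (N : ℝ) ^ (t - 2) * (∏ s ∈ Finset.Icc 1 (t - 1), (D s / η) ^ d s) / δ t
        ≤ C * (N : ℝ) ^ (t - 2) * dm ^ (t - 1) / δm := by
      gcongr
      · exact prod_le_dMax_pow hD hη htT
      · exact minOver_le δ ht
    have hden : 0 < N * b ^ p * (g (t - 1) * (1 + ε)) := by positivity
    rcases le_or_gt (C * (N : ℝ) ^ (t - 2) * (∏ s ∈ Finset.Icc 1 (t - 1), (D s / η) ^ d s) / δ t) 1
      with hle | hgt1
    · rw [sqrt_nonpos_log_div_eq_zero hx0.le hle hden.le]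
      positivity
    -- Otherwise the argument of the logarithm is at most `C * dm / δm`, hence at most one because
    -- `C / δm ≤ N`, contrary to the case at hand.
    have hNd : 1 ≤ N * dm := by
      by_contra hlt
      rw [not_le] at hlt
      refine absurd hgt1 (not_lt.2 (hx1.trans ?_))
      rw [div_le_iff₀ hδm] at hNδ
      rw [div_le_one hδm]
      have h1 : (N : ℝ) ^ (t - 2) * dm ^ (t - 1) = (N * dm) ^ (t - 2) * dm := by
        rw [mul_pow, mul_assoc, ← pow_succ, show t - 2 + 1 = t - 1 by omega]
      have h2 : (N * dm) ^ (t - 2) ≤ 1 := pow_le_one₀ (by positivity) hlt.le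
      calc C * (N : ℝ) ^ (t - 2) * dm ^ (t - 1) = C * ((N * dm) ^ (t - 2) * dm) := by
            rw [mul_assoc, h1]
        _ ≤ C * (1 * dm) := by gcongr
        _ ≤ (N * δm) * dm := by rw [one_mul]; gcongr
        _ = (N * dm) * δm := by ring
        _ ≤ 1 * δm := by gcongr
        _ = δm := one_mul _
    have hx2 : C * (N : ℝ) ^ (t - 2) * dm ^ (t - 1) / δm
        ≤ C * (N : ℝ) ^ (T - 2) * dm ^ (T - 1) / δm := by
      have h1 : (N : ℝ) ^ (T - 2) * dm ^ (T - 1)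
          = (N : ℝ) ^ (t - 2) * dm ^ (t - 1) * (N * dm) ^ (T - t) := by
        rw [mul_pow, mul_mul_mul_comm, ← pow_add, ← pow_add, show t - 2 + (T - t) = T - 2 by omega,
          show t - 1 + (T - t) = T - 1 by omega]
      rw [mul_assoc, mul_assoc, h1]
      refine div_le_div_of_nonneg_right (mul_le_mul_of_nonneg_left ?_ hC0.le) hδm.le
      exact le_mul_of_one_le_right (by positivity) (one_le_pow₀ hNd)
    have hlog : Real.log
        (C * (N : ℝ) ^ (t - 2) * (∏ s ∈ Finset.Icc 1 (t - 1), (D s / η) ^ d s) / δ t)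
        ≤ Real.log (C * (N : ℝ) ^ (T - 2) * dm ^ (T - 1) / δm) :=
      Real.log_le_log hx0 (hx1.trans hx2)
    have hlog0 := Real.log_pos hgt1
    have hsqrt : rate p N ^ 2 * √Y = √(rate p N ^ 4 * Y) := by
      rw [Real.sqrt_mul (by positivity : 0 ≤ rate p N ^ 4),
        show rate p N ^ 4 = (rate p N ^ 2) ^ 2 by ring, Real.sqrt_sq (by positivity)]
    rw [hsqrt]
    refine Real.sqrt_le_sqrt ?_
    set ℓ := Real.log (C * (N : ℝ) ^ (T - 2) * dm ^ (T - 1) / δm)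
    have hℓ : 0 < ℓ := hlog0.trans_le hlog
    have hinv : (N * b ^ p)⁻¹ ≤ rate p N ^ 4 / c ^ p := by
      rw [inv_le_iff_one_le_mul₀ (by positivity), div_mul_eq_mul_div, le_div_iff₀ hcp]
      linarith
    have hσS : σ t ^ 2 ≤ S := le_maxOver (fun t => σ t ^ 2) ht
    calc _ ≤ S * (ℓ / (N * b ^ p * (gm * (1 + ε)))) := by
          gcongr
          exact minOver_le g hgt
      _ = (N * b ^ p)⁻¹ * (S / (gm * (1 + ε)) * ℓ) := by field_simp
      _ ≤ rate p N ^ 4 / c ^ p * (S / (gm * (1 + ε)) * ℓ) := by gcongr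
      _ = rate p N ^ 4 * Y := by rw [hY]; field_simp
  have hcard : (((Finset.Icc 2 T).card : ℕ) : ℝ) ≤ T := by
    rw [Nat.card_Icc]
    exact_mod_cast (by omega)
  have hX0 : 0 ≤ rate p N ^ 2 * √Y + 2 * Lm * η := by positivity
  calc errorTerm p T d σ L D δ g η C ε N b
      ≤ ∑ _t ∈ Finset.Icc 2 T, (rate p N ^ 2 * √Y + 2 * Lm * η) := by
        refine Finset.sum_le_sum fun t ht => add_le_add (hterm t ht) ?_
        have := le_maxOver L ht
        gcongr
    _ = (Finset.Icc 2 T).card * (rate p N ^ 2 * √Y + 2 * Lm * η) := by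
        rw [Finset.sum_const, nsmul_eq_mul]
    _ ≤ T * (rate p N ^ 2 * √Y + 2 * Lm * η) := by gcongr
    _ = asymptoticBound p T d σ L D δ g c η C ε N := by
        rw [asymptoticBound, rate_sq]
        ring

theorem rpow_three_half {x : ℝ} (hx : 0 ≤ x) : x ^ ((3 : ℝ) / 2) = x * √x := by
  rw [Real.sqrt_eq_rpow, show (3 : ℝ) / 2 = 1 + 1 / 2 by norm_num,
    Real.rpow_add_of_nonneg hx (by norm_num) (by norm_num), Real.rpow_one]

/-- Since `C`, `N` and `max 1 dMax` are at least one and the least `δ` is at most one, the argument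
of the first logarithm is at most the `T`-th power of that of the second. The exponent leaves the
logarithm as a factor `T` and the root as `√T`. -/
theorem asymptoticBound_le_rateBound (hT : 2 ≤ T) (hN : 1 ≤ N) (hC : 1 ≤ C)
    (hD : ∀ t ∈ Finset.Icc 1 T, 0 < D t)
    (hδ : ∀ t ∈ Finset.Icc 2 T, 0 < δ t ∧ δ t < 1)
    (hg : ∀ t ∈ Finset.Icc 1 (T - 1), 0 < g t) (hη : 0 < η) (hε : 0 < 1 + ε) (hc : 0 < c) :
    asymptoticBound p T d σ L D δ g c η C ε N ≤ rateBound p T d σ L D δ g c η C ε N := by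
  have hN' : (1 : ℝ) ≤ N := by exact_mod_cast hN
  have hN0 : (0 : ℝ) < N := by linarith
  have hT' : (1 : ℝ) ≤ T := by exact_mod_cast (by omega : 1 ≤ T)
  have h2T : 2 ∈ Finset.Icc 2 T := Finset.mem_Icc.2 ⟨le_rfl, hT⟩
  have hgm : 0 < minOver (Finset.Icc 1 (T - 1)) g :=
    minOver_pos ⟨1, Finset.mem_Icc.2 ⟨le_rfl, by omega⟩⟩ hg
  have hdm : 0 < dMax T d D η := dMax_pos hT hD hη
  have hδm : 0 < minOver (Finset.Icc 2 T) δ := minOver_pos ⟨2, h2T⟩ fun t ht => (hδ t ht).1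
  have hδ1 : minOver (Finset.Icc 2 T) δ ≤ 1 := (minOver_le δ h2T).trans (hδ 2 h2T).2.le
  have hS0 : 0 ≤ maxOver (Finset.Icc 2 T) (fun t => σ t ^ 2) :=
    (sq_nonneg (σ 2)).trans (le_maxOver (fun t => σ t ^ 2) h2T)
  rw [asymptoticBound, rateBound]
  set S : ℝ := maxOver (Finset.Icc 2 T) (fun t => σ t ^ 2)
  set gm : ℝ := minOver (Finset.Icc 1 (T - 1)) g
  set dm : ℝ := dMax T d D η
  set δm : ℝ := minOver (Finset.Icc 2 T) δ
  set w : ℝ := S / (c ^ p * gm * (1 + ε)) with hw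
  have hw0 : 0 ≤ w := by positivity
  set m : ℝ := max 1 dm with hm
  have hm1 : 1 ≤ m := le_max_left _ _
  have hlog : Real.log (C * (N : ℝ) ^ (T - 2) * dm ^ (T - 1) / δm)
      ≤ T * Real.log (C * N * m / δm) := by
    rw [← Real.log_pow]
    refine Real.log_le_log (by positivity) ?_
    have h1 : C ≤ C ^ T := le_self_pow₀ hC (by omega)
    have h2 : (N : ℝ) ^ (T - 2) ≤ (N : ℝ) ^ T := pow_le_pow_right₀ hN' (by omega)
    have h3 : dm ^ (T - 1) ≤ m ^ T := (pow_le_pow_left₀ hdm.le (le_max_right _ _) _).trans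
      (pow_le_pow_right₀ hm1 (by omega))
    have h4 : δm ^ T ≤ δm := pow_le_of_le_one hδm.le hδ1 (by omega)
    rw [div_pow, mul_pow, mul_pow]
    gcongr
  have hsqrt : √(w * Real.log (C * (N : ℝ) ^ (T - 2) * dm ^ (T - 1) / δm))
      ≤ √T * √(w * Real.log (C * N * m / δm)) := by
    rw [← Real.sqrt_mul (by positivity)]
    refine Real.sqrt_le_sqrt ?_
    calc _ ≤ w * (T * Real.log (C * N * m / δm)) := mul_le_mul_of_nonneg_left hlog hw0
      _ = _ := by ring
  rw [rpow_three_half (by positivity)]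
  gcongr ?_ + _
  calc _ ≤ (T : ℝ) / (N : ℝ) ^ ((2 : ℝ) / (p + 4)) * (√T * √(w * Real.log (C * N * m / δm))) := by
        gcongr
    _ = _ := by ring

theorem term_le_errorTerm (hL : ∀ t ∈ Finset.Icc 2 T, 0 < L t) (hη : 0 < η) {t : ℕ}
    (ht : t ∈ Finset.Icc 2 T) :
    √(σ t ^ 2 *
        (Real.log (C * (N : ℝ) ^ (t - 2) * (∏ s ∈ Finset.Icc 1 (t - 1), (D s / η) ^ d s) / δ t)
          / (N * b ^ p * (g (t - 1) * (1 + ε))))) + 2 * L t * η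
      ≤ errorTerm p T d σ L D δ g η C ε N b :=
  Finset.single_le_sum (f := fun t => √(σ t ^ 2 *
        (Real.log (C * (N : ℝ) ^ (t - 2) * (∏ s ∈ Finset.Icc 1 (t - 1), (D s / η) ^ d s) / δ t)
          / (N * b ^ p * (g (t - 1) * (1 + ε))))) + 2 * L t * η)
    (fun s hs => by
      have := hL s hs
      positivity) ht

/-- A lower bound for the error term that does not depend on `η ≤ 1`. -/
theorem le_errorTerm_of_le_one (hL : ∀ t ∈ Finset.Icc 2 T, 0 < L t)
    (hD : ∀ t ∈ Finset.Icc 1 T, 0 < D t) (hη : 0 < η) (hη1 : η ≤ 1) (hN : 1 ≤ N) (hC : 0 < C)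
    {B γ x : ℝ} (hb : 0 < b) (hNb : N * b ^ p * rate p N ^ 4 ≤ B) {t : ℕ}
    (ht : t ∈ Finset.Icc 2 T) (hσ : 0 ≤ σ t) (hδ : 0 < δ t) (hδ1 : δ t ≤ 1) (hg : 0 < g (t - 1))
    (hgγ : g (t - 1) ≤ γ) (hx : 1 ≤ x)
    (hxC : x ≤ C * (N : ℝ) ^ (t - 2) * ∏ s ∈ Finset.Icc 1 (t - 1), D s ^ d s) :
    σ t / √(B * γ) * (rate p N ^ 2 * √(Real.log x)) ≤ errorTerm p T d σ L D δ g η C 0 N b := by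
  have hN0 : (0 : ℝ) < N := by exact_mod_cast hN
  have hr := rate_pos p hN
  have hLt := hL t ht
  obtain ⟨ht2, htT⟩ := Finset.mem_Icc.1 ht
  have hDpos : ∀ s ∈ Finset.Icc 1 (t - 1), 0 < D s := fun s hs => hD s (by
    rw [Finset.mem_Icc] at hs ⊢
    omega)
  have hx' : x ≤ C * (N : ℝ) ^ (t - 2) * (∏ s ∈ Finset.Icc 1 (t - 1), (D s / η) ^ d s) / δ t := by
    have h1 : ∏ s ∈ Finset.Icc 1 (t - 1), D s ^ d s
        ≤ ∏ s ∈ Finset.Icc 1 (t - 1), (D s / η) ^ d s :=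
      Finset.prod_le_prod (fun s hs => (pow_pos (hDpos s hs) _).le) fun s hs =>
        pow_le_pow_left₀ (hDpos s hs).le (le_div_self (hDpos s hs).le hη hη1) _
    have h2 : 0 < ∏ s ∈ Finset.Icc 1 (t - 1), (D s / η) ^ d s :=
      Finset.prod_pos fun s hs => pow_pos (div_pos (hDpos s hs) hη) _
    calc x ≤ C * (N : ℝ) ^ (t - 2) * ∏ s ∈ Finset.Icc 1 (t - 1), D s ^ d s := hxC
      _ ≤ C * (N : ℝ) ^ (t - 2) * ∏ s ∈ Finset.Icc 1 (t - 1), (D s / η) ^ d s := by gcongr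
      _ ≤ _ := le_div_self (by positivity) hδ hδ1
  have hB : 0 < B := (by positivity : 0 < N * b ^ p * rate p N ^ 4).trans_le hNb
  have hγ : 0 < γ := hg.trans_le hgγ
  have hlogx : 0 ≤ Real.log x := Real.log_nonneg hx
  refine le_trans ?_ ((le_add_of_nonneg_right (by positivity)).trans (term_le_errorTerm hL hη ht))
  have h1 : σ t / √(B * γ) * (rate p N ^ 2 * √(Real.log x))
      = √(σ t ^ 2 * (rate p N ^ 4 * Real.log x / (B * γ))) := by
    rw [Real.sqrt_mul (sq_nonneg _), Real.sqrt_sq hσ, Real.sqrt_div (by positivity),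
      Real.sqrt_mul (by positivity : 0 ≤ rate p N ^ 4),
      show rate p N ^ 4 = (rate p N ^ 2) ^ 2 by ring, Real.sqrt_sq (by positivity)]
    ring
  rw [h1]
  refine Real.sqrt_le_sqrt (mul_le_mul_of_nonneg_left ?_ (sq_nonneg _))
  rw [add_zero, mul_one, div_le_div_iff₀ (by positivity) (by positivity)]
  have h2 : Real.log x
      ≤ Real.log (C * (N : ℝ) ^ (t - 2) * (∏ s ∈ Finset.Icc 1 (t - 1), (D s / η) ^ d s) / δ t) :=
    Real.log_le_log (by linarith) hx'
  calc rate p N ^ 4 * Real.log x * (N * b ^ p * g (t - 1))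
      = (N * b ^ p * rate p N ^ 4) * g (t - 1) * Real.log x := by ring
    _ ≤ B * γ * Real.log x := by gcongr
    _ ≤ B * γ * _ := mul_le_mul_of_nonneg_left h2 (by positivity)
    _ = _ := by ring

end Bounds

/-! ### The least density at the data points -/

section MinDensity

variable {p : ℕ} {prog : Program p} {T : ℕ} {Ξ : ℕ → Set (E p)} {μ : Measure (ℕ → E p)}
  {f : ℕ → E p × E p → ℝ} {Ω : Type*} [MeasurableSpace Ω] {P : Measure Ω} {X : ℕ → Ω → ℕ → E p}

theorem scaledDensity_eq (f : ℕ → E p × E p → ℝ) (t : ℕ) (u : E p) :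
    scaledDensity f t u = partialInt (f t) (fun _ => 1) u / (2 * ∫ ρ : E p, kern ρ ^ 2) := by
  rw [scaledDensity, partialInt_one]

theorem continuous_scaledDensity (hA : Assumptions prog T Ξ μ f) {t : ℕ} (h2 : 2 ≤ t)
    (ht : t < T) : Continuous (scaledDensity f t) := by
  obtain ⟨M, -, hf⟩ := hA.regularDensity h2 ht
  have := hf.continuous_partialInt (φ := fun _ => 1) measurable_const (B := 1) (by simp)
  simp only [funext (scaledDensity_eq f t)]
  fun_prop

/-- If the density of `ξ_t` vanishes on `s` up to a null set, then `ξ_t` almost surely avoids `s`,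
and conversely. -/
theorem ae_notMem_iff [IsProbabilityMeasure μ] (hA : Assumptions prog T Ξ μ f) {t : ℕ}
    (h2 : 2 ≤ t) (ht : t < T) {s : Set (E p)} (hs : MeasurableSet s) :
    (∀ᵐ y ∂μ, y t ∉ s) ↔ ∀ᵐ u : E p, u ∈ s → scaledDensity f t u = 0 := by
  obtain ⟨M, -, hf⟩ := hA.regularDensity h2 ht
  have hψm : Measurable (s.indicator fun _ => (1 : ℝ)) := measurable_const.indicator hs
  have hψ0 : ∀ u, 0 ≤ s.indicator (fun _ => (1 : ℝ)) u := fun u =>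
    Set.indicator_nonneg (fun _ _ => zero_le_one) u
  have hψ1 : ∀ u, |s.indicator (fun _ => (1 : ℝ)) u| ≤ 1 := fun u => by
    rw [abs_of_nonneg (hψ0 u)]
    exact Set.indicator_le_self' (fun _ _ => zero_le_one) u
  have hm0 : ∀ u, 0 ≤ partialInt (f t) (fun _ => 1) u := hf.partialInt_nonneg fun _ => zero_le_one
  have key := hf.integral_comp_fst (measurable_pi_apply t) (measurable_pi_apply (t + 1))
    (hA.density t h2 ht) hψm hψ1
  have hk := integral_kern_sq_pos (p := p)
  have e1 : (∀ᵐ y ∂μ, y t ∉ s) ↔ ∫ y, s.indicator (fun _ => (1 : ℝ)) (y t) ∂μ = 0 := by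
    rw [integral_eq_zero_iff_of_nonneg (fun y => hψ0 _)
      (integrable_of_abs_le (hψm.comp (measurable_pi_apply t)) fun y => hψ1 _)]
    refine eventually_congr (Eventually.of_forall fun y => ?_)
    simp
  have e2 : (∀ᵐ u : E p, u ∈ s → scaledDensity f t u = 0) ↔
      ∫ u, s.indicator (fun _ => (1 : ℝ)) u * partialInt (f t) (fun _ => 1) u = 0 := by
    rw [integral_eq_zero_iff_of_nonneg (fun u => mul_nonneg (hψ0 u) (hm0 u))
      ((hf.integrable_partialInt measurable_const (B := 1) (by simp)).bdd_mul (c := 1)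
        hψm.aestronglyMeasurable (Eventually.of_forall hψ1))]
    refine eventually_congr (Eventually.of_forall fun u => ?_)
    simp [scaledDensity_eq, hk.ne', imp_iff_not_or]
  rw [e1, e2, key]

theorem ae_scaledDensity_pos [IsProbabilityMeasure μ] (hA : Assumptions prog T Ξ μ f) {t : ℕ}
    (h2 : 2 ≤ t) (ht : t < T) :
    ∀ᵐ y ∂μ, 0 < scaledDensity f t (y t) := by
  obtain ⟨M, -, hf⟩ := hA.regularDensity h2 ht
  have hcont := continuous_scaledDensity hA h2 ht
  have hms : MeasurableSet {u : E p | scaledDensity f t u = 0} :=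
    measurableSet_eq_fun hcont.measurable measurable_const
  filter_upwards [(ae_notMem_iff hA h2 ht hms).2 (Eventually.of_forall fun u hu => hu)] with y hy
  refine lt_of_le_of_ne ?_ (Ne.symm hy)
  rw [scaledDensity_eq]
  exact div_nonneg (hf.partialInt_nonneg (fun _ => zero_le_one) _)
    (mul_nonneg zero_le_two integral_kern_sq_pos.le)

/-- The density takes arbitrarily small values with positive probability. -/
theorem not_ae_lt_scaledDensity [IsProbabilityMeasure μ] (hp : 1 ≤ p)
    (hA : Assumptions prog T Ξ μ f) {t : ℕ} (h2 : 2 ≤ t) (ht : t < T) {γ : ℝ} (hγ : 0 < γ) : ¬ ∀ᵐ y ∂μ, γ < scaledDensity f t (y t) := by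
  intro hall
  obtain ⟨M, -, hf⟩ := hA.regularDensity h2 ht
  have hcont := continuous_scaledDensity hA h2 ht
  have hms : MeasurableSet {u : E p | scaledDensity f t u ≤ γ} :=
    measurableSet_le hcont.measurable measurable_const
  have hae := (ae_notMem_iff hA h2 ht hms).1 (hall.mono fun y hy => not_le.2 hy)
  obtain ⟨y₀, hy₀⟩ := (ae_scaledDensity_pos hA h2 ht).exists
  have : Nontrivial (E p) := by
    have : Nonempty (Fin p) := ⟨⟨0, hp⟩⟩
    infer_instance
  obtain ⟨u₁, hu₁⟩ : ∃ u, u ∉ Ξ t := (Set.ne_univ_iff_exists_notMem _).1 hf.compact.ne_univ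
  have hu₁' : scaledDensity f t u₁ = 0 := by
    rw [scaledDensity_eq, hf.partialInt_eq_zero _ hu₁, zero_div]
  -- For `p ≥ 1` the space is not compact, so the density vanishes outside the uncertainty set,
  -- while it is positive at `y₀ t`. By connectedness it takes the value `v`, strictly between `0`
  -- and `γ`, and therefore lies in this range on a nonempty open set, which has positive
  -- probability.
  set v : ℝ := min γ (scaledDensity f t (y₀ t)) / 2 with hv
  have hv0 : 0 < v := half_pos (lt_min hγ hy₀)
  have hvγ : v < γ := by
    have := min_le_left γ (scaledDensity f t (y₀ t))
    linarith
  have hvy : v ≤ scaledDensity f t (y₀ t) := by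
    have := min_le_right γ (scaledDensity f t (y₀ t))
    linarith
  obtain ⟨u, hu⟩ := mem_range_of_exists_le_of_exists_ge hcont ⟨u₁, hu₁'.le.trans hv0.le⟩
    ⟨y₀ t, hvy⟩
  have hopen : IsOpen {u : E p | 0 < scaledDensity f t u ∧ scaledDensity f t u < γ} :=
    (isOpen_lt continuous_const hcont).inter (isOpen_lt hcont continuous_const)
  refine (hopen.measure_pos volume ⟨u, by rw [hu]; exact hv0, by rw [hu]; exact hvγ⟩).ne' ?_
  refine measure_mono_null (fun u hu => ?_) hae
  exact fun h => hu.1.ne' (h hu.2.le)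

theorem minDensity_of_two_le (f : ℕ → E p × E p → ℝ) (g₁ : ℝ) (data : ℕ → ℕ → E p) (N : ℕ) {t : ℕ}
    (ht : 2 ≤ t) : minDensity f g₁ data N t = ⨅ i : Fin N, scaledDensity f t (data i t) :=
  if_neg (by omega)

theorem minDensity_pos {g₁ : ℝ} (hg₁ : 0 < g₁) {data : ℕ → ℕ → E p} {N : ℕ} (hN : 1 ≤ N) {t : ℕ}
    (h : 2 ≤ t → ∀ i, 0 < scaledDensity f t (data i t)) : 0 < minDensity f g₁ data N t := by
  rcases le_or_gt t 1 with ht | ht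
  · rw [minDensity, if_pos ht]
    exact hg₁
  · rw [minDensity_of_two_le f g₁ data N ht]
    have : Nonempty (Fin N) := ⟨⟨0, hN⟩⟩
    obtain ⟨i, hi⟩ := exists_eq_ciInf_of_finite
      (f := fun i : Fin N => scaledDensity f t (data i t))
    rw [← hi]
    exact h ht i

/-- If the minimum exceeds `γ`, all `N` independent samples fall into one event of probability less
than one. This has probability at most `(μ A) ^ N`, which tends to zero. -/
theorem whp_minDensity_le [IsProbabilityMeasure μ] (hp : 1 ≤ p) (hA : Assumptions prog T Ξ μ f)
    (hX_meas : ∀ i, Measurable (X i)) (hX_law : ∀ i, P.map (X i) = μ) (hX_indep : iIndepFun X P)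
    (g₁ : ℝ) {t : ℕ} (h2 : 2 ≤ t) (ht : t < T) {γ : ℝ} (hγ : 0 < γ) :
    WHP P fun N ω => minDensity f g₁ (fun i => X i ω) N t ≤ γ := by
  have hcont := continuous_scaledDensity hA h2 ht
  set A : Set (ℕ → E p) := {y | γ < scaledDensity f t (y t)} with hA_def
  have hAm : MeasurableSet A :=
    measurableSet_lt measurable_const (hcont.measurable.comp (measurable_pi_apply t))
  have hlt : μ A < 1 := by
    refine lt_of_le_of_ne prob_le_one fun h1 => not_ae_lt_scaledDensity hp hA h2 ht hγ ?_
    exact (mem_ae_iff_prob_eq_one hAm).2 h1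
  refine tendsto_of_tendsto_of_tendsto_of_le_of_le tendsto_const_nhds
    (ENNReal.tendsto_pow_atTop_nhds_zero_of_lt_one hlt) (fun _ => zero_le) fun N => ?_
  have hprod := hX_indep.measure_inter_preimage_eq_mul (Finset.range N) (sets := fun _ => A)
    fun _ _ => hAm
  have hpre : ∀ i, P (X i ⁻¹' A) = μ A := fun i => by
    rw [← hX_law i, Measure.map_apply (hX_meas i) hAm]
  simp only [hpre, Finset.prod_const, Finset.card_range] at hprod
  refine le_trans (measure_mono fun ω hω => ?_) hprod.le
  refine Set.mem_iInter₂.2 fun i hi => ?_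
  refine lt_of_lt_of_le (not_le.1 hω) ?_
  rw [minDensity_of_two_le f g₁ _ N h2]
  exact ciInf_le (f := fun i : Fin N => scaledDensity f t (X i ω t)) (Set.finite_range _).bddBelow
    ⟨i, Finset.mem_range.1 hi⟩

end MinDensity

end DDMSLP

namespace DDMSLP

/-! ### The out-of-sample guarantee -/

section Guarantee

variable {p : ℕ}

/-- The factor `√(log N * rate ^ p)` is what the plain average gains over `rate ^ 2`. It tends to
zero for `p ≥ 1`, which settles the two-stage case. -/
theorem sqrt_log_div_eq {N : ℕ} (hN : 1 ≤ N) :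
    √(Real.log N / N) = rate p N ^ 2 * √(Real.log N * rate p N ^ p) := by
  have h1 := rate_pow_mul p hN
  have hr := rate_pos p hN
  have hN' : (N : ℝ) ≠ 0 := by positivity
  have h2 : Real.log N / N = (rate p N ^ 2) ^ 2 * (Real.log N * rate p N ^ p) := by
    rw [div_eq_iff hN']
    calc Real.log N = Real.log N * (rate p N ^ (p + 4) * N) := by rw [h1, mul_one]
      _ = _ := by rw [pow_add]; ring
  rw [h2, Real.sqrt_mul (sq_nonneg _), Real.sqrt_sq (sq_nonneg _)]

theorem sqrt_log_div_le {N : ℕ} (hN : 1 ≤ N) :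
    √(Real.log N / N) ≤ rate p N ^ 2 * √(Real.log N) := by
  rw [sqrt_log_div_eq (p := p) hN]
  have hlog : 0 ≤ Real.log N := Real.log_nonneg (by exact_mod_cast hN)
  refine mul_le_mul_of_nonneg_left (Real.sqrt_le_sqrt ?_) (sq_nonneg _)
  exact mul_le_of_le_one_right hlog (pow_le_one₀ (rate_pos p hN).le (rate_le_one p hN))

theorem tendsto_rate_sq_mul_sqrt_log (p : ℕ) :
    Tendsto (fun N : ℕ => rate p N ^ 2 * √(Real.log N)) atTop (𝓝 0) := by
  have h := (Real.continuous_sqrt.tendsto 0).comp (tendsto_log_mul_rate_pow p (k := 4) (by norm_num))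
  rw [Real.sqrt_zero] at h
  refine h.congr' ?_
  filter_upwards [eventually_ge_atTop 1] with N hN
  have hr := rate_pos p hN
  rw [Function.comp_apply, mul_comm (Real.log N), Real.sqrt_mul (by positivity),
    show rate p N ^ 4 = (rate p N ^ 2) ^ 2 by ring, Real.sqrt_sq (by positivity)]

/-- For large samples, the error term exceeds the order of the out-of-sample error. -/
theorem eventually_le_errorTerm (hp : 1 ≤ p) {T : ℕ} (hT : 2 ≤ T) {d : ℕ → ℕ} {σ L D δ : ℕ → ℝ}
    {c B C g₁ a A : ℝ} {h : ℕ → ℝ} (hh : IsBandwidth p c B h)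
    (hσ : ∀ t ∈ Finset.Icc 2 T, 0 < σ t) (hL : ∀ t ∈ Finset.Icc 2 T, 0 < L t)
    (hD : ∀ t ∈ Finset.Icc 1 T, 0 < D t) (hδ : ∀ t ∈ Finset.Icc 2 T, 0 < δ t ∧ δ t < 1)
    (hg₁ : 0 < g₁) (ha : 0 ≤ a) (hA : 0 ≤ A) (hAT : T = 2 → A = 0) (hC : 0 < C)
    (hC₂ : 2 ≤ C * ∏ s ∈ Finset.Icc 1 (2 - 1), D s ^ d s)
    (hC₃ : 1 ≤ C * ∏ s ∈ Finset.Icc 1 (3 - 1), D s ^ d s) :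
    ∃ γ : ℝ, 0 < γ ∧ ∀ᶠ N : ℕ in atTop, ∀ (η : ℝ) (g : ℕ → ℝ), 0 < η → g 1 = g₁ →
      (∀ t ∈ Finset.Icc 1 (T - 1), 0 < g t) → (2 < T → g 2 ≤ γ) →
      a * √(Real.log N / N) + A * (rate p N ^ 2 * √(Real.log N))
        ≤ errorTerm p T d σ L D δ g η C 0 N (h N) := by
  have h2T : 2 ∈ Finset.Icc 2 T := Finset.mem_Icc.2 ⟨le_rfl, hT⟩
  have hBp := pow_pos hh.pos' p
  -- Chosen so that `σ 3 / √(B ^ p * γ) = a + A + 1`: a density minimum below `γ` lifts the summand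
  -- `t = 3` above the required multiple of `rate ^ 2 * √(log N)`.
  set γ : ℝ := σ 3 ^ 2 / (B ^ p * (a + A + 1) ^ 2) with hγ
  rcases hT.eq_or_lt with rfl | hT3
  · refine ⟨1, one_pos, ?_⟩
    have hσ2 := hσ 2 h2T
    -- `rate ^ 2 * w` bounds the summand `t = 2` from below when `η ≤ 1`. The `log 2` comes from the
    -- requirement `2 ≤ C * D 1 ^ d 1`.
    set w : ℝ := σ 2 / √(B ^ p * g₁) * √(Real.log 2) with hw
    have hw0 : 0 < w := mul_pos (div_pos hσ2 (Real.sqrt_pos.2 (by positivity)))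
      (Real.sqrt_pos.2 (Real.log_pos one_lt_two))
    have hlim : Tendsto (fun N : ℕ => a * √(Real.log N * rate p N ^ p)) atTop (𝓝 0) := by
      have := ((Real.continuous_sqrt.tendsto 0).comp (tendsto_log_mul_rate_pow p hp)).const_mul a
      simpa using this
    have hlim' : Tendsto (fun N : ℕ => a * (rate p N ^ 2 * √(Real.log N))) atTop (𝓝 0) := by
      simpa using (tendsto_rate_sq_mul_sqrt_log p).const_mul a
    filter_upwards [hlim.eventually (ge_mem_nhds hw0), eventually_ge_atTop 1, hh.eventually_pos,
      hh.eventually_mul_pow_le, hlim'.eventually (ge_mem_nhds (mul_pos two_pos (hL 2 h2T)))]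
      with N hN1 hN hpos hle hN2 η g hη hg1 hg _
    rw [hAT rfl, zero_mul, add_zero]
    -- For `η ≤ 1` the factors `(D s / η) ^ d s` are at least `D s ^ d s`, so the root is bounded
    -- below uniformly in `η`. For `η > 1` the summand `2 * L 2 * η` suffices, since the left side
    -- tends to zero.
    rcases le_or_gt η 1 with hη1 | hη1
    · have key := le_errorTerm_of_le_one hL hD hη hη1 hN hC hpos hle h2T hσ2.le (hδ 2 h2T).1
        (hδ 2 h2T).2.le (g := g) (hg 1 (by simp)) hg1.le (x := 2) one_le_two
        (by simpa using hC₂)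
      refine le_trans ?_ key
      rw [sqrt_log_div_eq (p := p) hN]
      calc a * (rate p N ^ 2 * √(Real.log N * rate p N ^ p))
          = rate p N ^ 2 * (a * √(Real.log N * rate p N ^ p)) := by ring
        _ ≤ rate p N ^ 2 * w := mul_le_mul_of_nonneg_left hN1 (sq_nonneg _)
        _ = _ := by rw [hw]; ring
    · have h1 := (mul_le_mul_of_nonneg_left (sqrt_log_div_le (p := p) hN) ha).trans hN2
      refine h1.trans (le_trans ?_ (term_le_errorTerm hL hη h2T))
      have := hL 2 h2T
      nlinarith [Real.sqrt_nonneg (σ 2 ^ 2 * (Real.log (C * (N : ℝ) ^ (2 - 2)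
        * (∏ s ∈ Finset.Icc 1 (2 - 1), (D s / η) ^ d s) / δ 2)
          / (N * h N ^ p * (g (2 - 1) * (1 + 0)))))]
  · have h3T : 3 ∈ Finset.Icc 2 T := Finset.mem_Icc.2 ⟨by norm_num, hT3⟩
    have hσ3 := hσ 3 h3T
    have hγ0 : 0 < γ := by positivity
    refine ⟨γ, hγ0, ?_⟩
    have hlim : Tendsto (fun N : ℕ => (a + A) * (rate p N ^ 2 * √(Real.log N))) atTop (𝓝 0) := by
      simpa using (tendsto_rate_sq_mul_sqrt_log p).const_mul (a + A)
    filter_upwards [eventually_ge_atTop 1, hh.eventually_pos, hh.eventually_mul_pow_le,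
      hlim.eventually (ge_mem_nhds (mul_pos two_pos (hL 2 h2T)))]
      with N hN hpos hle hN2 η g hη _ hg hgγ
    have hN' : (1 : ℝ) ≤ N := by exact_mod_cast hN
    have hr0 : 0 ≤ rate p N ^ 2 * √(Real.log N) := by positivity
    have hsum : a * √(Real.log N / N) + A * (rate p N ^ 2 * √(Real.log N))
        ≤ (a + A) * (rate p N ^ 2 * √(Real.log N)) := by
      have := mul_le_mul_of_nonneg_left (sqrt_log_div_le (p := p) hN) ha
      linarith
    refine hsum.trans ?_
    rcases le_or_gt η 1 with hη1 | hη1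
    · have key := le_errorTerm_of_le_one hL hD hη hη1 hN hC hpos hle h3T hσ3.le (hδ 3 h3T).1
        (hδ 3 h3T).2.le (g := g) (hg 2 (Finset.mem_Icc.2 ⟨by norm_num, by omega⟩)) (hgγ hT3) hN' (by
          rw [mul_right_comm, show 3 - 2 = 1 from rfl, pow_one]
          exact le_mul_of_one_le_left (by positivity) hC₃)
      refine le_trans (mul_le_mul_of_nonneg_right ?_ hr0) key
      have h1 : √(B ^ p * γ) = σ 3 / (a + A + 1) := by
        rw [hγ, show B ^ p * (σ 3 ^ 2 / (B ^ p * (a + A + 1) ^ 2)) = (σ 3 / (a + A + 1)) ^ 2 by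
          field_simp]
        exact Real.sqrt_sq (by positivity)
      rw [h1, div_div_cancel₀ hσ3.ne']
      linarith
    · refine hN2.trans (le_trans ?_ (term_le_errorTerm hL hη h2T))
      have := hL 2 h2T
      nlinarith [Real.sqrt_nonneg (σ 2 ^ 2 * (Real.log (C * (N : ℝ) ^ (2 - 2)
        * (∏ s ∈ Finset.Icc 1 (2 - 1), (D s / η) ^ d s) / δ 2)
          / (N * h N ^ p * (g (2 - 1) * (1 + 0)))))]

/-- Supplies the `O(1)`. With `u` and `v` the products of `D s ^ d s` up to stages one and two, the
logarithms of the summands `t = 2` and `t = 3` are at least `log 2` and `log N` for every `η ≤ 1`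
and all `δ < 1`. Hence `C` can be fixed before the `δ t`. -/
theorem exists_constant_of_prod_pos {u v : ℝ} (hu : 0 < u) (hv : 0 < v) :
    ∃ C : ℝ, 1 ≤ C ∧ 2 ≤ C * u ∧ 1 ≤ C * v := by
  have h1 : 0 < u⁻¹ := inv_pos.2 hu
  have h2 : 0 < v⁻¹ := inv_pos.2 hv
  refine ⟨1 + 2 * u⁻¹ + v⁻¹, by linarith, ?_, ?_⟩
  · nlinarith [inv_mul_cancel₀ hu.ne', mul_pos h2 hu]
  · nlinarith [inv_mul_cancel₀ hv.ne', mul_pos h1 hv]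

end Guarantee

end DDMSLP

/-! ### The theorem. -/

theorem mainTheorem6 {p : ℕ} (hp : 1 ≤ p) (T : ℕ) (hT : 2 ≤ T)
    -- the true problem
    (prog : DDMSLP.Program p) (Ξ : ℕ → Set (DDMSLP.E p))
    (μ : Measure (ℕ → DDMSLP.E p)) [IsProbabilityMeasure μ]
    (f : ℕ → DDMSLP.E p × DDMSLP.E p → ℝ)
    (hA : DDMSLP.Assumptions prog T Ξ μ f)
    -- independent historical trajectories
    {Ω : Type*} [MeasurableSpace Ω] (P : Measure Ω) [IsProbabilityMeasure P]
    (X : ℕ → Ω → ℕ → DDMSLP.E p)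
    (hX_meas : ∀ i, Measurable (X i)) (hX_law : ∀ i, P.map (X i) = μ) (hX_indep : iIndepFun X P)
    -- the bandwidth, of the order `N ^ (-1 / (p + 4))`
    (h : ℕ → ℝ) (c : ℝ) (hc : 0 < c)
    (h_upper : h =O[atTop] fun N : ℕ => (N : ℝ) ^ (-(1 : ℝ) / (p + 4)))
    (h_lower : ∀ᶠ N : ℕ in atTop, c * (N : ℝ) ^ (-(1 : ℝ) / (p + 4)) ≤ h N)
    -- the constants of the problem
    (σ L D : ℕ → ℝ) (g₁ : ℝ)
    (hσ_pos : ∀ t ∈ Finset.Icc 2 T, 0 < σ t) (hσ : DDMSLP.IsVarianceBound prog T Ξ μ f σ)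
    (hL_pos : ∀ t ∈ Finset.Icc 2 T, 0 < L t) (hL : DDMSLP.IsLipschitzBound prog T Ξ μ f L)
    (hD_pos : ∀ t ∈ Finset.Icc 1 T, 0 < D t) (hD : DDMSLP.IsDiameterBound prog T Ξ D)
    (hg₁ : 0 < g₁) :
    -- "with probability at least 1 - ∑ δ" bounds the probability of the complement
    ∃ C : ℝ, 1 ≤ C ∧ ∀ δ : ℕ → ℝ, (∀ t ∈ Finset.Icc 2 T, 0 < δ t ∧ δ t < 1) →
      (∃ ε : ℕ → ℝ, Tendsto ε atTop (𝓝 0) ∧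
        ∀ᶠ N : ℕ in atTop, ∀ η : ℝ, 0 < η →
          P {ω | ¬ (DDMSLP.outOfSampleError prog T μ f (fun i => X i ω) N (h N)
                      ≤ DDMSLP.errorTerm p T prog.d σ L D δ
                          (DDMSLP.minDensity f g₁ (fun i => X i ω) N) η C (ε N) N (h N)
                  ∧ DDMSLP.errorTerm p T prog.d σ L D δ
                          (DDMSLP.minDensity f g₁ (fun i => X i ω) N) η C (ε N) N (h N)
                      ≤ DDMSLP.asymptoticBound p T prog.d σ L D δ
                          (DDMSLP.minDensity f g₁ (fun i => X i ω) N) c η C (ε N) N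
                  ∧ DDMSLP.asymptoticBound p T prog.d σ L D δ
                          (DDMSLP.minDensity f g₁ (fun i => X i ω) N) c η C (ε N) N
                      ≤ DDMSLP.rateBound p T prog.d σ L D δ
                          (DDMSLP.minDensity f g₁ (fun i => X i ω) N) c η C (ε N) N)}
            ≤ ENNReal.ofReal (∑ t ∈ Finset.Icc 2 T, δ t)) ∧
      (∃ K : ℝ, 0 < K ∧ ∀ᶠ N : ℕ in atTop,
          P {ω | ¬ (DDMSLP.outOfSampleError prog T μ f (fun i => X i ω) N (h N)
                      ≤ K * ((T : ℝ) ^ ((3 : ℝ) / 2) / (N : ℝ) ^ ((2 : ℝ) / (p + 4)))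
                          * Real.sqrt (Real.log N))}
            ≤ ENNReal.ofReal (∑ t ∈ Finset.Icc 2 T, δ t)) := by
  obtain ⟨B, hh⟩ := DDMSLP.exists_isBandwidth hc h_upper h_lower
  obtain ⟨a, A, ha, hA0, hAT, hw⟩ := DDMSLP.exists_whp_outOfSampleError_le hA hX_meas hX_law
    hX_indep hh hL_pos hL hT
  -- The range up to `T + 1` admits `t = 3` even when `T = 2`.
  have hprod : ∀ t ≤ T + 1, 0 < ∏ s ∈ Finset.Icc 1 (t - 1), D s ^ prog.d s := fun t ht =>
    Finset.prod_pos fun s hs => pow_pos (hD_pos s (by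
      rw [Finset.mem_Icc] at hs ⊢
      omega)) _
  obtain ⟨C, hC1, hC2, hC3⟩ :=
    DDMSLP.exists_constant_of_prod_pos (hprod 2 (by omega)) (hprod 3 (by omega))
  have hC0 : 0 < C := by linarith
  have h2T : 2 ∈ Finset.Icc 2 T := Finset.mem_Icc.2 ⟨le_rfl, hT⟩
  refine ⟨C, hC1, fun δ hδ => ?_⟩
  have hδsum : 0 < ENNReal.ofReal (∑ t ∈ Finset.Icc 2 T, δ t) :=
    ENNReal.ofReal_pos.2 (Finset.sum_pos (fun t ht => (hδ t ht).1) ⟨2, h2T⟩)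
  have hδm : 0 < DDMSLP.minOver (Finset.Icc 2 T) δ :=
    DDMSLP.minOver_pos ⟨2, h2T⟩ fun t ht => (hδ t ht).1
  constructor
  · obtain ⟨γ, hγ, hlow⟩ := DDMSLP.eventually_le_errorTerm hp hT (d := prog.d) (δ := δ) hh hσ_pos
      hL_pos hD_pos hδ hg₁ ha hA0 hAT hC0 hC2 hC3
    have hdens : ∀ᵐ ω ∂P, ∀ i, ∀ t ∈ Set.Ico 2 T,
        0 < DDMSLP.scaledDensity f t (X i ω t) := by
      refine ae_all_iff.2 fun i => (ae_ball_iff (Set.to_countable _)).2 fun t ht => ?_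
      refine ae_of_ae_map (p := fun y : ℕ → DDMSLP.E p => 0 < DDMSLP.scaledDensity f t (y t))
        (hX_meas i).aemeasurable ?_
      rw [hX_law i]
      exact DDMSLP.ae_scaledDensity_pos hA ht.1 ht.2
    have hsmall : DDMSLP.WHP P fun N ω => 2 < T →
        DDMSLP.minDensity f g₁ (fun i => X i ω) N 2 ≤ γ := by
      by_cases h3 : 2 < T
      · exact (DDMSLP.whp_minDensity_le hp hA hX_meas hX_law hX_indep g₁ le_rfl h3 hγ).mono
          (Eventually.of_forall fun N ω hω _ => hω)
      · exact DDMSLP.WHP.of_ae (Eventually.of_forall fun _ h => absurd h h3) |>.mono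
          (Eventually.of_forall fun N ω (_ : 2 < T → False) h => absurd h h3)
    -- The error term dominates the rate with room to spare, so the `o(1)` can be taken to be zero.
    refine ⟨fun _ => 0, tendsto_const_nhds, ?_⟩
    filter_upwards [((hw.and hsmall).and (DDMSLP.WHP.of_ae hdens)).eventually_le hδsum, hlow,
      eventually_ge_atTop 1, hh.eventually_pos, hh.eventually_le_mul_pow,
      tendsto_natCast_atTop_atTop.eventually_ge_atTop (C / DDMSLP.minOver (Finset.Icc 2 T) δ)]
      with N hP hlow hN hpos hle hNδ η hη
    refine le_trans (measure_mono ?_) hP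
    intro ω hω hgood
    refine hω ?_
    obtain ⟨⟨herr, hγω⟩, hdω⟩ := hgood
    have hg : ∀ t ∈ Finset.Icc 1 (T - 1), 0 < DDMSLP.minDensity f g₁ (fun i => X i ω) N t :=
      fun t ht => DDMSLP.minDensity_pos hg₁ hN fun h2 i => hdω i t ⟨h2, by
        have := (Finset.mem_Icc.1 ht).2
        omega⟩
    refine ⟨herr.trans (hlow η _ hη (if_pos le_rfl) hg hγω), ?_, ?_⟩
    · exact DDMSLP.errorTerm_le_asymptoticBound hT hN hC1 hσ_pos hL_pos hD_pos
        (fun t ht => (hδ t ht).1) hg hη (by norm_num) hc hpos hle hNδ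
    · exact DDMSLP.asymptoticBound_le_rateBound hT hN hC1 hD_pos hδ hg hη (by norm_num) hc
  -- The summand `1` only makes the constant positive.
  · refine ⟨a + A + 1, by positivity, ?_⟩
    filter_upwards [hw.eventually_le hδsum, eventually_ge_atTop 1] with N hP hN
    refine le_trans (measure_mono ?_) hP
    intro ω hω hgood
    refine hω (le_trans hgood ?_)
    have hT1 : 1 ≤ (T : ℝ) ^ ((3 : ℝ) / 2) :=
      Real.one_le_rpow (by exact_mod_cast (by omega : 1 ≤ T)) (by norm_num)
    have hN' : (0 : ℝ) < N := by exact_mod_cast hN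
    have hr0 : 0 ≤ DDMSLP.rate p N ^ 2 * Real.sqrt (Real.log N) := by positivity
    have h1 := mul_le_mul_of_nonneg_left (DDMSLP.sqrt_log_div_le (p := p) hN) ha
    calc a * Real.sqrt (Real.log N / N) + A * (DDMSLP.rate p N ^ 2 * Real.sqrt (Real.log N))
        ≤ (a + A + 1) * (1 * (DDMSLP.rate p N ^ 2 * Real.sqrt (Real.log N))) := by linarith
      _ ≤ (a + A + 1) * ((T : ℝ) ^ ((3 : ℝ) / 2)
          * (DDMSLP.rate p N ^ 2 * Real.sqrt (Real.log N))) := by gcongr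
      _ = _ := by
        rw [DDMSLP.rate_sq]
        ring
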